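/- Let $V$ be an entire function, real on $\mathbb R$, and for a probability measure $\rho$ on $\mathbb R$ let $m_\rho(z)=\int_{\mathbb R}\frac{d\rho(x)}{x-z}$ be its Stieltjes transform. Say that $\rho$ has *square-root behaviour at the right edge* $E\in\mathbb R$ if $\rho$ is supported in $(-\infty,E]$ and there are a neighbourhood $\mathcal N$ of $E$ in $\mathbb C$ and functions $A,B$ analytic in $\mathcal N$, with $E$ a simple root of $B$, such that $m_\rho=A+\sqrt B$ on $\mathcal N\cap\mathbb C_+$ for an analytic branch of $\sqrt B$ on this set. A *solution of the McKean–Vlasov equation* on $[0,T]$ is a weakly continuous path $(\hat\rho_t)_{0\le t\le T}$ of probability measures, all supported in one compact interval, whose Stieltjes transforms $\hat m_t$ satisfy, for all $t\in[0,T]$ and $z\in\mathbb C_+$, $$\partial_t \hat m_t(z)=\partial_z\hat m_t(z)\Big(\hat m_t(z)+\frac{V'(z)}2\Big)+\frac{\hat m_t(z)V''(z)}2+\int_{\mathbb R} g(z,x)\,d\hat\rho_t(x),$$ where $g(z,x)=\frac{V'(x)-V'(z)-(x-z)V''(z)}{2(x-z)^2}$ for $x\ne z$ and $g(x,x)=\frac{V'''(x)}4$.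 Let $\hat\rho_0$ be a compactly supported probability measure with square-root behaviour at the right edge $E_0$. Then there are $T_0>0$, $\varepsilon>0$ and $L$, depending only on $V$ and $\hat\rho_0$, such that for every $0<T\le T_0$ and every solution $(\hat\rho_t)_{0\le t\le T}$ of the McKean–Vlasov equation with initial data $\hat\rho_0$ there are real numbers $E_t$ (equal to $E_0$ at $t=0$) and $C_t>0$, $0\le t\le T$, such that: 1. for every $t\in[0,T]$, $\hat\rho_t$ has square-root behaviour at the right edge $E_t$; 2. for every $t\in[0,T]$ the integral $\hat m_t(E_t)=\int\frac{d\hat\rho_t(x)}{x-E_t}$ converges absolutely, $t\mapsto E_t$ is differentiable on $[0,T]$ (one-sidedly at the end points), and $$\partial_tE_t=-\hat m_t(E_t)-\frac{V'(E_t)}2;$$ 3. $|E_t-E_s|\le L|t-s|$ for all $s,t\in[0,T]$; 4. for every $t\in[0,T]$, $\hat\rho_t$ has a density on $[E_t-\varepsilon,E_t+\varepsilon]$, and this density satisfies $\hat\rho_t(x)=(1+o(1))\,C_t\sqrt{[E_t-x]_+}$ as $x\to E_t$, uniformly in $t\in[0,T]$; 5. $|C_t-C_s|\le L|t-s|$ for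 all $s,t\in[0,T]$. -/

import Mathlib

open MeasureTheory Set Filter Topology

namespace McKeanVlasov

/-- The Stieltjes transform `m(z) = ∫ (x - z)⁻¹ dρ(x)`. -/
noncomputable def stieltjes (ρ : ProbabilityMeasure ℝ) (z : ℂ) : ℂ :=
  ∫ x : ℝ, 1 / ((x : ℂ) - z) ∂(ρ : Measure ℝ)

/-- The kernel `g(z,x) = (V'(x) - V'(z) - (x - z) V''(z)) / (2 (x - z)²)`, with the value
`V'''(x) / 4` on the diagonal. -/
noncomputable def kernel (V : ℂ → ℂ) (z x : ℂ) : ℂ :=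
  if x = z then iteratedDeriv 3 V x / 4
  else (deriv V x - deriv V z - (x - z) * iteratedDeriv 2 V z) / (2 * (x - z) ^ 2)

/-- A potential: an entire function that is real on the real line. -/
structure IsPotential (V : ℂ → ℂ) : Prop where
  entire : Differentiable ℂ V
  real_on_real : ∀ x : ℝ, (V (x : ℂ)).im = 0

/-- The measure `ρ` is carried by `[-b, b]`. -/
def CarriedBy (ρ : ProbabilityMeasure ℝ) (b : ℝ) : Prop :=
  (ρ : Measure ℝ) (Icc (-b) b)ᶜ = 0

/-- `ρ` has square root behaviour at the right edge `E`: it is supported in `(-∞, E]`, and in a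
neighbourhood `U` of `E` its Stieltjes transform (a function on the upper half plane) is
`A + √B` with `A`, `B` analytic in `U` and `E` a simple root of `B`.
The function `S` is the branch of `√B` on `U ∩ {Im z > 0}`. -/
def HasSqrtEdge (ρ : ProbabilityMeasure ℝ) (E : ℝ) : Prop :=
  (ρ : Measure ℝ) (Ioi E) = 0 ∧
  ∃ (U : Set ℂ) (A B S : ℂ → ℂ), IsOpen U ∧ (E : ℂ) ∈ U ∧
    AnalyticOnNhd ℂ A U ∧ AnalyticOnNhd ℂ B U ∧
    B E = 0 ∧ deriv B E ≠ 0 ∧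
    AnalyticOnNhd ℂ S (U ∩ {z : ℂ | 0 < z.im}) ∧
    ∀ z ∈ U, 0 < z.im → S z ^ 2 = B z ∧ stieltjes ρ z = A z + S z

/-- `(ρ t)`, `0 ≤ t ≤ T`, is a solution of the McKean-Vlasov equation with potential `V`: a weakly
continuous path of probability measures, carried by a common compact interval, whose Stieltjes
transforms `m_t` satisfy, for `Im z > 0`,
`∂ₜ m_t(z) = ∂_z m_t(z) (m_t(z) + V'(z)/2) + m_t(z) V''(z)/2 + ∫ g(z,x) dρ_t(x)`. -/
structure IsSolution (V : ℂ → ℂ) (T : ℝ) (ρ : ℝ → ProbabilityMeasure ℝ) : Prop where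
  continuousOn : ContinuousOn ρ (Icc 0 T)
  carried : ∃ b : ℝ, ∀ t ∈ Icc 0 T, CarriedBy (ρ t) b
  equation : ∀ t ∈ Icc 0 T, ∀ z : ℂ, 0 < z.im →
    HasDerivWithinAt (fun s : ℝ => stieltjes (ρ s) z)
      (deriv (stieltjes (ρ t)) z * (stieltjes (ρ t) z + deriv V z / 2)
        + stieltjes (ρ t) z * iteratedDeriv 2 V z / 2
        + ∫ x : ℝ, kernel V z (x : ℂ) ∂(ρ t : Measure ℝ))
      (Icc 0 T) t

end McKeanVlasov

/-! For u = m + V'/2 the equation becomes a forced complex Burgers equation, ∂ₜu = u ∂_z u + F_t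
with F_t(z) = ∫ g(z,x) dρ_t(x) − V'(z)V''(z)/4. Because V is entire and the measures are carried by
a common compact set, F_t is entire, however singular m_t may be. The characteristics Z' = −U, U' =
F_t(Z) can therefore be started from a curve of initial data that passes through the edge, and they
are followed in a Banach space of holomorphic functions (`exists_flow`). Along characteristics that
remain in the upper half plane, Gronwall's inequality gives m_t(Z) + V'(Z)/2 = U
(`IsSolution.eq_along_characteristic`).

In the coordinate s = √(z − E₀) the initial transform extends to a holomorphic k with real Taylor
coefficients, and k'(0) = c > 0 because Im m ≥ 0 above the axis
(`HasSqrtEdge.exists_uniformization`). The flow started at Z = E₀ + s² with U = k + V'/2 stays a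
small perturbation of this fold. A nearby fold has one nondegenerate real critical point σ_t, and
Z_t = E_t + ζ² in a new real coordinate ζ, where E_t = Z_t(σ_t) (`exists_fold`). Since U' ≈ c > 0,
characteristics with Im s > 0 move downwards, so one that lies in the upper half plane at time t has
been there ever since time 0. Hence near E_t the function m_t + V'/2 is a real holomorphic function
G of √(z − E_t) (`IsSolution.exists_edgeChart`).

The local claims are read off from this chart. The even and odd parts of G give A and √B. Stieltjes
inversion gives a density with leading coefficient C_t = G'(0)/π, where G'(0) =
U_t'(σ_t)(Z_t''(σ_t)/2)^(−1/2). The critical point does not contribute to the derivative of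
Z_t(σ_t), so ∂ₜE_t = −U_t(σ_t) = −G(0) = −m_t(E_t) − V'(E_t)/2. Lipschitz bounds follow from Cauchy
estimates on Z and U.

Two global facts remain. The support must stay in a range fixed by the initial data, so that all
times and constants are uniform over solutions, and no mass may appear to the right of E_t. Both
rest on finite speed of propagation (`exists_time_measure_Ioo_eq_zero`): characteristics started
over a gap of the initial measure keep Im m_t = O(Im z) there, and inversion then shows that the gap
persists on a smaller interval. -/

namespace McKeanVlasov

open Metric Complex
open scoped ComplexConjugate NNReal

/-! ### Holomorphic functions that commute with conjugation -/

/-- `f` is holomorphic on the disc of radius `r` about `0` and commutes there with complex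
conjugation. -/
structure RealHol (f : ℂ → ℂ) (r : ℝ) : Prop where
  diff : DifferentiableOn ℂ f (ball 0 r)
  symm : ∀ s ∈ ball (0 : ℂ) r, f (conj s) = conj (f s)

lemma conj_mem_ball_zero {s : ℂ} {r : ℝ} (hs : s ∈ ball (0 : ℂ) r) : conj s ∈ ball (0 : ℂ) r := by
  simpa using hs

lemma ofReal_mem_ball_zero {x r : ℝ} (hx : |x| < r) : (x : ℂ) ∈ ball (0 : ℂ) r := by
  simpa using hx

namespace RealHol

variable {f g : ℂ → ℂ} {r r' : ℝ}

lemma mono (hf : RealHol f r) (h : r' ≤ r) : RealHol f r' :=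
  ⟨hf.diff.mono (ball_subset_ball h), fun s hs => hf.symm s (ball_subset_ball h hs)⟩

lemma differentiableAt (hf : RealHol f r) {s : ℂ} (hs : s ∈ ball (0 : ℂ) r) :
    DifferentiableAt ℂ f s :=
  hf.diff.differentiableAt (isOpen_ball.mem_nhds hs)

lemma deriv (hf : RealHol f r) : RealHol (deriv f) r := by
  refine ⟨hf.diff.deriv isOpen_ball, fun s hs => ?_⟩
  have h1 : (conj ∘ f ∘ conj) =ᶠ[𝓝 s] f := by
    filter_upwards [isOpen_ball.mem_nhds hs] with w hw
    simp [hf.symm w hw]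
  have h2 := h1.deriv_eq
  rw [deriv_conj_conj] at h2
  have := congrArg conj h2
  simpa using this

lemma im_ofReal (hf : RealHol f r) {x : ℝ} (hx : (x : ℂ) ∈ ball (0 : ℂ) r) : (f x).im = 0 := by
  have := hf.symm x hx
  rw [conj_ofReal] at this
  exact conj_eq_iff_im.mp this.symm

lemma add (hf : RealHol f r) (hg : RealHol g r) : RealHol (fun s => f s + g s) r :=
  ⟨hf.diff.add hg.diff, fun s hs => by simp [hf.symm s hs, hg.symm s hs]⟩

lemma mul (hf : RealHol f r) (hg : RealHol g r) : RealHol (fun s => f s * g s) r :=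
  ⟨hf.diff.mul hg.diff, fun s hs => by simp [hf.symm s hs, hg.symm s hs]⟩

lemma ofReal (x : ℝ) : RealHol (fun _ => (x : ℂ)) r :=
  ⟨differentiableOn_const _, fun s _ => by simp⟩

lemma id : RealHol (fun s => s) r := ⟨differentiableOn_id, fun _ _ => rfl⟩

lemma comp (hf : RealHol f r) (hg : RealHol g r') (h : ∀ s ∈ ball (0 : ℂ) r', g s ∈ ball (0 : ℂ) r) :
    RealHol (fun s => f (g s)) r' :=
  ⟨hf.diff.comp hg.diff h, fun s hs => by rw [hg.symm s hs, hf.symm _ (h s hs)]⟩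

end RealHol

/-- Cauchy's estimate on a smaller concentric disc. -/
lemma norm_deriv_le_of_ball {f : ℂ → ℂ} {c : ℂ} {r r' M : ℝ} (hf : DifferentiableOn ℂ f (ball c r))
    (hM : ∀ s ∈ ball c r, ‖f s‖ ≤ M) (h : r' < r) {s : ℂ} (hs : s ∈ ball c r') :
    ‖deriv f s‖ ≤ M / (r - r') := by
  have hsub : closedBall s (r - r') ⊆ ball c r := fun w hw => by
    rw [mem_ball] at hs ⊢
    rw [mem_closedBall] at hw
    linarith [dist_triangle w s c]
  refine norm_deriv_le_of_forall_mem_sphere_norm_le (by linarith)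
    ((hf.mono (closure_ball_subset_closedBall.trans hsub)).diffContOnCl)
    fun w hw => hM w (hsub (sphere_subset_closedBall hw))

lemma norm_image_sub_le_of_ball {f : ℂ → ℂ} {c : ℂ} {r K : ℝ}
    (hf : DifferentiableOn ℂ f (ball c r)) (hK : ∀ s ∈ ball c r, ‖deriv f s‖ ≤ K) {s w : ℂ}
    (hs : s ∈ ball c r) (hw : w ∈ ball c r) : ‖f w - f s‖ ≤ K * ‖w - s‖ :=
  (convex_ball c r).norm_image_sub_le_of_norm_deriv_le
    (fun _ hx => hf.differentiableAt (isOpen_ball.mem_nhds hx)) hK hs hw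

/-- If `f' ≈ c` then `Im f ≈ c Im`. -/
lemma RealHol.abs_im_sub_le {f : ℂ → ℂ} {r c d : ℝ} (hf : RealHol f r)
    (hd : ∀ s ∈ ball (0 : ℂ) r, ‖_root_.deriv f s - c‖ ≤ d) {s : ℂ} (hs : s ∈ ball (0 : ℂ) r) :
    |(f s).im - c * s.im| ≤ d * |s.im| := by
  have hg : DifferentiableOn ℂ (fun s => f s - c * s) (ball 0 r) :=
    hf.diff.sub (differentiableOn_id.const_mul _)
  have h1 := norm_image_sub_le_of_ball hg (K := d) (fun w hw => by
    have : _root_.deriv (fun s => f s - c * s) w = _root_.deriv f w - c := by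
      have := ((hf.differentiableAt hw).hasDerivAt.fun_sub ((hasDerivAt_id w).const_mul (c : ℂ))).deriv
      simpa using this
    rw [this]; exact hd w hw) (conj_mem_ball_zero hs) hs
  have e1 : f s - c * s - (f (conj s) - c * conj s) = (2 * ((f s).im - c * s.im) : ℝ) * I := by
    rw [hf.symm s hs]
    apply Complex.ext
    · simp
    · simp; ring
  have e2 : s - conj s = (2 * s.im : ℝ) * I := by
    apply Complex.ext <;> simp; ring
  rw [e1, e2] at h1
  simp only [norm_mul, norm_I, mul_one, norm_real, Real.norm_eq_abs, abs_two] at h1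
  linarith

lemma RealHol.abs_im_le {f : ℂ → ℂ} {r d : ℝ} (hf : RealHol f r)
    (hd : ∀ s ∈ ball (0 : ℂ) r, ‖_root_.deriv f s‖ ≤ d) {s : ℂ} (hs : s ∈ ball (0 : ℂ) r) :
    |(f s).im| ≤ d * |s.im| := by
  simpa using hf.abs_im_sub_le (c := 0) (by simpa using hd) hs

/-! ### Quantitative inversion near the identity -/

section NearIdentity

variable {f : ℂ → ℂ} {r : ℝ}

/-- Cauchy's estimate from the disc to its half turns the distance r/8 into (r/8)/(r/2) = 1/4. The
map f − id is then a contraction, which is the source of injectivity, surjectivity and preservation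
of half planes in what follows. -/
lemma norm_deriv_sub_one_le (hf : DifferentiableOn ℂ f (ball 0 r))
    (h : ∀ s ∈ ball (0 : ℂ) r, ‖f s - s‖ ≤ r / 8) {s : ℂ} (hs : s ∈ ball (0 : ℂ) (r / 2)) :
    ‖deriv f s - 1‖ ≤ 1 / 4 := by
  have hr : 0 < r := by
    have := pos_of_mem_ball hs
    linarith
  have hg : DifferentiableOn ℂ (fun s => f s - s) (ball 0 r) := hf.sub differentiableOn_id
  have h1 := norm_deriv_le_of_ball hg h (by linarith : r / 2 < r) hs
  have hd : deriv (fun s => f s - s) s = deriv f s - 1 :=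
    ((hf.differentiableAt (isOpen_ball.mem_nhds (ball_subset_ball (by linarith) hs))).hasDerivAt.sub
      (hasDerivAt_id s)).deriv
  rw [hd] at h1
  refine h1.trans (le_of_eq ?_)
  field_simp
  norm_num

lemma norm_image_sub_sub_le (hf : DifferentiableOn ℂ f (ball 0 r))
    (h : ∀ s ∈ ball (0 : ℂ) r, ‖f s - s‖ ≤ r / 8) {s w : ℂ} (hs : s ∈ ball (0 : ℂ) (r / 2))
    (hw : w ∈ ball (0 : ℂ) (r / 2)) : ‖(f w - w) - (f s - s)‖ ≤ 1 / 4 * ‖w - s‖ := by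
  have hr : 0 < r := by
    have := pos_of_mem_ball hs
    linarith
  have hsub : ball (0 : ℂ) (r / 2) ⊆ ball 0 r := ball_subset_ball (by linarith)
  refine norm_image_sub_le_of_ball (f := fun s => f s - s)
    ((hf.sub differentiableOn_id).mono hsub) (fun v hv => ?_) hs hw
  have hd : deriv (fun s => f s - s) v = deriv f v - 1 :=
    ((hf.differentiableAt (isOpen_ball.mem_nhds (hsub hv))).hasDerivAt.sub
      (hasDerivAt_id v)).deriv
  rw [hd]
  exact norm_deriv_sub_one_le hf h hv

lemma norm_sub_le_of_near_id (hf : DifferentiableOn ℂ f (ball 0 r))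
    (h : ∀ s ∈ ball (0 : ℂ) r, ‖f s - s‖ ≤ r / 8) {s w : ℂ} (hs : s ∈ ball (0 : ℂ) (r / 2))
    (hw : w ∈ ball (0 : ℂ) (r / 2)) : ‖w - s‖ ≤ 2 * ‖f w - f s‖ := by
  have h1 := norm_image_sub_sub_le hf h hs hw
  have h2 : ‖w - s‖ ≤ ‖f w - f s‖ + ‖(f w - w) - (f s - s)‖ := by
    have : w - s = (f w - f s) - ((f w - w) - (f s - s)) := by ring
    rw [this]
    exact norm_sub_le _ _
  have := norm_nonneg (w - s)
  linarith

/-- A preimage of ζ is a fixed point of s ↦ ζ − (f s − s). This map contracts by 1/4, and it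
preserves the disc of radius r/4 because r/8 + r/8 = r/4. -/
lemma exists_preimage_of_near_id (hr : 0 < r) (hf : DifferentiableOn ℂ f (ball 0 r))
    (h : ∀ s ∈ ball (0 : ℂ) r, ‖f s - s‖ ≤ r / 8) {ζ : ℂ} (hζ : ‖ζ‖ ≤ r / 8) :
    ∃ s ∈ closedBall (0 : ℂ) (r / 4), f s = ζ := by
  have hsub : closedBall (0 : ℂ) (r / 4) ⊆ ball 0 (r / 2) := closedBall_subset_ball (by linarith)
  have hsub' : ball (0 : ℂ) (r / 2) ⊆ ball 0 r := ball_subset_ball (by linarith)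
  let T : ℂ → ℂ := fun s => ζ - (f s - s)
  have hmaps : MapsTo T (closedBall 0 (r / 4)) (closedBall 0 (r / 4)) := fun s hs => by
    rw [mem_closedBall_zero_iff]
    have := h s (hsub' (hsub hs))
    have := norm_sub_le ζ (f s - s)
    simp only [T]
    linarith
  have hc : ContractingWith (1 / 4) (hmaps.restrict T _ _) := by
    refine ⟨by norm_num, LipschitzWith.of_dist_le_mul fun a b => ?_⟩
    have := norm_image_sub_sub_le hf h (hsub b.2) (hsub a.2)
    rw [Subtype.dist_eq, Subtype.dist_eq, dist_eq_norm, dist_eq_norm]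
    simp only [MapsTo.val_restrict_apply, T]
    rw [show ζ - (f a - a) - (ζ - (f b - b)) = -((f a - a) - (f b - b)) by ring, norm_neg]
    simpa using this
  obtain ⟨s, hs, hfix, -⟩ := hc.exists_fixedPoint' isClosed_closedBall.isComplete hmaps
    (x := 0) (by simpa using by linarith) (edist_ne_top _ _)
  refine ⟨s, hs, ?_⟩
  have : ζ - (f s - s) = s := hfix
  linear_combination -this

lemma im_pos_of_near_id (hf : RealHol f r) (h : ∀ s ∈ ball (0 : ℂ) r, ‖f s - s‖ ≤ r / 8) {s : ℂ}
    (hs : s ∈ ball (0 : ℂ) (r / 2)) : |(f s).im - s.im| ≤ 1 / 4 * |s.im| := by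
  have hr : 0 < r := by
    have := pos_of_mem_ball hs
    linarith
  have := (hf.mono (by linarith : r / 2 ≤ r)).abs_im_sub_le (c := 1) (d := 1 / 4)
    (fun s hs => by simpa using norm_deriv_sub_one_le hf.diff h hs) hs
  simpa using this

lemma im_pos_iff_of_near_id (hf : RealHol f r) (h : ∀ s ∈ ball (0 : ℂ) r, ‖f s - s‖ ≤ r / 8)
    {s : ℂ} (hs : s ∈ ball (0 : ℂ) (r / 2)) : 0 < (f s).im ↔ 0 < s.im := by
  have h1 := abs_le.1 (im_pos_of_near_id hf h hs)
  rcases abs_cases s.im with ⟨h2, h3⟩ | ⟨h2, h3⟩ <;> rw [h2] at h1 <;>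
    constructor <;> intro h4 <;> linarith

/-- A real holomorphic map close to the identity has a real holomorphic inverse. -/
lemma exists_inverse_of_near_id (hr : 0 < r) (hf : RealHol f r)
    (h : ∀ s ∈ ball (0 : ℂ) r, ‖f s - s‖ ≤ r / 8) :
    ∃ ψ : ℂ → ℂ, RealHol ψ (r / 8) ∧ ∀ ζ ∈ ball (0 : ℂ) (r / 8),
      ψ ζ ∈ closedBall (0 : ℂ) (r / 4) ∧ f (ψ ζ) = ζ ∧ (0 < ζ.im → 0 < (ψ ζ).im) ∧
      HasDerivAt ψ (deriv f (ψ ζ))⁻¹ ζ := by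
  have hsub : closedBall (0 : ℂ) (r / 4) ⊆ ball 0 (r / 2) := closedBall_subset_ball (by linarith)
  have hex : ∀ ζ : ℂ, ∃ s, ζ ∈ ball (0 : ℂ) (r / 8) → s ∈ closedBall (0 : ℂ) (r / 4) ∧ f s = ζ := by
    intro ζ
    by_cases hζ : ζ ∈ ball (0 : ℂ) (r / 8)
    · obtain ⟨s, h1, h2⟩ := exists_preimage_of_near_id hr hf.diff h
        (mem_ball_zero_iff.1 hζ).le
      exact ⟨s, fun _ => ⟨h1, h2⟩⟩
    · exact ⟨0, fun h => (hζ h).elim⟩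
  choose ψ hψ using hex
  have hder : ∀ ζ ∈ ball (0 : ℂ) (r / 8), HasDerivAt ψ (deriv f (ψ ζ))⁻¹ ζ := by
    intro ζ hζ
    have hmem := hsub (hψ ζ hζ).1
    have hnhds : ball (0 : ℂ) (r / 8) ∈ 𝓝 ζ := isOpen_ball.mem_nhds hζ
    refine HasDerivAt.of_local_left_inverse (f := f) ?_ ?_ ?_ ?_
    · rw [ContinuousAt, Metric.tendsto_nhds_nhds]
      intro ε hε
      obtain ⟨δ, hδ, hb⟩ := Metric.mem_nhds_iff.1 hnhds
      refine ⟨min δ (ε / 2), by positivity, fun {w} hw => ?_⟩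
      have hw' : w ∈ ball (0 : ℂ) (r / 8) := hb (mem_ball.2 (hw.trans_le (min_le_left _ _)))
      have h1 := norm_sub_le_of_near_id hf.diff h hmem (hsub (hψ w hw').1)
      rw [(hψ w hw').2, (hψ ζ hζ).2] at h1
      rw [dist_eq_norm] at hw ⊢
      linarith [hw.trans_le (min_le_right _ _)]
    · exact (hf.differentiableAt (ball_subset_ball (by linarith) hmem)).hasDerivAt
    · intro h0
      have := norm_deriv_sub_one_le hf.diff h hmem
      rw [h0] at this
      norm_num at this
    · filter_upwards [hnhds] with w hw using (hψ w hw).2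
  refine ⟨ψ, ⟨fun ζ hζ => (hder ζ hζ).differentiableAt.differentiableWithinAt, ?_⟩,
    fun ζ hζ => ⟨(hψ ζ hζ).1, (hψ ζ hζ).2, fun him => ?_, hder ζ hζ⟩⟩
  · intro ζ hζ
    have hζ' := conj_mem_ball_zero hζ
    have hmem := hsub (hψ ζ hζ).1
    have h1 := norm_sub_le_of_near_id hf.diff h (conj_mem_ball_zero hmem) (hsub (hψ _ hζ').1)
    rw [(hψ _ hζ').2, hf.symm _ (ball_subset_ball (by linarith) hmem), (hψ ζ hζ).2, sub_self,
      norm_zero, mul_zero] at h1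
    exact sub_eq_zero.1 (norm_le_zero_iff.1 h1)
  · rw [← im_pos_iff_of_near_id hf h (hsub (hψ ζ hζ).1), (hψ ζ hζ).2]
    exact him

end NearIdentity

/-! ### Characteristics as an ODE in a Banach space of holomorphic functions -/

/-- The Picard-Lindelöf theorem with the information that the solution stays in the ball. -/
lemma exists_solution_mem_closedBall {E : Type*} [NormedAddCommGroup E] [NormedSpace ℝ E]
    [CompleteSpace E] {f : ℝ → E → E} {tmin tmax : ℝ} {t₀ : Icc tmin tmax} {x₀ : E} {a L K : ℝ≥0}
    (hf : IsPicardLindelof f t₀ x₀ a 0 L K) :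
    ∃ α : ℝ → E, α t₀ = x₀ ∧ (∀ t, α t ∈ closedBall x₀ a) ∧
      ∀ t ∈ Icc tmin tmax, HasDerivWithinAt α (f t (α t)) (Icc tmin tmax) t := by
  have hx : x₀ ∈ closedBall x₀ ((0 : ℝ≥0) : ℝ) := mem_closedBall_self le_rfl
  obtain ⟨α, hα⟩ := ODE.FunSpace.exists_isFixedPt_next hf hx
  refine ⟨α.compProj, by rw [ODE.FunSpace.compProj_val, ← hα, ODE.FunSpace.next_apply₀],
    fun t => α.compProj_mem_closedBall hf.mul_max_le, fun t ht ↦ ?_⟩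
  apply ODE.hasDerivWithinAt_picard_Icc t₀.2 hf.continuousOn_uncurry
    α.continuous_compProj.continuousOn (fun _ _ ↦ α.compProj_mem_closedBall hf.mul_max_le)
    x₀ ht |>.congr_of_mem _ ht
  intro t' ht'
  nth_rw 1 [← hα]
  rw [ODE.FunSpace.compProj_of_mem ht', ODE.FunSpace.next_apply]

/-- The extension by zero of a function on the closed disc. -/
noncomputable def zeroExtend {r : ℝ} (f : C(closedBall (0 : ℂ) r, ℂ)) (s : ℂ) : ℂ :=
  open Classical in if h : s ∈ closedBall (0 : ℂ) r then f ⟨s, h⟩ else 0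

lemma zeroExtend_of_mem {r : ℝ} (f : C(closedBall (0 : ℂ) r, ℂ)) {s : ℂ}
    (h : s ∈ closedBall (0 : ℂ) r) : zeroExtend f s = f ⟨s, h⟩ := dif_pos h

lemma zeroExtend_of_mem_ball {r : ℝ} (f : C(closedBall (0 : ℂ) r, ℂ)) {s : ℂ}
    (h : s ∈ ball (0 : ℂ) r) : zeroExtend f s = f ⟨s, ball_subset_closedBall h⟩ :=
  zeroExtend_of_mem f _

/-- The real Banach space of continuous functions on the closed disc that are holomorphic in the
interior and commute there with conjugation. -/
noncomputable def realHolSubmodule (r : ℝ) : Submodule ℝ C(closedBall (0 : ℂ) r, ℂ) where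
  carrier := {f | RealHol (zeroExtend f) r}
  add_mem' {f g} hf hg := by
    have h := hf.add hg
    refine ⟨h.diff.congr fun s hs => ?_, fun s hs => ?_⟩
    · simp [zeroExtend_of_mem_ball _ hs]
    · have := h.symm s hs
      rw [zeroExtend_of_mem_ball _ hs] at this ⊢
      rw [zeroExtend_of_mem_ball _ (conj_mem_ball_zero hs)] at this ⊢
      simpa [zeroExtend_of_mem_ball _ hs, zeroExtend_of_mem_ball _ (conj_mem_ball_zero hs)]
        using this
  zero_mem' := by
    have : zeroExtend (0 : C(closedBall (0 : ℂ) r, ℂ)) = fun _ => ((0 : ℝ) : ℂ) := by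
      ext s; simp [zeroExtend]
    show RealHol _ r
    rw [this]
    exact RealHol.ofReal 0
  smul_mem' c f hf := by
    have : zeroExtend (c • f) = fun s => (c : ℂ) * zeroExtend f s := by
      ext s
      simp only [zeroExtend]
      split_ifs <;> simp
    show RealHol _ r
    rw [this]
    exact (RealHol.ofReal c).mul hf

/-- Uniform limits of holomorphic functions are holomorphic. Closedness makes the space complete, as
Picard–Lindelöf requires. -/
lemma isClosed_realHolSubmodule (r : ℝ) :
    IsClosed (realHolSubmodule r : Set C(closedBall (0 : ℂ) r, ℂ)) := by
  refine IsSeqClosed.isClosed fun f g hf hg => ?_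
  have hlim : ∀ s ∈ ball (0 : ℂ) r,
      Tendsto (fun n => zeroExtend (f n) s) atTop (𝓝 (zeroExtend g s)) := fun s hs => by
    simp only [zeroExtend_of_mem_ball _ hs]
    exact ((continuous_eval_const _).tendsto g).comp hg
  refine ⟨?_, fun s hs => ?_⟩
  · refine TendstoLocallyUniformlyOn.differentiableOn (F := fun n => zeroExtend (f n)) (φ := atTop)
      (TendstoUniformlyOn.tendstoLocallyUniformlyOn ?_)
      (Eventually.of_forall fun n => (hf n).diff) isOpen_ball
    rw [ContinuousMap.tendsto_iff_tendstoUniformly] at hg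
    rw [Metric.tendstoUniformlyOn_iff]
    intro ε hε
    filter_upwards [Metric.tendstoUniformly_iff.1 hg ε hε] with n hn s hs
    rw [zeroExtend_of_mem_ball _ hs, zeroExtend_of_mem_ball _ hs]
    exact hn _
  · refine tendsto_nhds_unique (hlim _ (conj_mem_ball_zero hs)) ?_
    have := (Complex.continuous_conj.tendsto _).comp (hlim s hs)
    refine this.congr fun n => ?_
    exact ((hf n).symm s hs).symm

instance (r : ℝ) : CompleteSpace (realHolSubmodule r) :=
  (isClosed_realHolSubmodule r).completeSpace_coe

/-- The element of `realHolSubmodule r` given by a real holomorphic function that is continuous on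
the closed disc. -/
noncomputable def realHolMk {r : ℝ} (f : ℂ → ℂ) (hf : RealHol f r)
    (hc : ContinuousOn f (closedBall 0 r)) : realHolSubmodule r :=
  ⟨⟨fun s => f s, hc.domRestrict⟩, by
    have h : ∀ s ∈ ball (0 : ℂ) r,
        zeroExtend (⟨fun s => f s, hc.domRestrict⟩ : C(closedBall (0 : ℂ) r, ℂ)) s = f s :=
      fun s hs => zeroExtend_of_mem_ball _ hs
    exact ⟨hf.diff.congr h, fun s hs => by
      rw [h s hs, h _ (conj_mem_ball_zero hs), hf.symm s hs]⟩⟩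

/-- Composition with a real entire function. -/
noncomputable def realHolComp {r : ℝ} (F : ℂ → ℂ) (hF : Differentiable ℂ F)
    (hs : ∀ z, F (conj z) = conj (F z)) (f : realHolSubmodule r) : realHolSubmodule r :=
  ⟨⟨fun s => F (f.1 s), hF.continuous.comp f.1.continuous⟩, by
    have h : ∀ s ∈ ball (0 : ℂ) r,
        zeroExtend (⟨fun s => F (f.1 s), hF.continuous.comp f.1.continuous⟩ :
          C(closedBall (0 : ℂ) r, ℂ)) s = F (zeroExtend f.1 s) :=
      fun s hs => by simp [zeroExtend_of_mem_ball _ hs]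
    exact ⟨(hF.comp_differentiableOn f.2.diff).congr h, fun s hs' => by
      rw [h s hs', h _ (conj_mem_ball_zero hs'), f.2.symm s hs', hs]⟩⟩

/-- A forcing term: entire and real in the space variable, jointly continuous, bounded and
Lipschitz on the disc of radius `R`. -/
structure IsForcing (F : ℝ → ℂ → ℂ) (T R M K : ℝ) : Prop where
  diff : ∀ t ∈ Icc 0 T, Differentiable ℂ (F t)
  symm : ∀ t ∈ Icc 0 T, ∀ z, F t (conj z) = conj (F t z)
  cont : ContinuousOn (Function.uncurry F) (Icc 0 T ×ˢ univ)
  bound : ∀ t ∈ Icc 0 T, ∀ z ∈ closedBall (0 : ℂ) R, ‖F t z‖ ≤ M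
  lip : ∀ t ∈ Icc 0 T, ∀ z ∈ closedBall (0 : ℂ) R, ∀ w ∈ closedBall (0 : ℂ) R,
    ‖F t z - F t w‖ ≤ K * ‖z - w‖

/-- The characteristics `Z' = -U`, `U' = F_t(Z)` that start on the curve `s ↦ (h s, k s)`. -/
structure IsFlow (F : ℝ → ℂ → ℂ) (T r R N : ℝ) (h k : ℂ → ℂ) (Z U : ℝ → ℂ → ℂ) : Prop where
  init : ∀ s ∈ ball (0 : ℂ) r, Z 0 s = h s ∧ U 0 s = k s
  holZ : ∀ t ∈ Icc 0 T, RealHol (Z t) r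
  holU : ∀ t ∈ Icc 0 T, RealHol (U t) r
  derivZ : ∀ t ∈ Icc 0 T, ∀ s ∈ ball (0 : ℂ) r,
    HasDerivWithinAt (fun τ => Z τ s) (-U t s) (Icc 0 T) t
  derivU : ∀ t ∈ Icc 0 T, ∀ s ∈ ball (0 : ℂ) r,
    HasDerivWithinAt (fun τ => U τ s) (F t (Z t s)) (Icc 0 T) t
  boundZ : ∀ t ∈ Icc 0 T, ∀ s ∈ ball (0 : ℂ) r, ‖Z t s‖ ≤ R
  boundU : ∀ t ∈ Icc 0 T, ∀ s ∈ ball (0 : ℂ) r, ‖U t s‖ ≤ N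

/-- The whole family of characteristics is one solution curve of an ODE for pairs of functions on
the disc. Holomorphy in s and the conjugation symmetry come from the choice of the space, with no
separate argument for dependence on the initial point. -/
theorem exists_flow {F : ℝ → ℂ → ℂ} {T r R N M K : ℝ} (hT : 0 ≤ T) (hr : 0 < r)
    (hF : IsForcing F T R M K) {h k : ℂ → ℂ} (hh : RealHol h r)
    (hhc : ContinuousOn h (closedBall 0 r)) (hk : RealHol k r)
    (hkc : ContinuousOn k (closedBall 0 r)) (hR : ∀ s ∈ closedBall (0 : ℂ) r, ‖h s‖ + 1 ≤ R)
    (hN : ∀ s ∈ closedBall (0 : ℂ) r, ‖k s‖ + 1 ≤ N) (hTN : T * N ≤ 1) (hTM : T * M ≤ 1) :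
    ∃ Z U : ℝ → ℂ → ℂ, IsFlow F T r R N h k Z U := by
  have h0 : (0 : ℂ) ∈ closedBall (0 : ℂ) r := mem_closedBall_self hr.le
  have hR0 : 0 ≤ R := by linarith [hR 0 h0, norm_nonneg (h 0)]
  have hN0 : 0 ≤ N := by linarith [hN 0 h0, norm_nonneg (k 0)]
  have hM0 : 0 ≤ M := (norm_nonneg _).trans (hF.bound 0 ⟨le_rfl, hT⟩ 0 (mem_closedBall_self hR0))
  -- Time is clamped to [0,T], where alone `F t` is known to be entire and symmetric, so that the
  -- vector field `v` is defined for every real time.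
  let π : ℝ → ℝ := fun t => projIcc 0 T hT t
  have hπ : ∀ t, π t ∈ Icc 0 T := fun t => (projIcc 0 T hT t).2
  have hπe : ∀ t ∈ Icc 0 T, π t = t := fun t ht => by simp [π, projIcc_of_mem hT ht]
  let v : ℝ → realHolSubmodule r × realHolSubmodule r → realHolSubmodule r × realHolSubmodule r :=
    fun t p => (-p.2, realHolComp (F (π t)) (hF.diff _ (hπ t)) (hF.symm _ (hπ t)) p.1)
  let x₀ : realHolSubmodule r × realHolSubmodule r := (realHolMk h hh hhc, realHolMk k hk hkc)
  have hball : ∀ p ∈ closedBall x₀ 1, ∀ s : closedBall (0 : ℂ) r,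
      ‖p.1.1 s‖ ≤ R ∧ ‖p.2.1 s‖ ≤ N := by
    intro p hp s
    rw [mem_closedBall, dist_eq_norm] at hp
    have h1 : ‖p.1.1 s - h s‖ ≤ 1 :=
      ((p.1.1 - x₀.1.1).norm_coe_le_norm s).trans ((norm_fst_le (p - x₀)).trans hp)
    have h2 : ‖p.2.1 s - k s‖ ≤ 1 :=
      ((p.2.1 - x₀.2.1).norm_coe_le_norm s).trans ((norm_snd_le (p - x₀)).trans hp)
    constructor
    · linarith [hR s s.2, norm_le_norm_add_norm_sub' (p.1.1 s) (h s)]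
    · linarith [hN s s.2, norm_le_norm_add_norm_sub' (p.2.1 s) (k s)]
  let L : ℝ≥0 := ⟨max N M, le_max_of_le_left hN0⟩
  -- On the unit ball about the initial pair the field is bounded by max N M, so T·N ≤ 1 and T·M ≤ 1
  -- keep the solution in that ball. This explains the margins of one in the hypotheses on h and k.
  have hPL : IsPicardLindelof v (⟨0, le_rfl, hT⟩ : Icc 0 T) x₀ 1 0 L (max 1 K.toNNReal) := by
    refine ⟨fun t _ => LipschitzOnWith.of_dist_le_mul fun p hp q hq => ?_, fun p hp => ?_,
      fun t _ p hp => ?_, ?_⟩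
    · rw [Prod.dist_eq, dist_eq_norm, dist_eq_norm]
      have hd1 : ‖p.1 - q.1‖ ≤ dist p q := by rw [dist_eq_norm]; exact norm_fst_le (p - q)
      have hd2 : ‖p.2 - q.2‖ ≤ dist p q := by rw [dist_eq_norm]; exact norm_snd_le (p - q)
      have hd0 : 0 ≤ dist p q := dist_nonneg
      refine max_le ?_ ?_
      · have : ‖(v t p).1 - (v t q).1‖ = ‖p.2 - q.2‖ := by
          simp only [v]
          rw [← norm_neg]; congr 1; abel
        rw [this]
        refine hd2.trans (le_mul_of_one_le_left hd0 ?_)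
        simp
      · have hK : K ≤ ((max 1 K.toNNReal : ℝ≥0) : ℝ) := by
          simp
        refine (ContinuousMap.norm_le _ (by positivity)).2 fun s => ?_
        have h1 := hF.lip _ (hπ t) _ (mem_closedBall_zero_iff.2 (hball p hp s).1) _
          (mem_closedBall_zero_iff.2 (hball q hq s).1)
        refine h1.trans ?_
        have h2 : ‖p.1.1 s - q.1.1 s‖ ≤ dist p q :=
          ((p.1.1 - q.1.1).norm_coe_le_norm s).trans hd1
        gcongr
    · have hg : Continuous fun t : ℝ => (v t p).2.1 := by
        have hc : Continuous (Function.uncurry fun (t : ℝ) (s : closedBall (0 : ℂ) r) =>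
            F (π t) (p.1.1 s)) := by
          have : Continuous fun q : ℝ × closedBall (0 : ℂ) r => (π q.1, p.1.1 q.2) :=
            (continuous_subtype_val.comp (continuous_projIcc.comp continuous_fst)).prodMk
              (p.1.1.continuous.comp continuous_snd)
          exact hF.cont.comp_continuous this fun q => ⟨hπ _, mem_univ _⟩
        exact (ContinuousMap.curry ⟨_, hc⟩).continuous
      exact (continuous_const.prodMk (Continuous.subtype_mk hg _)).continuousOn
    · rw [Prod.norm_def]
      refine max_le ?_ ?_
      · have : ‖(v t p).1‖ = ‖p.2‖ := by simp only [v]; rw [norm_neg]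
        rw [this]
        refine (ContinuousMap.norm_le _ L.2).2 fun s => ?_
        exact (hball p hp s).2.trans (le_max_left _ _)
      · refine (ContinuousMap.norm_le _ L.2).2 fun s => ?_
        exact (hF.bound _ (hπ t) _ (mem_closedBall_zero_iff.2 (hball p hp s).1)).trans
          (le_max_right _ _)
    · have : max N M * T ≤ 1 := by
        rcases max_cases N M with ⟨h, -⟩ | ⟨h, -⟩ <;> rw [h] <;> linarith
      have h2 : max (T - 0) (0 - 0) = T := by simp [hT]
      show max N M * max (T - 0) (0 - 0) ≤ ((1 : ℝ≥0) : ℝ) - ((0 : ℝ≥0) : ℝ)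
      rw [h2]
      simpa using this
  obtain ⟨α, hα0, hαm, hα⟩ := exists_solution_mem_closedBall hPL
  have hderiv1 : ∀ t ∈ Icc 0 T, ∀ s : closedBall (0 : ℂ) r,
      HasDerivWithinAt (fun τ => (α τ).1.1 s) ((v t (α t)).1.1 s) (Icc 0 T) t := by
    intro t ht s
    let ℓ : realHolSubmodule r × realHolSubmodule r →L[ℝ] ℂ :=
      (ContinuousMap.evalCLM ℝ s).comp
        ((realHolSubmodule r).subtypeL.comp (ContinuousLinearMap.fst ℝ _ _))
    exact ℓ.hasFDerivAt.comp_hasDerivWithinAt t (hα t ht)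
  have hderiv2 : ∀ t ∈ Icc 0 T, ∀ s : closedBall (0 : ℂ) r,
      HasDerivWithinAt (fun τ => (α τ).2.1 s) ((v t (α t)).2.1 s) (Icc 0 T) t := by
    intro t ht s
    let ℓ : realHolSubmodule r × realHolSubmodule r →L[ℝ] ℂ :=
      (ContinuousMap.evalCLM ℝ s).comp
        ((realHolSubmodule r).subtypeL.comp (ContinuousLinearMap.snd ℝ _ _))
    exact ℓ.hasFDerivAt.comp_hasDerivWithinAt t (hα t ht)
  have hα0' : α 0 = x₀ := hα0
  refine ⟨fun t => zeroExtend (α t).1.1, fun t => zeroExtend (α t).2.1, ?_, fun t _ => (α t).1.2,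
    fun t _ => (α t).2.2, fun t ht s hs => ?_, fun t ht s hs => ?_, fun t _ s hs => ?_,
    fun t _ s hs => ?_⟩
  · intro s hs
    rw [zeroExtend_of_mem_ball _ hs, zeroExtend_of_mem_ball _ hs, hα0']
    exact ⟨rfl, rfl⟩
  · simp only [zeroExtend_of_mem_ball _ hs]
    exact hderiv1 t ht ⟨s, ball_subset_closedBall hs⟩
  · simp only [zeroExtend_of_mem_ball _ hs]
    have := hderiv2 t ht ⟨s, ball_subset_closedBall hs⟩
    simp only [v, realHolComp, hπe t ht] at this
    exact this
  · rw [zeroExtend_of_mem_ball _ hs]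
    exact (hball _ (hαm t) _).1
  · rw [zeroExtend_of_mem_ball _ hs]
    exact (hball _ (hαm t) _).2

/-! ### The kernel and the forcing term as entire functions -/

/-- A continuous family of entire functions, integrated against a finite measure carried by a
compact set, is entire. -/
lemma differentiable_integral_of_continuous {ν : Measure ℝ} [IsFiniteMeasure ν] {S : Set ℝ}
    (hS : IsCompact S) (hν : ∀ᵐ x ∂ν, x ∈ S) {g : ℂ → ℝ → ℂ} (hg : Continuous (Function.uncurry g))
    (hd : ∀ x, Differentiable ℂ fun z => g z x) : Differentiable ℂ fun z => ∫ x, g z x ∂ν := by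
  intro z₀
  obtain ⟨C, hC⟩ := ((isCompact_closedBall z₀ 2).prod hS).exists_bound_of_continuousOn
    hg.continuousOn
  have hg1 : ∀ z, Continuous (g z) := fun z => hg.comp (continuous_const.prodMk continuous_id)
  have hm := measurable_deriv_with_param (𝕜 := ℂ) (f := fun (x : ℝ) (z : ℂ) => g z x)
    (hg.comp continuous_swap)
  refine (hasDerivAt_integral_of_dominated_loc_of_deriv_le (F' := fun z x => deriv (fun z => g z x) z)
    (bound := fun _ => C) (ball_mem_nhds z₀ one_pos)
    (Eventually.of_forall fun z => (hg1 z).aestronglyMeasurable) ?_ ?_ ?_ (integrable_const _)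
    ?_).2.differentiableAt
  · refine Integrable.of_bound (hg1 z₀).aestronglyMeasurable C ?_
    filter_upwards [hν] with x hx
    exact hC (z₀, x) ⟨mem_closedBall_self zero_le_two, hx⟩
  · exact (hm.comp (measurable_id.prodMk measurable_const)).aestronglyMeasurable
  · filter_upwards [hν] with x hx z hz
    have := norm_deriv_le_of_ball (M := C) (hd x).differentiableOn
      (fun w hw => hC (w, x) ⟨ball_subset_closedBall hw, hx⟩) one_lt_two hz
    norm_num at this
    exact this
  · exact Eventually.of_forall fun x z _ => ((hd x) z).hasDerivAt

namespace IsPotential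

variable {V : ℂ → ℂ}

lemma differentiable_iteratedDeriv (hV : IsPotential V) (n : ℕ) :
    Differentiable ℂ (iteratedDeriv n V) :=
  (hV.entire.contDiff (n := ⊤)).differentiable_iteratedDeriv n (by exact_mod_cast WithTop.coe_lt_top _)

lemma differentiable_deriv (hV : IsPotential V) : Differentiable ℂ (deriv V) := by
  simpa [iteratedDeriv_one] using hV.differentiable_iteratedDeriv 1

lemma hasDerivAt_deriv (hV : IsPotential V) (z : ℂ) :
    HasDerivAt (deriv V) (iteratedDeriv 2 V z) z := by
  rw [show iteratedDeriv 2 V = deriv (deriv V) by rw [iteratedDeriv_succ, iteratedDeriv_one]]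
  exact (hV.differentiable_deriv z).hasDerivAt

lemma hasDerivAt_iteratedDeriv_two (hV : IsPotential V) (z : ℂ) :
    HasDerivAt (iteratedDeriv 2 V) (iteratedDeriv 3 V z) z := by
  have := (hV.differentiable_iteratedDeriv 2 z).hasDerivAt
  rwa [← iteratedDeriv_succ] at this

/-- Schwarz reflection: z ↦ conj V(conj z) is entire and agrees with V at the real points 1/(n+1),
which accumulate at 0. -/
lemma apply_conj (hV : IsPotential V) (z : ℂ) : V (conj z) = conj (V z) := by
  have h1 : Differentiable ℂ (conj ∘ V ∘ conj) := fun z =>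
    differentiableAt_conj_conj_iff.2 (hV.entire _)
  have h2 : (conj ∘ V ∘ conj) = V := by
    refine AnalyticOnNhd.eq_of_frequently_eq (z₀ := 0)
      (h1.differentiableOn.analyticOnNhd isOpen_univ) (hV.entire.differentiableOn.analyticOnNhd isOpen_univ) ?_
    have h3 : Tendsto (fun n : ℕ => ((1 / ((n : ℝ) + 1) : ℝ) : ℂ)) atTop (𝓝[≠] 0) := by
      refine tendsto_nhdsWithin_iff.2 ⟨?_, Eventually.of_forall fun n => ?_⟩
      · have := (Complex.continuous_ofReal.tendsto 0).comp
          (tendsto_one_div_add_atTop_nhds_zero_nat (𝕜 := ℝ))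
        simpa [Function.comp_def] using this
      · rw [mem_compl_singleton_iff, Ne, ofReal_eq_zero]
        positivity
    refine h3.frequently (Frequently.of_forall fun n => ?_)
    simp only [Function.comp_apply, conj_ofReal]
    exact conj_eq_iff_im.2 (hV.real_on_real _)
  have := congrFun h2 (conj z)
  simp only [Function.comp_apply, conj_conj] at this
  exact this.symm

lemma deriv_conj (hV : IsPotential V) (n : ℕ) (z : ℂ) :
    iteratedDeriv n V (conj z) = conj (iteratedDeriv n V z) := by
  induction n generalizing z with
  | zero => simpa using hV.apply_conj z
  | succ n ih =>
    rw [iteratedDeriv_succ]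
    have h : (conj ∘ iteratedDeriv n V ∘ conj) = iteratedDeriv n V := by
      ext w; simp [ih]
    have := congrFun (deriv_conj_conj (f := iteratedDeriv n V)) z
    rw [h] at this
    simp [this]

lemma deriv_apply_conj (hV : IsPotential V) (z : ℂ) : deriv V (conj z) = conj (deriv V z) := by
  simpa [iteratedDeriv_one] using hV.deriv_conj 1 z

lemma deriv_im_ofReal (hV : IsPotential V) (x : ℝ) : (deriv V x).im = 0 := by
  have := hV.deriv_apply_conj x
  rw [conj_ofReal] at this
  exact conj_eq_iff_im.mp this.symm

end IsPotential

/-- The integral form of the kernel `g`. -/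
noncomputable def regKernel (V : ℂ → ℂ) (z x : ℂ) : ℂ :=
  1 / 2 * ∫ θ in (0 : ℝ)..1, (1 - θ : ℂ) * iteratedDeriv 3 V (z + θ * (x - z))

/-- Taylor's formula for V' with integral remainder. The remainder form has no singularity on the
diagonal, so it is entire in z and jointly continuous. The diagonal itself is not needed, since z
lies off the real line wherever the equation is used. -/
lemma kernel_eq_regKernel {V : ℂ → ℂ} (hV : IsPotential V) {z x : ℂ} (h : x ≠ z) :
    kernel V z x = regKernel V z x := by
  have h1 : ∀ θ : ℝ, HasDerivAt (fun θ : ℝ =>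
      (1 - θ : ℂ) * ((x - z) * iteratedDeriv 2 V (z + θ * (x - z))) + deriv V (z + θ * (x - z)))
      ((x - z) ^ 2 * ((1 - θ : ℂ) * iteratedDeriv 3 V (z + θ * (x - z)))) θ := by
    intro θ
    have e0 : HasDerivAt (fun θ : ℂ => z + θ * (x - z)) (x - z) θ := by
      simpa using ((hasDerivAt_id (θ : ℂ)).mul_const (x - z)).const_add z
    have e1 := (hV.hasDerivAt_iteratedDeriv_two (z + θ * (x - z))).comp (θ : ℂ) e0
    have e2 := (hV.hasDerivAt_deriv (z + θ * (x - z))).comp (θ : ℂ) e0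
    have e3 := ((((hasDerivAt_id (θ : ℂ)).const_sub 1).mul (e1.const_mul (x - z))).add e2)
    have e4 := e3.comp_ofReal
    refine e4.congr_deriv ?_
    simp only [id, Function.comp_apply]
    ring
  have hc : Continuous (iteratedDeriv 3 V) := (hV.differentiable_iteratedDeriv 3).continuous
  have h2 := intervalIntegral.integral_eq_sub_of_hasDerivAt (a := 0) (b := 1) (fun θ _ => h1 θ)
    (Continuous.intervalIntegrable (by fun_prop) _ _)
  rw [intervalIntegral.integral_const_mul] at h2
  have hne : x - z ≠ 0 := sub_ne_zero.2 h
  rw [kernel, if_neg h, regKernel]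
  have h3 : (∫ θ in (0 : ℝ)..1, (1 - θ : ℂ) * iteratedDeriv 3 V (z + θ * (x - z)))
      = (deriv V x - deriv V z - (x - z) * iteratedDeriv 2 V z) / (x - z) ^ 2 := by
    rw [eq_div_iff (pow_ne_zero 2 hne), mul_comm, h2]
    simp
    ring
  rw [h3]
  field_simp

lemma continuous_regKernel {V : ℂ → ℂ} (hV : IsPotential V) :
    Continuous fun p : ℂ × ℂ => regKernel V p.1 p.2 := by
  have hc : Continuous (iteratedDeriv 3 V) := (hV.differentiable_iteratedDeriv 3).continuous
  have := intervalIntegral.continuous_parametric_intervalIntegral_of_continuous' (μ := volume)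
    (f := fun (p : ℂ × ℂ) (θ : ℝ) => (1 - θ : ℂ) * iteratedDeriv 3 V (p.1 + θ * (p.2 - p.1)))
    (by simp only [Function.uncurry_def]; fun_prop) 0 1
  exact continuous_const.mul this

lemma continuous_regKernel_comp {V : ℂ → ℂ} (hV : IsPotential V) {α : Type*} [TopologicalSpace α]
    {f g : α → ℂ} (hf : Continuous f) (hg : Continuous g) :
    Continuous fun a => regKernel V (f a) (g a) := by
  have h := (continuous_regKernel hV).comp (hf.prodMk hg)
  simpa only [Function.comp_def] using h

lemma differentiable_regKernel {V : ℂ → ℂ} (hV : IsPotential V) (x : ℂ) :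
    Differentiable ℂ fun z => regKernel V z x := by
  have hc := hV.differentiable_iteratedDeriv 3
  have hc' := hc.continuous
  refine Differentiable.const_mul ?_ _
  simp only [intervalIntegral.integral_of_le zero_le_one]
  refine differentiable_integral_of_continuous (S := Icc 0 1) isCompact_Icc ?_
    (g := fun z (θ : ℝ) => (1 - θ : ℂ) * iteratedDeriv 3 V (z + θ * (x - z)))
    (by simp only [Function.uncurry_def]; fun_prop) fun θ => ?_
  · exact (ae_restrict_mem measurableSet_Ioc).mono fun _ h => Ioc_subset_Icc_self h
  · exact (hc.comp (by fun_prop)).const_mul _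

lemma regKernel_conj {V : ℂ → ℂ} (hV : IsPotential V) (z : ℂ) (x : ℝ) :
    regKernel V (conj z) x = conj (regKernel V z x) := by
  simp only [regKernel, intervalIntegral.integral_of_le zero_le_one, map_mul, ← integral_conj]
  congr 1
  · simp [map_ofNat]
  · refine integral_congr_ae (Eventually.of_forall fun θ => ?_)
    simp only [map_sub, map_one, conj_ofReal, map_mul, ← hV.deriv_conj, map_add]

/-- The forcing term of the Burgers equation for `m + V'/2`. -/
noncomputable def forcing (V : ℂ → ℂ) (ρ : ProbabilityMeasure ℝ) (z : ℂ) : ℂ :=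
  (∫ x : ℝ, regKernel V z x ∂(ρ : Measure ℝ)) - deriv V z * iteratedDeriv 2 V z / 4

lemma CarriedBy.ae_mem {ρ : ProbabilityMeasure ℝ} {b : ℝ} (h : CarriedBy ρ b) :
    ∀ᵐ x ∂(ρ : Measure ℝ), x ∈ Icc (-b) b := h

lemma differentiable_forcing {V : ℂ → ℂ} (hV : IsPotential V) {ρ : ProbabilityMeasure ℝ} {b : ℝ}
    (hρ : CarriedBy ρ b) : Differentiable ℂ (forcing V ρ) := by
  have hg : Continuous fun p : ℂ × ℝ => regKernel V p.1 p.2 :=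
    continuous_regKernel_comp hV continuous_fst (continuous_ofReal.comp continuous_snd)
  have h1 := differentiable_integral_of_continuous isCompact_Icc hρ.ae_mem
    (g := fun z (x : ℝ) => regKernel V z x) hg fun x => differentiable_regKernel hV x
  exact h1.fun_sub
    ((hV.differentiable_deriv.fun_mul (hV.differentiable_iteratedDeriv 2)).div_const _)

lemma forcing_conj {V : ℂ → ℂ} (hV : IsPotential V) (ρ : ProbabilityMeasure ℝ) (z : ℂ) :
    forcing V ρ (conj z) = conj (forcing V ρ z) := by
  simp only [forcing, regKernel_conj hV, map_sub, ← integral_conj, map_div₀, map_mul,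
    ← hV.deriv_conj, ← hV.deriv_apply_conj, map_ofNat]

/-- A bound for the forcing term on a disc that only depends on the support of the measure. -/
lemma exists_forcing_bound {V : ℂ → ℂ} (hV : IsPotential V) (b R : ℝ) :
    ∃ M, 0 ≤ M ∧ ∀ ρ : ProbabilityMeasure ℝ, CarriedBy ρ b → ∀ z ∈ closedBall (0 : ℂ) R,
      ‖forcing V ρ z‖ ≤ M := by
  obtain ⟨C, hC⟩ := ((isCompact_closedBall (0 : ℂ) R).prod (isCompact_Icc (a := -b) (b := b)))
    |>.exists_bound_of_continuousOn (f := fun p : ℂ × ℝ => regKernel V p.1 p.2)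
    (continuous_regKernel_comp hV continuous_fst
      (continuous_ofReal.comp continuous_snd)).continuousOn
  obtain ⟨D, hD⟩ := (isCompact_closedBall (0 : ℂ) R).exists_bound_of_continuousOn
    (f := fun z => deriv V z * iteratedDeriv 2 V z / 4)
    ((hV.differentiable_deriv.mul (hV.differentiable_iteratedDeriv 2)).div_const
      4).continuous.continuousOn
  refine ⟨|C| + |D|, by positivity, fun ρ hρ z hz => ?_⟩
  refine (norm_sub_le _ _).trans (add_le_add ?_ ((hD z hz).trans (le_abs_self _)))
  have := norm_integral_le_of_norm_le_const (μ := (ρ : Measure ℝ)) (C := C)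
    (f := fun x : ℝ => regKernel V z x) (hρ.ae_mem.mono fun x hx => hC (z, x) ⟨hz, hx⟩)
  simp only [probReal_univ, mul_one] at this
  exact this.trans (le_abs_self _)

lemma tendsto_integral_of_bounded {ρ : ℝ → ProbabilityMeasure ℝ} {S : Set ℝ} {t : ℝ}
    (hρ : ContinuousWithinAt ρ S t) {f : ℝ → ℂ} (hf : Continuous f) {C : ℝ} (hC : ∀ x, ‖f x‖ ≤ C) :
    Tendsto (fun s => ∫ x, f x ∂(ρ s : Measure ℝ)) (𝓝[S] t) (𝓝 (∫ x, f x ∂(ρ t : Measure ℝ))) :=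
  (ProbabilityMeasure.tendsto_iff_forall_integral_rclike_tendsto ℂ).1 hρ
    (BoundedContinuousFunction.ofNormedAddCommGroup f hf C hC)

lemma tendsto_integral_of_carriedBy {ρ : ℝ → ProbabilityMeasure ℝ} {S : Set ℝ} {t b : ℝ}
    (hρ : ContinuousWithinAt ρ S t) (ht : t ∈ S) (hb : ∀ s ∈ S, CarriedBy (ρ s) b) {f : ℝ → ℂ}
    (hf : Continuous f) :
    Tendsto (fun s => ∫ x, f x ∂(ρ s : Measure ℝ)) (𝓝[S] t) (𝓝 (∫ x, f x ∂(ρ t : Measure ℝ))) := by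
  -- Weak convergence tests only bounded functions. Composing f with the clamp to [−|b|,|b|] makes
  -- it bounded without changing the integrals.
  let c : ℝ → ℝ := fun x => max (-|b|) (min x |b|)
  have hc : Continuous c := by fun_prop
  have hcm : ∀ x, c x ∈ Icc (-|b|) |b| := fun x =>
    ⟨le_max_left _ _, max_le (by linarith [abs_nonneg b]) (min_le_right _ _)⟩
  have hce : ∀ x ∈ Icc (-b) b, c x = x := fun x hx => by
    have := le_abs_self b
    simp only [c]
    rw [min_eq_left (hx.2.trans this), max_eq_right (by linarith [hx.1])]
  obtain ⟨C, hC⟩ := (isCompact_Icc (a := -|b|) (b := |b|)).exists_bound_of_continuousOn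
    hf.continuousOn
  have key : ∀ s ∈ S, ∫ x, f (c x) ∂(ρ s : Measure ℝ) = ∫ x, f x ∂(ρ s : Measure ℝ) :=
    fun s hs => integral_congr_ae ((hb s hs).ae_mem.mono fun x hx => by
      simp only [hce x hx])
  have := tendsto_integral_of_bounded hρ (hf.comp hc) (fun x => hC _ (hcm x))
  simp only [Function.comp_def] at this
  rw [key t ht] at this
  exact this.congr' (eventually_mem_nhdsWithin.mono key)

/-- Cauchy's estimate with half of the unit margin: the derivative is at most M/(1/2) on the disc of
radius R + 1/2. -/
lemma lipschitz_of_bound {f : ℂ → ℂ} (hf : Differentiable ℂ f) {R M : ℝ}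
    (h : ∀ z ∈ closedBall (0 : ℂ) (R + 1), ‖f z‖ ≤ M) {z w : ℂ} (hz : z ∈ closedBall (0 : ℂ) R)
    (hw : w ∈ closedBall (0 : ℂ) R) : ‖f z - f w‖ ≤ 2 * M * ‖z - w‖ := by
  have hsub : closedBall (0 : ℂ) R ⊆ ball 0 (R + 1 / 2) := closedBall_subset_ball (by linarith)
  refine norm_image_sub_le_of_ball hf.differentiableOn (fun s hs => ?_) (hsub hw) (hsub hz)
  have := norm_deriv_le_of_ball (r := R + 1) hf.differentiableOn
    (fun s hs => h s (ball_subset_closedBall hs)) (by linarith) hs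
  convert this using 1
  rw [show R + 1 - (R + 1 / 2) = 1 / 2 by ring]
  ring

/-- Weak continuity gives continuity in time at a fixed z₀, and a Lipschitz bound in z that is
uniform in time upgrades it to joint continuity. -/
lemma continuousOn_forcing {V : ℂ → ℂ} (hV : IsPotential V) {b T : ℝ}
    {ρ : ℝ → ProbabilityMeasure ℝ} (hρ : ContinuousOn ρ (Icc 0 T))
    (hb : ∀ t ∈ Icc 0 T, CarriedBy (ρ t) b) :
    ContinuousOn (fun p : ℝ × ℂ => forcing V (ρ p.1) p.2) (Icc 0 T ×ˢ univ) := by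
  rintro ⟨t₀, z₀⟩ ⟨ht₀, -⟩
  obtain ⟨M', -, hM'⟩ := exists_forcing_bound hV b (‖z₀‖ + 1 + 1)
  have hgc : Continuous fun x : ℝ => regKernel V z₀ x :=
    continuous_regKernel_comp hV continuous_const continuous_ofReal
  have h1 : Tendsto (fun t => forcing V (ρ t) z₀) (𝓝[Icc 0 T] t₀) (𝓝 (forcing V (ρ t₀) z₀)) :=
    (tendsto_integral_of_carriedBy (hρ t₀ ht₀) ht₀ hb (f := fun x : ℝ => regKernel V z₀ x)
      hgc).sub_const _
  have h1' : Tendsto (fun p : ℝ × ℂ => forcing V (ρ p.1) z₀) (𝓝[Icc 0 T ×ˢ univ] (t₀, z₀))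
      (𝓝 (forcing V (ρ t₀) z₀)) := by
    refine h1.comp (tendsto_nhdsWithin_iff.2 ⟨?_, ?_⟩)
    · exact (continuous_fst.tendsto _).mono_left nhdsWithin_le_nhds
    · exact eventually_mem_nhdsWithin.mono fun p hp => hp.1
  have h2 : Tendsto (fun p : ℝ × ℂ => forcing V (ρ p.1) p.2 - forcing V (ρ p.1) z₀)
      (𝓝[Icc 0 T ×ˢ univ] (t₀, z₀)) (𝓝 0) := by
    have h3 : Tendsto (fun p : ℝ × ℂ => 2 * M' * ‖p.2 - z₀‖) (𝓝[Icc 0 T ×ˢ univ] (t₀, z₀))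
        (𝓝 0) := by
      have : Continuous fun p : ℝ × ℂ => 2 * M' * ‖p.2 - z₀‖ := by fun_prop
      have h4 := (this.tendsto (t₀, z₀)).mono_left (nhdsWithin_le_nhds (s := Icc 0 T ×ˢ univ))
      simpa using h4
    refine squeeze_zero_norm' ?_ h3
    have h5 : ∀ᶠ p : ℝ × ℂ in 𝓝[Icc 0 T ×ˢ univ] (t₀, z₀), p.2 ∈ closedBall z₀ 1 :=
      ((continuous_snd.tendsto (t₀, z₀)).mono_left nhdsWithin_le_nhds).eventually
        (closedBall_mem_nhds z₀ one_pos)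
    filter_upwards [h5, eventually_mem_nhdsWithin] with p hp hpS
    have hsub : closedBall z₀ 1 ⊆ closedBall 0 (‖z₀‖ + 1) :=
      closedBall_subset_closedBall' (by simp [add_comm])
    exact lipschitz_of_bound (differentiable_forcing hV (hb _ hpS.1)) (hM' _ (hb _ hpS.1))
      (hsub hp) (hsub (mem_closedBall_self zero_le_one))
  have := h2.add h1'
  simp only [sub_add_cancel, zero_add] at this
  exact this

/-- The constants depend only on V, the range b and the radius R. This is what makes all later
existence times independent of the particular solution. -/
theorem exists_isForcing {V : ℂ → ℂ} (hV : IsPotential V) (b R : ℝ) :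
    ∃ M, 0 ≤ M ∧ ∀ (T : ℝ) (ρ : ℝ → ProbabilityMeasure ℝ), ContinuousOn ρ (Icc 0 T) →
      (∀ t ∈ Icc 0 T, CarriedBy (ρ t) b) →
      IsForcing (fun t => forcing V (ρ t)) T R M (2 * M) := by
  obtain ⟨M, hM0, hM⟩ := exists_forcing_bound hV b (R + 1)
  refine ⟨M, hM0, fun T ρ hρ hb => ⟨fun t ht => differentiable_forcing hV (hb t ht),
    fun t _ => forcing_conj hV (ρ t), continuousOn_forcing hV hρ hb, fun t ht z hz =>
      hM _ (hb t ht) z (closedBall_subset_closedBall (by linarith) hz),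
    fun t ht z hz w hw => lipschitz_of_bound (differentiable_forcing hV (hb t ht))
      (hM _ (hb t ht)) hz hw⟩⟩

/-! ### Elementary bounds for Stieltjes transforms -/

lemma im_le_norm_ofReal_sub (x : ℝ) (z : ℂ) : |z.im| ≤ ‖(x : ℂ) - z‖ := by
  have := abs_im_le_norm ((x : ℂ) - z)
  simpa using this

lemma measurable_one_div_sub (z : ℂ) : Measurable fun x : ℝ => 1 / ((x : ℂ) - z) := by
  fun_prop

lemma norm_one_div_sub_le {δ : ℝ} (hδ : 0 < δ) {x z : ℂ} (h : δ ≤ ‖x - z‖) :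
    ‖1 / (x - z)‖ ≤ 1 / δ := by
  rw [norm_div, norm_one]
  exact one_div_le_one_div_of_le hδ h

lemma integrable_one_div_sub {ρ : ProbabilityMeasure ℝ} {z : ℂ} {δ : ℝ} (hδ : 0 < δ)
    (h : ∀ᵐ x : ℝ ∂(ρ : Measure ℝ), δ ≤ ‖(x : ℂ) - z‖) :
    Integrable (fun x : ℝ => 1 / ((x : ℂ) - z)) (ρ : Measure ℝ) :=
  Integrable.of_bound (measurable_one_div_sub z).aestronglyMeasurable (1 / δ)
    (h.mono fun _ hx => norm_one_div_sub_le hδ hx)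

lemma norm_stieltjes_le {ρ : ProbabilityMeasure ℝ} {z : ℂ} {δ : ℝ} (hδ : 0 < δ)
    (h : ∀ᵐ x : ℝ ∂(ρ : Measure ℝ), δ ≤ ‖(x : ℂ) - z‖) : ‖stieltjes ρ z‖ ≤ 1 / δ := by
  have := norm_integral_le_of_norm_le_const (μ := (ρ : Measure ℝ)) (C := 1 / δ)
    (f := fun x : ℝ => 1 / ((x : ℂ) - z)) (h.mono fun x hx => norm_one_div_sub_le hδ hx)
  simp only [probReal_univ, mul_one] at this
  exact this

lemma hasDerivAt_stieltjes {ρ : ProbabilityMeasure ℝ} {z : ℂ} {δ : ℝ} (hδ : 0 < δ)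
    (h : ∀ᵐ x : ℝ ∂(ρ : Measure ℝ), δ ≤ ‖(x : ℂ) - z‖) :
    HasDerivAt (stieltjes ρ) (∫ x : ℝ, 1 / ((x : ℂ) - z) ^ 2 ∂(ρ : Measure ℝ)) z := by
  have hfar : ∀ x : ℝ, δ ≤ ‖(x : ℂ) - z‖ → ∀ w ∈ ball z (δ / 2), δ / 2 ≤ ‖(x : ℂ) - w‖ := by
    intro x hx w hw
    have h1 : ‖w - z‖ < δ / 2 := by rwa [mem_ball, dist_eq_norm] at hw
    have h2 := norm_sub_le_norm_sub_add_norm_sub (x : ℂ) w z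
    linarith
  refine (hasDerivAt_integral_of_dominated_loc_of_deriv_le
    (F' := fun w (x : ℝ) => 1 / ((x : ℂ) - w) ^ 2) (bound := fun _ => (1 / (δ / 2)) ^ 2)
    (ball_mem_nhds z (half_pos hδ))
    (Eventually.of_forall fun w => (measurable_one_div_sub w).aestronglyMeasurable)
    (integrable_one_div_sub hδ h) ?_ ?_ (integrable_const _) ?_).2
  · exact (by fun_prop : Measurable fun x : ℝ => 1 / ((x : ℂ) - z) ^ 2).aestronglyMeasurable
  · filter_upwards [h] with x hx w hw
    rw [← one_div_pow, norm_pow]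
    exact pow_le_pow_left₀ (norm_nonneg _) (norm_one_div_sub_le (half_pos hδ) (hfar x hx w hw)) 2
  · filter_upwards [h] with x hx w hw
    have hne : (x : ℂ) - w ≠ 0 := norm_pos_iff.1 ((half_pos hδ).trans_le (hfar x hx w hw))
    have := ((hasDerivAt_id w).const_sub (x : ℂ)).fun_inv hne
    simpa [one_div] using this

lemma norm_deriv_stieltjes_le {ρ : ProbabilityMeasure ℝ} {z : ℂ} {δ : ℝ} (hδ : 0 < δ)
    (h : ∀ᵐ x : ℝ ∂(ρ : Measure ℝ), δ ≤ ‖(x : ℂ) - z‖) :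
    ‖deriv (stieltjes ρ) z‖ ≤ (1 / δ) ^ 2 := by
  rw [(hasDerivAt_stieltjes hδ h).deriv]
  have := norm_integral_le_of_norm_le_const (μ := (ρ : Measure ℝ)) (C := (1 / δ) ^ 2)
    (f := fun x : ℝ => 1 / ((x : ℂ) - z) ^ 2) (h.mono fun x hx => by
      rw [← one_div_pow, norm_pow]
      exact pow_le_pow_left₀ (norm_nonneg _) (norm_one_div_sub_le hδ hx) 2)
  simpa only [probReal_univ, mul_one] using this

lemma ae_im_le_norm {ρ : ProbabilityMeasure ℝ} {z : ℂ} {c : ℝ} (h : c ≤ z.im) :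
    ∀ᵐ x : ℝ ∂(ρ : Measure ℝ), c ≤ ‖(x : ℂ) - z‖ :=
  Eventually.of_forall fun x => h.trans ((le_abs_self _).trans (im_le_norm_ofReal_sub x z))

lemma stieltjes_conj (ρ : ProbabilityMeasure ℝ) (z : ℂ) :
    stieltjes ρ (conj z) = conj (stieltjes ρ z) := by
  simp only [stieltjes, ← integral_conj, map_div₀, map_one, map_sub, conj_ofReal]

lemma one_div_sub_im (x : ℝ) (z : ℂ) : (1 / ((x : ℂ) - z)).im = z.im / ((x - z.re) ^ 2 + z.im ^ 2) := by
  rw [one_div, inv_im, normSq_apply]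
  simp
  ring

lemma one_div_sub_re (x : ℝ) (z : ℂ) :
    (1 / ((x : ℂ) - z)).re = (x - z.re) / ((x - z.re) ^ 2 + z.im ^ 2) := by
  rw [one_div, inv_re, normSq_apply]
  simp
  ring

lemma stieltjes_im {ρ : ProbabilityMeasure ℝ} {z : ℂ} (hz : 0 < z.im) :
    (stieltjes ρ z).im = ∫ x : ℝ, z.im / ((x - z.re) ^ 2 + z.im ^ 2) ∂(ρ : Measure ℝ) := by
  have := integral_im (integrable_one_div_sub hz (ae_im_le_norm (ρ := ρ) le_rfl))
  simp only [RCLike.im_eq_complex_im, one_div_sub_im] at this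
  exact this.symm

lemma stieltjes_re {ρ : ProbabilityMeasure ℝ} {z : ℂ} (hz : 0 < z.im) :
    (stieltjes ρ z).re = ∫ x : ℝ, (x - z.re) / ((x - z.re) ^ 2 + z.im ^ 2) ∂(ρ : Measure ℝ) := by
  have := integral_re (integrable_one_div_sub hz (ae_im_le_norm (ρ := ρ) le_rfl))
  simp only [RCLike.re_eq_complex_re, one_div_sub_re] at this
  exact this.symm

lemma stieltjes_im_nonneg {ρ : ProbabilityMeasure ℝ} {z : ℂ} (hz : 0 < z.im) :
    0 ≤ (stieltjes ρ z).im := by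
  rw [stieltjes_im hz]
  exact integral_nonneg fun x => by positivity

/-! ### Transport along characteristics -/

section Characteristics

variable {V : ℂ → ℂ} {T : ℝ} {ρ : ℝ → ProbabilityMeasure ℝ}

/-- The derivative of the Stieltjes transform along a moving point of the upper half plane. -/
lemma IsSolution.hasDerivWithinAt_comp (hρ : IsSolution V T ρ) {z : ℝ → ℂ} {z' : ℂ} {t : ℝ}
    (ht : t ∈ Icc 0 T) (hz : HasDerivWithinAt z z' (Icc 0 T) t) (him : 0 < (z t).im) :
    HasDerivWithinAt (fun s => stieltjes (ρ s) (z s))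
      ((deriv (stieltjes (ρ t)) (z t) * (stieltjes (ρ t) (z t) + deriv V (z t) / 2)
        + stieltjes (ρ t) (z t) * iteratedDeriv 2 V (z t) / 2
        + ∫ x : ℝ, kernel V (z t) (x : ℂ) ∂(ρ t : Measure ℝ))
        + deriv (stieltjes (ρ t)) (z t) * z') (Icc 0 T) t := by
  set w := z t with hw
  set c := w.im / 2 with hc
  have hc0 : 0 < c := half_pos him
  -- The resolvent identity gives m_s(z_s) = m_s(w) + Q(s)(z_s − w) exactly. The first term is
  -- differentiated by the equation at the fixed point w. For the second it suffices that Q(s) tends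
  -- to the space derivative of m_t at w, which is weak continuity plus a uniform bound on the
  -- integrand.
  let Q : ℝ → ℂ := fun s => ∫ x : ℝ, 1 / (((x : ℂ) - z s) * ((x : ℂ) - w)) ∂(ρ s : Measure ℝ)
  have hzc : Tendsto z (𝓝[Icc 0 T] t) (𝓝 w) := hz.continuousWithinAt
  have hev : ∀ᶠ s in 𝓝[Icc 0 T] t, c < (z s).im :=
    (Complex.continuous_im.continuousAt.tendsto.comp hzc).eventually
      (lt_mem_nhds (by simp only [hc]; linarith))
  have hinv : ∀ (x : ℝ) (v : ℂ), c ≤ v.im → c ≤ ‖(x : ℂ) - v‖ := fun x v hv =>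
    hv.trans ((le_abs_self _).trans (im_le_norm_ofReal_sub x v))
  have hwc : c ≤ w.im := by simp only [hc]; linarith
  have hne : ∀ (x : ℝ) (v : ℂ), c ≤ v.im → (x : ℂ) - v ≠ 0 := fun x v hv =>
    norm_pos_iff.1 (hc0.trans_le (hinv x v hv))
  have hQint : ∀ (s : ℝ) (v : ℂ), c ≤ v.im →
      Integrable (fun x : ℝ => 1 / (((x : ℂ) - v) * ((x : ℂ) - w))) (ρ s : Measure ℝ) := by
    intro s v hv
    refine Integrable.of_bound (by fun_prop : Measurable fun x : ℝ =>
      1 / (((x : ℂ) - v) * ((x : ℂ) - w))).aestronglyMeasurable (1 / c * (1 / c))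
      (Eventually.of_forall fun x => ?_)
    rw [← one_div_mul_one_div, norm_mul]
    exact mul_le_mul (norm_one_div_sub_le hc0 (hinv x v hv))
      (norm_one_div_sub_le hc0 (hinv x w hwc)) (norm_nonneg _) (by positivity)
  have hQ : Tendsto Q (𝓝[Icc 0 T] t) (𝓝 (deriv (stieltjes (ρ t)) w)) := by
    rw [(hasDerivAt_stieltjes him (ae_im_le_norm le_rfl)).deriv]
    have h1 : Tendsto (fun s => ∫ x : ℝ, 1 / ((x : ℂ) - w) ^ 2 ∂(ρ s : Measure ℝ)) (𝓝[Icc 0 T] t)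
        (𝓝 (∫ x : ℝ, 1 / ((x : ℂ) - w) ^ 2 ∂(ρ t : Measure ℝ))) := by
      refine tendsto_integral_of_bounded (hρ.continuousOn t ht) ?_ (C := (1 / c) ^ 2) fun x => ?_
      · refine continuous_const.div (by fun_prop) fun x => pow_ne_zero 2 (hne x w hwc)
      · rw [← one_div_pow, norm_pow]
        exact pow_le_pow_left₀ (norm_nonneg _) (norm_one_div_sub_le hc0 (hinv x w hwc)) 2
    have h2 : Tendsto (fun s => Q s - ∫ x : ℝ, 1 / ((x : ℂ) - w) ^ 2 ∂(ρ s : Measure ℝ))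
        (𝓝[Icc 0 T] t) (𝓝 0) := by
      have h3 : Tendsto (fun s => (1 / c) ^ 3 * ‖z s - w‖) (𝓝[Icc 0 T] t) (𝓝 0) := by
        have := ((hzc.sub_const w).norm).const_mul ((1 / c) ^ 3)
        simpa using this
      refine squeeze_zero_norm' ?_ h3
      filter_upwards [hev] with s hs
      have hi2 : Integrable (fun x : ℝ => 1 / ((x : ℂ) - w) ^ 2) (ρ s : Measure ℝ) := by
        simpa only [sq] using hQint s w hwc
      simp only [Q]
      rw [← integral_sub (hQint s (z s) hs.le) hi2]
      have hb : ∀ x : ℝ, ‖1 / (((x : ℂ) - z s) * ((x : ℂ) - w)) - 1 / ((x : ℂ) - w) ^ 2‖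
          ≤ (1 / c) ^ 3 * ‖z s - w‖ := by
        intro x
        have e : 1 / (((x : ℂ) - z s) * ((x : ℂ) - w)) - 1 / ((x : ℂ) - w) ^ 2
            = (1 / ((x : ℂ) - z s)) * (1 / ((x : ℂ) - w)) ^ 2 * (z s - w) := by
          have n1 := hne x (z s) hs.le
          have n2 := hne x w hwc
          field_simp
          ring
        rw [e, norm_mul, norm_mul, norm_pow, pow_succ' (1 / c) 2]
        have b1 := norm_one_div_sub_le hc0 (hinv x (z s) hs.le)
        have b2 := norm_one_div_sub_le hc0 (hinv x w hwc)
        gcongr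
      have := norm_integral_le_of_norm_le_const (μ := (ρ s : Measure ℝ))
        (Eventually.of_forall hb)
      simpa only [probReal_univ, mul_one] using this
    simpa using h2.add h1
  have hprod : HasDerivWithinAt (fun s => Q s * (z s - w)) (deriv (stieltjes (ρ t)) w * z')
      (Icc 0 T) t := by
    rw [hasDerivWithinAt_iff_tendsto_slope] at hz ⊢
    refine ((hQ.mono_left (nhdsWithin_mono _ sdiff_subset)).mul hz).congr fun s => ?_
    simp only [slope_def_module, ← hw, sub_self, mul_zero, sub_zero, mul_smul_comm]
  refine ((hρ.equation t ht w him).add hprod).congr_of_eventuallyEq ?_ ?_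
  · filter_upwards [hev] with s hs
    simp only [Pi.add_apply, stieltjes, Q]
    rw [← integral_mul_const, ← integral_add (integrable_one_div_sub hc0 (ae_im_le_norm hwc))
      ((hQint s (z s) hs.le).mul_const _)]
    refine integral_congr_ae (Eventually.of_forall fun x => ?_)
    have n1 := hne x (z s) hs.le
    have n2 := hne x w hwc
    simp only
    field_simp
    ring
  · simp [← hw]

/-- The Stieltjes transform is transported along the characteristics that stay in the upper half
plane. -/
theorem IsSolution.eq_along_characteristic (hV : IsPotential V) (hρ : IsSolution V T ρ)
    {z u : ℝ → ℂ} {t c : ℝ} (ht : t ∈ Icc 0 T) (hc : 0 < c)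
    (hz : ∀ τ ∈ Icc 0 t, HasDerivWithinAt z (-u τ) (Icc 0 T) τ)
    (hu : ∀ τ ∈ Icc 0 t, HasDerivWithinAt u (forcing V (ρ τ) (z τ)) (Icc 0 T) τ)
    (him : ∀ τ ∈ Icc 0 t, c ≤ (z τ).im)
    (h0 : stieltjes (ρ 0) (z 0) + deriv V (z 0) / 2 = u 0) :
    stieltjes (ρ t) (z t) + deriv V (z t) / 2 = u t := by
  have hsub : Icc 0 t ⊆ Icc 0 T := Icc_subset_Icc_right ht.2
  -- The mismatch d = u(τ, z(τ)) − u_char satisfies the linear equation d' = (∂_z u) d by Burgers.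
  -- The coefficient is bounded because the path keeps height at least c, so d(0) = 0 forces d = 0.
  let d : ℝ → ℂ := fun τ => stieltjes (ρ τ) (z τ) + deriv V (z τ) / 2 - u τ
  let a : ℝ → ℂ := fun τ => deriv (stieltjes (ρ τ)) (z τ) + iteratedDeriv 2 V (z τ) / 2
  have hd : ∀ τ ∈ Icc 0 t, HasDerivWithinAt d (a τ * d τ) (Icc 0 T) τ := by
    intro τ hτ
    have hpos : 0 < (z τ).im := hc.trans_le (him τ hτ)
    have h1 := hρ.hasDerivWithinAt_comp (hsub hτ) (hz τ hτ) hpos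
    have h2 := (hV.hasDerivAt_deriv (z τ)).comp_hasDerivWithinAt τ (hz τ hτ)
    refine ((h1.add (h2.div_const 2)).sub (hu τ hτ)).congr_deriv ?_
    have hk : ∫ x : ℝ, kernel V (z τ) (x : ℂ) ∂(ρ τ : Measure ℝ)
        = ∫ x : ℝ, regKernel V (z τ) (x : ℂ) ∂(ρ τ : Measure ℝ) :=
      integral_congr_ae (Eventually.of_forall fun x => kernel_eq_regKernel hV fun h => by
        rw [← h] at hpos; simp at hpos)
    rw [hk, forcing]
    simp only [a, d]
    ring
  have hzc : ContinuousOn z (Icc 0 t) := fun τ hτ =>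
    ((hz τ hτ).mono hsub).continuousWithinAt
  obtain ⟨D, hD⟩ := isCompact_Icc.exists_bound_of_continuousOn
    (((hV.differentiable_iteratedDeriv 2).continuous.comp_continuousOn hzc))
  have ha : ∀ τ ∈ Icc 0 t, ‖a τ‖ ≤ (1 / c) ^ 2 + D / 2 := by
    intro τ hτ
    refine (norm_add_le _ _).trans (add_le_add
      (norm_deriv_stieltjes_le hc (ae_im_le_norm (him τ hτ))) ?_)
    rw [norm_div, Complex.norm_ofNat]
    have := hD τ hτ
    simp only [Function.comp_apply] at this
    linarith
  have := eq_zero_of_abs_deriv_le_mul_abs_self_of_eq_zero_right (f := d) (a := 0) (b := t)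
    (f' := fun τ => a τ * d τ) (K := (1 / c) ^ 2 + D / 2)
    (fun τ hτ => ((hd τ hτ).mono hsub).continuousWithinAt)
    (fun τ hτ => (hd τ ⟨hτ.1, hτ.2.le⟩).mono_of_mem_nhdsWithin
      (Icc_mem_nhdsGE_of_mem ⟨hτ.1, hτ.2.trans_le ht.2⟩))
    (by simp only [d]; rw [h0, sub_self])
    (fun τ hτ => by
      rw [norm_mul]
      exact mul_le_mul_of_nonneg_right (ha τ ⟨hτ.1, hτ.2.le⟩) (norm_nonneg _))
    t ⟨ht.1, le_rfl⟩
  exact sub_eq_zero.1 this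

end Characteristics

/-! ### Stieltjes inversion -/

section Inversion

variable {φ : ℝ → ℝ}

lemma integrable_inv_one_add_sq_mul {g : ℝ → ℝ} (hg : Continuous g) (hg1 : ∀ x, |g x| ≤ 1) :
    Integrable fun v : ℝ => g v * (1 + v ^ 2)⁻¹ := by
  refine integrable_inv_one_add_sq.mono' ?_ (Eventually.of_forall fun v => ?_)
  · exact (hg.mul (by fun_prop (disch := intro x; positivity))).aestronglyMeasurable
  · rw [Real.norm_eq_abs, abs_mul, abs_of_nonneg (by positivity : (0 : ℝ) ≤ (1 + v ^ 2)⁻¹)]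
    exact mul_le_of_le_one_left (by positivity) (hg1 v)

/-- Poisson's kernel after scaling. -/
lemma integral_mul_poisson (u : ℝ) {y : ℝ} (hy : 0 < y) :
    ∫ x, φ x * (y / ((u - x) ^ 2 + y ^ 2)) = ∫ v, φ (u + y * v) * (1 + v ^ 2)⁻¹ := by
  have h1 := Measure.integral_comp_mul_left
    (fun v : ℝ => φ (u + v) * (y / ((u - (u + v)) ^ 2 + y ^ 2))) y
  rw [integral_add_left_eq_self (fun x => φ x * (y / ((u - x) ^ 2 + y ^ 2))) u,
    abs_of_pos (inv_pos.2 hy), smul_eq_mul, eq_inv_mul_iff_mul_eq₀ hy.ne'] at h1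
  rw [← h1, ← integral_const_mul]
  refine integral_congr_ae (Eventually.of_forall fun v => ?_)
  simp only
  have : (1 + v ^ 2) ≠ 0 := by positivity
  have h3 : (u - (u + y * v)) ^ 2 + y ^ 2 = y ^ 2 * (1 + v ^ 2) := by ring
  rw [h3]
  field_simp

lemma tendsto_integral_poisson (hφ : Continuous φ) (hφ1 : ∀ x, |φ x| ≤ 1) (μ : Measure ℝ)
    [IsFiniteMeasure μ] :
    Tendsto (fun y : ℝ => ∫ u, ∫ v, φ (u + y * v) * (1 + v ^ 2)⁻¹ ∂volume ∂μ) (𝓝[>] 0)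
      (𝓝 (∫ u, φ u * Real.pi ∂μ)) := by
  refine tendsto_integral_filter_of_dominated_convergence (fun _ => Real.pi)
    (Eventually.of_forall fun y => ?_) (Eventually.of_forall fun y => ?_) (integrable_const _) ?_
  · have hc : Continuous fun p : ℝ × ℝ => φ (p.1 + y * p.2) * (1 + p.2 ^ 2)⁻¹ :=
      (by fun_prop : Continuous fun p : ℝ × ℝ => φ (p.1 + y * p.2)).mul
        (by fun_prop (disch := intro x; positivity))
    exact hc.stronglyMeasurable.integral_prod_right'.aestronglyMeasurable
  · refine Eventually.of_forall fun u => ?_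
    rw [← integral_univ_inv_one_add_sq]
    refine norm_integral_le_of_norm_le integrable_inv_one_add_sq (Eventually.of_forall fun v => ?_)
    rw [Real.norm_eq_abs, abs_mul, abs_of_nonneg (by positivity : (0 : ℝ) ≤ (1 + v ^ 2)⁻¹)]
    exact mul_le_of_le_one_left (by positivity) (hφ1 _)
  · refine Eventually.of_forall fun u => ?_
    rw [← integral_univ_inv_one_add_sq, ← integral_const_mul]
    refine tendsto_integral_filter_of_dominated_convergence (fun v => (1 + v ^ 2)⁻¹)
      (Eventually.of_forall fun y => ?_) (Eventually.of_forall fun y => ?_)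
      integrable_inv_one_add_sq (Eventually.of_forall fun v => ?_)
    · exact (integrable_inv_one_add_sq_mul (g := fun v => φ (u + y * v)) (by fun_prop)
        fun _ => hφ1 _).aestronglyMeasurable
    · refine Eventually.of_forall fun v => ?_
      rw [Real.norm_eq_abs, abs_mul, abs_of_nonneg (by positivity : (0 : ℝ) ≤ (1 + v ^ 2)⁻¹)]
      exact mul_le_of_le_one_left (by positivity) (hφ1 _)
    · have hc : Continuous fun y : ℝ => φ (u + y * v) * (1 + v ^ 2)⁻¹ := by fun_prop
      have := (hc.tendsto 0).mono_left (nhdsWithin_le_nhds (s := Ioi 0))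
      simpa using this

lemma continuous_stieltjes_line (ρ : ProbabilityMeasure ℝ) {y : ℝ} (hy : 0 < y) :
    Continuous fun x : ℝ => stieltjes ρ (x + y * I) := by
  refine continuous_iff_continuousAt.2 fun x => ?_
  have h1 := (hasDerivAt_stieltjes (ρ := ρ) (z := x + y * I) hy
    (ae_im_le_norm (by simp))).continuousAt
  exact ContinuousAt.comp (f := fun x : ℝ => (x + y * I : ℂ)) h1 (by fun_prop)

/-- Fubini moves the Poisson kernel from the measure to the test function. After scaling, the
smoothed test function tends to π φ as y decreases to 0. -/
lemma integral_mul_stieltjes_im (ρ : ProbabilityMeasure ℝ) {c d : ℝ} (hφ : Continuous φ)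
    (hφ1 : ∀ x, |φ x| ≤ 1) (hφ0 : ∀ x ∉ Ioo c d, φ x = 0) {y : ℝ} (hy : 0 < y) :
    ∫ x in Ioo c d, φ x * (stieltjes ρ (x + y * I)).im
      = ∫ u, ∫ v, φ (u + y * v) * (1 + v ^ 2)⁻¹ ∂volume ∂(ρ : Measure ℝ) := by
  have h1 : ∀ x : ℝ, φ x * (stieltjes ρ (x + y * I)).im
      = ∫ u, φ x * (y / ((u - x) ^ 2 + y ^ 2)) ∂(ρ : Measure ℝ) := fun x => by
    rw [stieltjes_im (by simpa using hy), integral_const_mul]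
    simp
  simp only [h1]
  rw [integral_integral_swap]
  · refine integral_congr_ae (Eventually.of_forall fun u => ?_)
    simp only
    rw [setIntegral_eq_integral_of_forall_compl_eq_zero fun x hx => by rw [hφ0 x hx, zero_mul],
      integral_mul_poisson u hy]
  · refine Integrable.of_bound (C := y / y ^ 2) ?_ (Eventually.of_forall fun p => ?_)
    · refine Continuous.aestronglyMeasurable ?_
      simp only [Function.uncurry_def]
      refine (hφ.comp continuous_fst).mul (continuous_const.div (by fun_prop) fun p => ?_)
      positivity
    · simp only [Function.uncurry]
      rw [Real.norm_eq_abs, abs_mul,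
        abs_of_nonneg (by positivity : 0 ≤ y / ((p.2 - p.1) ^ 2 + y ^ 2))]
      refine (mul_le_of_le_one_left (by positivity) (hφ1 _)).trans ?_
      gcongr
      nlinarith [sq_nonneg (p.2 - p.1)]

/-- Continuous functions that increase to the indicator function of `(p, q)`. -/
noncomputable def tent (p q : ℝ) (n : ℕ) (x : ℝ) : ℝ := min 1 (n * max 0 (min (x - p) (q - x)))

lemma continuous_tent (p q : ℝ) (n : ℕ) : Continuous (tent p q n) := by
  unfold tent; fun_prop

lemma abs_tent_le_one (p q : ℝ) (n : ℕ) (x : ℝ) : |tent p q n x| ≤ 1 := by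
  rw [abs_of_nonneg (by unfold tent; positivity)]
  exact min_le_left _ _

lemma tent_eq_zero {p q x : ℝ} (n : ℕ) (hx : x ∉ Ioo p q) : tent p q n x = 0 := by
  have : min (x - p) (q - x) ≤ 0 := by
    rw [mem_Ioo, not_and_or, not_lt, not_lt] at hx
    rcases hx with h | h
    · exact (min_le_left _ _).trans (by linarith)
    · exact (min_le_right _ _).trans (by linarith)
  simp [tent, max_eq_left this]

lemma tendsto_tent (p q x : ℝ) :
    Tendsto (fun n => tent p q n x) atTop (𝓝 ((Ioo p q).indicator 1 x)) := by
  by_cases hx : x ∈ Ioo p q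
  · rw [indicator_of_mem hx]
    have hpos : 0 < min (x - p) (q - x) := lt_min (by linarith [hx.1]) (by linarith [hx.2])
    obtain ⟨N, hN⟩ := exists_nat_gt (1 / min (x - p) (q - x))
    refine tendsto_const_nhds.congr' ?_
    filter_upwards [eventually_ge_atTop N] with n hn
    have h1 : (1 : ℝ) ≤ n * min (x - p) (q - x) := by
      rw [div_lt_iff₀ hpos] at hN
      refine hN.le.trans ?_
      gcongr
    simp only [tent, Pi.one_apply, max_eq_right hpos.le]
    exact (min_eq_left h1).symm
  · rw [indicator_of_notMem hx]
    simp only [tent_eq_zero _ hx]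
    exact tendsto_const_nhds

/-- The Stieltjes inversion formula: on an interval in which the imaginary part of the Stieltjes
transform is bounded and has pointwise boundary values `π f`, the measure has density `f`. -/
theorem restrict_eq_withDensity {ρ : ProbabilityMeasure ℝ} {c d y₀ M : ℝ} {f : ℝ → ℝ}
    (hy₀ : 0 < y₀) (hf : Measurable f) (hf0 : ∀ x, 0 ≤ f x)
    (hlim : ∀ x ∈ Ioo c d,
      Tendsto (fun y : ℝ => (stieltjes ρ (x + y * I)).im) (𝓝[>] 0) (𝓝 (f x * Real.pi)))
    (hM : ∀ x ∈ Ioo c d, ∀ y ∈ Ioo 0 y₀, |(stieltjes ρ (x + y * I)).im| ≤ M) :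
    (ρ : Measure ℝ).restrict (Ioo c d) =
      (volume.restrict (Ioo c d)).withDensity (fun x => ENNReal.ofReal (f x)) := by
  have hev : ∀ᶠ y : ℝ in 𝓝[>] 0, y ∈ Ioo 0 y₀ := Ioo_mem_nhdsGT hy₀
  have hfM : ∀ x ∈ Ioo c d, |f x * Real.pi| ≤ M := fun x hx =>
    le_of_tendsto (hlim x hx).abs (hev.mono fun y hy => hM x hx y hy)
  have hfi : IntegrableOn f (Ioo c d) := by
    refine IntegrableOn.of_bound (by simp) hf.aestronglyMeasurable (M / Real.pi)
      ((ae_restrict_mem measurableSet_Ioo).mono fun x hx => ?_)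
    rw [le_div_iff₀ Real.pi_pos, Real.norm_eq_abs]
    have := hfM x hx
    rwa [abs_mul, abs_of_pos Real.pi_pos] at this
  -- Both sides are limits of the same integral as y decreases to 0. One uses the pointwise boundary
  -- values and the bound M, the other the approximation of φ by its Poisson averages.
  have key : ∀ φ : ℝ → ℝ, Continuous φ → (∀ x, |φ x| ≤ 1) → (∀ x ∉ Ioo c d, φ x = 0) →
      ∫ x, φ x ∂(ρ : Measure ℝ) = ∫ x in Ioo c d, φ x * f x := by
    intro φ hφ hφ1 hφ0
    have h1 : Tendsto (fun y : ℝ => ∫ x in Ioo c d, φ x * (stieltjes ρ (x + y * I)).im) (𝓝[>] 0)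
        (𝓝 (∫ x in Ioo c d, φ x * (f x * Real.pi))) := by
      refine tendsto_integral_filter_of_dominated_convergence (fun _ => M) ?_ ?_
        (integrable_const _) ?_
      · filter_upwards [hev] with y hy
        exact (hφ.mul (Complex.continuous_im.comp
          (continuous_stieltjes_line ρ hy.1))).aestronglyMeasurable
      · filter_upwards [hev] with y hy
        filter_upwards [ae_restrict_mem measurableSet_Ioo] with x hx
        rw [Real.norm_eq_abs, abs_mul]
        exact (mul_le_of_le_one_left (abs_nonneg _) (hφ1 x)).trans (hM x hx y hy)
      · filter_upwards [ae_restrict_mem measurableSet_Ioo] with x hx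
        exact (hlim x hx).const_mul _
    have h2 := tendsto_nhds_unique (h1.congr' (hev.mono fun y hy =>
      integral_mul_stieltjes_im ρ hφ hφ1 hφ0 hy.1)) (tendsto_integral_poisson hφ hφ1 ρ)
    simp only [← mul_assoc] at h2
    rw [integral_mul_const, integral_mul_const] at h2
    exact (mul_right_cancel₀ Real.pi_ne_zero h2).symm
  -- Tent functions pass the identity from continuous test functions to open intervals, and these
  -- determine a finite measure.
  have hIoo : ∀ p q : ℝ, Ioo p q ⊆ Ioo c d →
      (ρ : Measure ℝ).real (Ioo p q) = ∫ x in Ioo p q, f x := by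
    intro p q hpq
    have h1 : Tendsto (fun n => ∫ x, tent p q n x ∂(ρ : Measure ℝ)) atTop
        (𝓝 (∫ x, (Ioo p q).indicator 1 x ∂(ρ : Measure ℝ))) :=
      tendsto_integral_of_dominated_convergence (fun _ => 1)
        (fun n => (continuous_tent p q n).aestronglyMeasurable) (integrable_const _)
        (fun n => Eventually.of_forall fun x => abs_tent_le_one p q n x)
        (Eventually.of_forall fun x => tendsto_tent p q x)
    have h2 : Tendsto (fun n => ∫ x in Ioo c d, tent p q n x * f x) atTop
        (𝓝 (∫ x in Ioo c d, (Ioo p q).indicator 1 x * f x)) :=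
      tendsto_integral_of_dominated_convergence f
        (fun n => ((continuous_tent p q n).measurable.mul hf).aestronglyMeasurable) hfi
        (fun n => Eventually.of_forall fun x => by
          rw [Real.norm_eq_abs, abs_mul, abs_of_nonneg (hf0 x)]
          exact mul_le_of_le_one_left (hf0 x) (abs_tent_le_one p q n x))
        (Eventually.of_forall fun x => (tendsto_tent p q x).mul_const _)
    have h3 := tendsto_nhds_unique h1 (h2.congr fun n =>
      (key _ (continuous_tent p q n) (abs_tent_le_one p q n)
        (fun x hx => tent_eq_zero n fun h => hx (hpq h))).symm)
    rw [integral_indicator_one measurableSet_Ioo] at h3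
    rw [h3]
    have h4 : ∀ x, (Ioo p q).indicator (1 : ℝ → ℝ) x * f x = (Ioo p q).indicator f x := fun x => by
      by_cases hx : x ∈ Ioo p q <;> simp [hx]
    simp only [h4]
    rw [setIntegral_indicator measurableSet_Ioo, inter_eq_right.2 hpq]
  have : IsFiniteMeasure ((volume.restrict (Ioo c d)).withDensity
      (fun x => ENNReal.ofReal (f x))) :=
    isFiniteMeasure_withDensity_ofReal hfi.2
  refine Real.measure_ext_Ioo_rat fun p q => ?_
  rw [Measure.restrict_apply measurableSet_Ioo, withDensity_apply _ measurableSet_Ioo,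
    Measure.restrict_restrict measurableSet_Ioo, Ioo_inter_Ioo]
  set p' := max (p : ℝ) c
  set q' := min (q : ℝ) d
  have hsub : Ioo p' q' ⊆ Ioo c d := Ioo_subset_Ioo (le_max_right _ _) (min_le_right _ _)
  rw [← ofReal_integral_eq_lintegral_ofReal (hfi.mono_set hsub)
    (Eventually.of_forall hf0), ← hIoo _ _ hsub, ofReal_measureReal]

end Inversion

/-! ### Finite speed of propagation -/

section Flow

variable {F : ℝ → ℂ → ℂ} {T r R N M K : ℝ} {h k : ℂ → ℂ} {Z U : ℝ → ℂ → ℂ}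

lemma IsFlow.norm_Z_sub_le (hZ : IsFlow F T r R N h k Z U) {s : ℂ} (hs : s ∈ ball (0 : ℂ) r)
    {t τ : ℝ} (ht : t ∈ Icc 0 T) (hτ : τ ∈ Icc 0 T) : ‖Z t s - Z τ s‖ ≤ N * |t - τ| :=
  (convex_Icc 0 T).norm_image_sub_le_of_norm_hasDerivWithin_le
    (fun x hx => hZ.derivZ x hx s hs)
    (fun x hx => by rw [norm_neg]; exact hZ.boundU x hx s hs) hτ ht

lemma IsFlow.norm_U_sub_le (hZ : IsFlow F T r R N h k Z U) (hF : IsForcing F T R M K) {s : ℂ}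
    (hs : s ∈ ball (0 : ℂ) r) {t τ : ℝ} (ht : t ∈ Icc 0 T) (hτ : τ ∈ Icc 0 T) :
    ‖U t s - U τ s‖ ≤ M * |t - τ| :=
  (convex_Icc 0 T).norm_image_sub_le_of_norm_hasDerivWithin_le
    (fun x hx => hZ.derivU x hx s hs)
    (fun x hx => hF.bound x hx _ (mem_closedBall_zero_iff.2 (hZ.boundZ x hx s hs))) hτ ht

end Flow

lemma IsFlow.stieltjes_eq {V : ℂ → ℂ} (hV : IsPotential V) {T : ℝ}
    {ρ : ℝ → ProbabilityMeasure ℝ} (hρ : IsSolution V T ρ) {r R N : ℝ} {h k : ℂ → ℂ}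
    {Z U : ℝ → ℂ → ℂ} (hZ : IsFlow (fun t => forcing V (ρ t)) T r R N h k Z U) {t c : ℝ}
    (ht : t ∈ Icc 0 T) {s : ℂ} (hs : s ∈ ball (0 : ℂ) r) (hc : 0 < c)
    (him : ∀ τ ∈ Icc 0 t, c ≤ (Z τ s).im)
    (h0 : stieltjes (ρ 0) (h s) + deriv V (h s) / 2 = k s) :
    stieltjes (ρ t) (Z t s) + deriv V (Z t s) / 2 = U t s := by
  have hsub : Icc 0 t ⊆ Icc 0 T := Icc_subset_Icc_right ht.2
  obtain ⟨e1, e2⟩ := hZ.init s hs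
  exact hρ.eq_along_characteristic hV (z := fun τ => Z τ s) (u := fun τ => U τ s) ht hc
    (fun τ hτ => hZ.derivZ τ (hsub hτ) s hs) (fun τ hτ => hZ.derivU τ (hsub hτ) s hs) him
    (by simp only [e1, e2, h0])

lemma IsPotential.realHol_deriv_add {V : ℂ → ℂ} (hV : IsPotential V) (x r : ℝ) :
    RealHol (fun s => deriv V (x + s)) r :=
  ⟨(hV.differentiable_deriv.comp (by fun_prop : Differentiable ℂ fun s : ℂ => (x : ℂ) + s))
    |>.differentiableOn, fun s _ => by rw [← hV.deriv_apply_conj, map_add, conj_ofReal]⟩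

lemma ae_le_norm_of_measure_Ioo_eq_zero {ρ : ProbabilityMeasure ℝ} {x r : ℝ}
    (h : (ρ : Measure ℝ) (Ioo (x - 2 * r) (x + 2 * r)) = 0) {s : ℂ} (hs : ‖s‖ ≤ r) :
    ∀ᵐ u : ℝ ∂(ρ : Measure ℝ), r ≤ ‖(u : ℂ) - (x + s)‖ := by
  filter_upwards [measure_eq_zero_iff_ae_notMem.1 h] with u hu
  have h1 : 2 * r ≤ |u - x| := by
    by_contra hc
    rw [not_le, abs_lt] at hc
    exact hu ⟨by linarith [hc.1], by linarith [hc.2]⟩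
  have h2 : ‖(u : ℂ) - x‖ = |u - x| := by rw [← ofReal_sub, norm_real, Real.norm_eq_abs]
  have h3 : ‖(u : ℂ) - x‖ ≤ ‖(u : ℂ) - (x + s)‖ + ‖s‖ := by
    have : (u : ℂ) - x = ((u : ℂ) - (x + s)) + s := by ring
    rw [this]
    exact norm_add_le _ _
  linarith

/-- If the initial measure does not charge an interval then for a short time the solution does not
charge a smaller concentric interval. -/
theorem exists_time_measure_Ioo_eq_zero {V : ℂ → ℂ} (hV : IsPotential V) (b B : ℝ) {r : ℝ}
    (hr : 0 < r) :
    ∃ δ > 0, ∀ (T : ℝ) (ρ : ℝ → ProbabilityMeasure ℝ), T ≤ δ → IsSolution V T ρ →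
      (∀ t ∈ Icc 0 T, CarriedBy (ρ t) b) → ∀ x : ℝ, |x| ≤ B →
      (ρ 0 : Measure ℝ) (Ioo (x - 2 * r) (x + 2 * r)) = 0 →
      ∀ t ∈ Icc 0 T, (ρ t : Measure ℝ) (Ioo (x - r / 16) (x + r / 16)) = 0 := by
  obtain ⟨D, hD⟩ := (isCompact_closedBall (0 : ℂ) (B + r)).exists_bound_of_continuousOn
    hV.differentiable_deriv.continuous.continuousOn
  obtain ⟨M, hM0, hM⟩ := exists_isForcing hV b (B + r + 1)
  set N := 1 / r + |D| / 2 + 1 with hNdef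
  have hN0 : 0 < N := by positivity
  -- The first bound lets the flow exist up to time T. The second keeps Z_t − x within r/8 of the
  -- identity, so that the inversion lemmas apply.
  refine ⟨min (1 / (N + M)) (r / 8 / N), by positivity, fun T ρ hTδ hρ hb x hx hx0 t ht => ?_⟩
  have hT : 0 ≤ T := ht.1.trans ht.2
  have hT1 : T * (N + M) ≤ 1 := by
    rw [← le_div_iff₀ (by positivity)]; exact hTδ.trans (min_le_left _ _)
  have hTN : T * N ≤ 1 := le_trans (by gcongr; linarith) hT1
  have hTM : T * M ≤ 1 := le_trans (by gcongr; linarith) hT1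
  have hT2 : N * T ≤ r / 8 := by
    rw [mul_comm, ← le_div_iff₀ hN0]; exact hTδ.trans (min_le_right _ _)
  have hF := hM T ρ hρ.continuousOn hb
  let h : ℂ → ℂ := fun s => x + s
  let k : ℂ → ℂ := fun s => stieltjes (ρ 0) (x + s) + deriv V (x + s) / 2
  have hdist : ∀ s ∈ closedBall (0 : ℂ) r, ∀ᵐ u : ℝ ∂(ρ 0 : Measure ℝ), r ≤ ‖(u : ℂ) - (x + s)‖ :=
    fun s hs => ae_le_norm_of_measure_Ioo_eq_zero hx0 (mem_closedBall_zero_iff.1 hs)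
  have hkd : ∀ s ∈ closedBall (0 : ℂ) r, DifferentiableAt ℂ k s := by
    intro s hs
    refine DifferentiableAt.add ?_ ?_
    · exact (hasDerivAt_stieltjes hr (hdist s hs)).differentiableAt.comp s (by fun_prop)
    · exact ((hV.differentiable_deriv _).comp s (by fun_prop)).div_const 2
  have hVb : ∀ s ∈ closedBall (0 : ℂ) r, ‖deriv V (x + s)‖ ≤ |D| := by
    intro s hs
    refine (hD _ ?_).trans (le_abs_self D)
    rw [mem_closedBall_zero_iff] at hs ⊢
    refine (norm_add_le _ _).trans (add_le_add ?_ hs)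
    rwa [norm_real]
  have hh : RealHol h r := (RealHol.ofReal x).add RealHol.id
  have hk : RealHol k r := by
    refine ⟨fun s hs => (hkd s (ball_subset_closedBall hs)).differentiableWithinAt, fun s hs => ?_⟩
    have := stieltjes_conj (ρ 0) (x + s)
    have h2 := (hV.realHol_deriv_add x r).symm s hs
    simp only [k, map_add, map_div₀, conj_ofReal, map_ofNat] at this ⊢
    rw [this, h2]
  obtain ⟨Z, U, hZ⟩ := exists_flow hT hr hF (h := h) (k := k) hh (by fun_prop) hk
    (fun s hs => (hkd s hs).continuousAt.continuousWithinAt)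
    (fun s hs => by
      rw [mem_closedBall_zero_iff] at hs
      have := norm_add_le (x : ℂ) s
      rw [norm_real, Real.norm_eq_abs] at this
      simp only [h]
      linarith)
    (fun s hs => by
      have h1 := norm_stieltjes_le hr (hdist s hs)
      have h2 := hVb s hs
      have h3 := norm_add_le (stieltjes (ρ 0) (x + s)) (deriv V (x + s) / 2)
      rw [norm_div, Complex.norm_ofNat] at h3
      simp only [k]
      linarith) hTN hTM
  have hfR : ∀ τ ∈ Icc 0 T, RealHol (fun s => Z τ s - x) r := fun τ hτ => by
    have := (hZ.holZ τ hτ).add (RealHol.ofReal (-x))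
    simpa [sub_eq_add_neg] using this
  have hfid : ∀ τ ∈ Icc 0 T, ∀ s ∈ ball (0 : ℂ) r, ‖(Z τ s - x) - s‖ ≤ r / 8 := by
    intro τ hτ s hs
    have h1 := hZ.norm_Z_sub_le hs hτ ⟨le_rfl, hT⟩
    rw [(hZ.init s hs).1, sub_zero, abs_of_nonneg hτ.1] at h1
    rw [sub_sub]
    exact h1.trans (le_trans (by gcongr; exact hτ.2) hT2)
  have him : ∀ τ ∈ Icc 0 T, ∀ s ∈ ball (0 : ℂ) (r / 2), 0 < s.im →
      s.im / 2 ≤ (Z τ s).im ∧ (Z τ s).im ≤ 2 * s.im := by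
    intro τ hτ s hs hs0
    have h1 := abs_le.1 (im_pos_of_near_id (hfR τ hτ) (hfid τ hτ) hs)
    rw [abs_of_pos hs0] at h1
    simp only [sub_im, ofReal_im, sub_zero] at h1
    constructor <;> linarith [h1.1, h1.2]
  have hUd : ∀ s ∈ ball (0 : ℂ) (r / 2), ‖deriv (U t) s‖ ≤ N / (r - r / 2) := fun s hs =>
    norm_deriv_le_of_ball (hZ.holU t ht).diff (hZ.boundU t ht) (by linarith) hs
  have hVd : ∀ s ∈ ball (0 : ℂ) (r / 2), ‖deriv (fun s => deriv V (x + s)) s‖ ≤ |D| / (r - r / 2) :=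
    fun s hs => norm_deriv_le_of_ball (hV.realHol_deriv_add x r).diff
      (fun s hs => hVb s (ball_subset_closedBall hs)) (by linarith) hs
  set C := N / (r - r / 2) * 2 + |D| / (r - r / 2) with hC
  have hC0 : 0 ≤ C := by
    have : 0 < r - r / 2 := by linarith
    positivity
  -- Every point x' + iy is reached by a characteristic starting at height at most 2y. Since U_t and
  -- V' are real on the real axis with bounded derivative, Im m_t(x' + iy) is O(y) and has boundary
  -- value 0.
  have key : ∀ x' ∈ Ioo (x - r / 16) (x + r / 16), ∀ y ∈ Ioo 0 (r / 16),
      |(stieltjes (ρ t) (x' + y * I)).im| ≤ C * y := by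
    intro x' hx' y hy
    set ζ : ℂ := (x' + y * I) - x with hζdef
    have hζim : ζ.im = y := by simp [hζdef]
    have hζ : ‖ζ‖ ≤ r / 8 := by
      have h1 := norm_le_abs_re_add_abs_im ζ
      have h2 : |ζ.re| ≤ r / 16 := by
        simp only [hζdef, sub_re, add_re, ofReal_re, mul_re, I_re, mul_zero, ofReal_im, I_im,
          mul_one, sub_self, add_zero]
        exact abs_le.2 ⟨by linarith [hx'.1], by linarith [hx'.2]⟩
      rw [hζim, abs_of_pos hy.1] at h1
      linarith [hy.2]
    obtain ⟨s, hs, hfs⟩ := exists_preimage_of_near_id hr (hfR t ht).diff (hfid t ht) hζ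
    have hs2 : s ∈ ball (0 : ℂ) (r / 2) := closedBall_subset_ball (by linarith) hs
    have hsr : s ∈ ball (0 : ℂ) r := ball_subset_ball (by linarith) hs2
    have hs0 : 0 < s.im := by
      rw [← im_pos_iff_of_near_id (hfR t ht) (hfid t ht) hs2, hfs, hζim]
      exact hy.1
    have hZs : Z t s = x' + y * I := by
      rw [hζdef] at hfs
      exact sub_left_injective hfs
    have heq := hZ.stieltjes_eq hV hρ ht hsr (half_pos hs0)
      (fun τ hτ => (him τ ⟨hτ.1, hτ.2.trans ht.2⟩ s hs2 hs0).1) rfl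
    rw [hZs] at heq
    have hsy : s.im ≤ 2 * y := by
      have := (him t ht s hs2 hs0).1
      rw [hZs] at this
      simp at this
      linarith
    have h1 := ((hZ.holU t ht).mono (by linarith : r / 2 ≤ r)).abs_im_le hUd hs2
    have hζ2 : ζ ∈ ball (0 : ℂ) (r / 2) := mem_ball_zero_iff.2 (by linarith)
    have h2 := (hV.realHol_deriv_add x (r / 2)).abs_im_le hVd hζ2
    rw [hζim, abs_of_pos hy.1, show (x : ℂ) + ζ = x' + y * I by rw [hζdef]; ring] at h2
    rw [abs_of_pos hs0] at h1
    have h3 : (stieltjes (ρ t) (x' + y * I)).im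
        = (U t s).im - (deriv V (x' + y * I)).im / 2 := by
      rw [← heq, add_im, show (deriv V (x' + y * I) / 2).im = (deriv V (x' + y * I)).im / 2 by simp]
      ring
    rw [h3]
    have h4 : N / (r - r / 2) * s.im ≤ N / (r - r / 2) * (2 * y) := by
      have : 0 < r - r / 2 := by linarith
      gcongr
    have h5 := abs_sub (U t s).im ((deriv V (x' + y * I)).im / 2)
    rw [abs_div, abs_two] at h5
    have h6 := abs_nonneg (deriv V (x' + y * I)).im
    rw [hC]
    nlinarith
  have hres := restrict_eq_withDensity (ρ := ρ t) (c := x - r / 16) (d := x + r / 16)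
    (y₀ := r / 16) (M := C * (r / 16)) (f := fun _ => 0) (by positivity) measurable_const
    (fun _ => le_rfl) (fun x' hx' => by
      rw [zero_mul]
      have h0 : Tendsto (fun y : ℝ => C * y) (𝓝[>] 0) (𝓝 0) := by
        have := ((continuous_const_mul C).tendsto 0).mono_left (nhdsWithin_le_nhds (s := Ioi 0))
        simpa using this
      refine squeeze_zero_norm' ?_ h0
      filter_upwards [Ioo_mem_nhdsGT (by positivity : 0 < r / 16)] with y hy
      exact key x' hx' y hy)
    (fun x' hx' y hy => (key x' hx' y hy).trans (by gcongr; exact hy.2.le))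
  have := congrArg (fun μ : Measure ℝ => μ univ) hres
  simpa using this

/-! ### Confinement of the support -/

section Support

variable {V : ℂ → ℂ} {T : ℝ} {ρ : ℝ → ProbabilityMeasure ℝ}

lemma IsSolution.mono (hρ : IsSolution V T ρ) {T' : ℝ} (h : T' ≤ T) : IsSolution V T' ρ := by
  have hsub : Icc 0 T' ⊆ Icc 0 T := Icc_subset_Icc_right h
  obtain ⟨b, hb⟩ := hρ.carried
  exact ⟨hρ.continuousOn.mono hsub, ⟨b, fun t ht => hb t (hsub ht)⟩,
    fun t ht z hz => (hρ.equation t (hsub ht) z hz).mono hsub⟩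

lemma IsSolution.shift (hρ : IsSolution V T ρ) {t₀ : ℝ} (h : 0 ≤ t₀) :
    IsSolution V (T - t₀) (fun s => ρ (t₀ + s)) := by
  have hmaps : MapsTo (fun s => t₀ + s) (Icc 0 (T - t₀)) (Icc 0 T) := fun s hs =>
    ⟨by linarith [hs.1], by linarith [hs.2]⟩
  obtain ⟨b, hb⟩ := hρ.carried
  refine ⟨hρ.continuousOn.comp (by fun_prop) hmaps, ⟨b, fun t ht => hb _ (hmaps ht)⟩,
    fun t ht z hz => ?_⟩
  have h1 := hρ.equation _ (hmaps ht) z hz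
  have h2 : HasDerivWithinAt (fun s => t₀ + s) 1 (Icc 0 (T - t₀)) t :=
    (hasDerivWithinAt_id _ _).const_add t₀
  have := h1.scomp t h2 hmaps
  simpa [Function.comp_def] using this

lemma CarriedBy.mono {μ : ProbabilityMeasure ℝ} {a b : ℝ} (h : CarriedBy μ a) (hab : a ≤ b) :
    CarriedBy μ b :=
  measure_mono_null (compl_subset_compl.2 (Icc_subset_Icc (by linarith) hab)) h

/-- For a short time that depends on the total range the support grows by at most one. -/
lemma exists_time_carriedBy_of_carriedBy (hV : IsPotential V) (a b : ℝ) :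
    ∃ δ > 0, ∀ (T : ℝ) (ρ : ℝ → ProbabilityMeasure ℝ), T ≤ δ → IsSolution V T ρ →
      (∀ t ∈ Icc 0 T, CarriedBy (ρ t) b) → CarriedBy (ρ 0) a →
      ∀ t ∈ Icc 0 T, CarriedBy (ρ t) (a + 1) := by
  obtain ⟨δ, hδ, h⟩ := exists_time_measure_Ioo_eq_zero hV b b (r := 1 / 2) (by norm_num)
  refine ⟨δ, hδ, fun T ρ hT hρ hb ha t ht => ?_⟩
  -- For |x| > a + 1 the interval of radius 1 = 2·(1/2) about x misses [−a,a], so a neighbourhood of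
  -- x stays free of mass. Local nullity is then summed up.
  have h1 : (ρ t : Measure ℝ) ((Icc (-(a + 1)) (a + 1))ᶜ ∩ Icc (-b) b) = 0 := by
    refine measure_null_of_locally_null _ fun x hx => ?_
    refine ⟨Ioo (x - 1 / 2 / 16) (x + 1 / 2 / 16),
      mem_nhdsWithin_of_mem_nhds (Ioo_mem_nhds (by norm_num) (by norm_num)),
      h T ρ hT hρ hb x (abs_le.2 hx.2) (measure_mono_null (t := (Icc (-a) a)ᶜ) (fun u hu hua => ?_) ha) t ht⟩
    apply hx.1
    norm_num at hu
    exact ⟨by linarith [hu.1, hu.2, hua.1], by linarith [hu.1, hu.2, hua.2]⟩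
  refine measure_mono_null (t := ((Icc (-(a + 1)) (a + 1))ᶜ ∩ Icc (-b) b) ∪ (Icc (-b) b)ᶜ) ?_
    (measure_union_null h1 (hb t ht))
  intro x hx
  by_cases hxb : x ∈ Icc (-b) b
  · exact Or.inl ⟨hx, hxb⟩
  · exact Or.inr hxb

/-- For a short time that depends only on the initial range the support grows by at most one. -/
theorem exists_time_carriedBy (hV : IsPotential V) (a : ℝ) :
    ∃ T₀ > 0, ∀ (T : ℝ) (ρ : ℝ → ProbabilityMeasure ℝ), T ≤ T₀ → IsSolution V T ρ →
      CarriedBy (ρ 0) a → ∀ t ∈ Icc 0 T, CarriedBy (ρ t) (a + 1) := by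
  -- The range b of a solution is not controlled a priori, so the bound a + 1 is bootstrapped. A
  -- step δ, which may depend on b, enlarges a + 1 to at most a + 2. Applied with range a + 2, the
  -- short-time bound brings this back to a + 1. The time T₀ comes only from the latter and does not
  -- depend on b.
  obtain ⟨T₀, hT₀, h⟩ := exists_time_carriedBy_of_carriedBy hV a (a + 2)
  refine ⟨T₀, hT₀, fun T ρ hT hρ ha => ?_⟩
  obtain ⟨b, hb⟩ := hρ.carried
  obtain ⟨δ, hδ, h'⟩ := exists_time_carriedBy_of_carriedBy hV (a + 1) b
  have step : ∀ n : ℕ, ∀ t ∈ Icc 0 T, t ≤ n * δ → CarriedBy (ρ t) (a + 1) := by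
    intro n
    induction n with
    | zero =>
      intro t ht htn
      have : t = 0 := le_antisymm (by simpa using htn) ht.1
      rw [this]
      exact ha.mono (by linarith)
    | succ n ih =>
      intro t ht htn
      refine h t ρ (ht.2.trans hT) (hρ.mono ht.2) (fun s hs => ?_) ha t ⟨ht.1, le_rfl⟩
      rcases le_total s (n * δ) with hsn | hsn
      · exact (ih s ⟨hs.1, hs.2.trans ht.2⟩ hsn).mono (by linarith)
      · have hn0 : 0 ≤ n * δ := by positivity
        have hnT : n * δ ∈ Icc 0 T := ⟨hn0, hsn.trans (hs.2.trans ht.2)⟩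
        have hsol := (hρ.mono (hs.2.trans ht.2)).shift hn0
        have h1 := h' (s - n * δ) (fun τ => ρ (n * δ + τ)) (by
          push_cast at htn
          linarith [hs.2]) hsol
          (fun τ hτ => hb _ ⟨by linarith [hτ.1], by linarith [hτ.2, hs.2, ht.2]⟩)
          (by simpa using ih _ hnT le_rfl) (s - n * δ) ⟨by linarith, le_rfl⟩
        simp only [add_sub_cancel] at h1
        exact h1.mono (by linarith)
  intro t ht
  obtain ⟨n, hn⟩ := exists_nat_ge (t / δ)
  exact step n t ht ((div_le_iff₀ hδ).1 hn)

end Support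

/-! ### The principal square root and its boundary values -/

section SquareRoot

/-- The principal branch of the square root. -/
noncomputable def csqrt (w : ℂ) : ℂ := w ^ ((2 : ℕ) : ℂ)⁻¹

lemma csqrt_sq (w : ℂ) : csqrt w ^ 2 = w := cpow_nat_inv_pow w two_ne_zero

lemma norm_csqrt_sq (w : ℂ) : ‖csqrt w‖ ^ 2 = ‖w‖ := by rw [← norm_pow, csqrt_sq]

lemma norm_csqrt (w : ℂ) : ‖csqrt w‖ = Real.sqrt ‖w‖ := by
  rw [← norm_csqrt_sq w, Real.sqrt_sq (norm_nonneg _)]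

lemma csqrt_zero : csqrt 0 = 0 := by
  have := csqrt_sq 0
  simpa using this

lemma csqrt_mem_ball {w : ℂ} {r : ℝ} (hr : 0 ≤ r) (hw : w ∈ ball (0 : ℂ) (r ^ 2)) :
    csqrt w ∈ ball (0 : ℂ) r := by
  rw [mem_ball_zero_iff] at hw ⊢
  rw [← norm_csqrt_sq] at hw
  exact lt_of_pow_lt_pow_left₀ 2 hr hw

lemma differentiableAt_csqrt {w : ℂ} (hw : w ∈ slitPlane) : DifferentiableAt ℂ csqrt w :=
  (differentiableAt_id.cpow_const hw)

lemma continuousAt_csqrt_zero : ContinuousAt csqrt 0 := by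
  rw [ContinuousAt, csqrt_zero, tendsto_zero_iff_norm_tendsto_zero]
  simp only [norm_csqrt]
  have : Continuous fun w : ℂ => Real.sqrt ‖w‖ := by fun_prop
  simpa using this.tendsto 0

lemma csqrt_re_pos {w : ℂ} (hw : w ∈ slitPlane) : 0 < (csqrt w).re := by
  have h0 := slitPlane_ne_zero hw
  rw [csqrt, cpow_def_of_ne_zero h0, exp_re]
  refine mul_pos (Real.exp_pos _) (Real.cos_pos_of_mem_Ioo ?_)
  have h1 := neg_pi_lt_arg w
  have h2 : w.arg < Real.pi := lt_of_le_of_ne (arg_le_pi w) (mem_slitPlane_iff_arg.1 hw).1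
  have h3 : (log w * ((2 : ℕ) : ℂ)⁻¹).im = w.arg / 2 := by
    rw [show (((2 : ℕ) : ℂ)⁻¹) = ((1 / 2 : ℝ) : ℂ) by push_cast; norm_num, im_mul_ofReal, log_im]
    ring
  rw [h3]
  constructor <;> linarith

lemma csqrt_im_pos {w : ℂ} (hw : 0 < w.im) : 0 < (csqrt w).im := by
  have h1 := csqrt_re_pos (w := w) (Or.inr hw.ne')
  have h2 : 2 * (csqrt w).re * (csqrt w).im = w.im := by
    conv_rhs => rw [← csqrt_sq w]
    simp [sq]; ring
  by_contra hc
  nlinarith [not_lt.1 hc]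

/-- The right-hand side continues across the negative axis, where the principal branch jumps, and so
yields the boundary values from above. -/
lemma csqrt_eq_of_im_pos {w : ℂ} (hw : 0 < w.im) : csqrt w = I * csqrt (-w) := by
  have h1 := csqrt_im_pos hw
  have h2 : 0 < (I * csqrt (-w)).im := by
    have := csqrt_re_pos (w := -w) (Or.inr (by simpa using hw.ne'))
    simpa using this
  have h3 : csqrt w ^ 2 = (I * csqrt (-w)) ^ 2 := by
    rw [mul_pow, csqrt_sq, csqrt_sq, I_sq]; ring
  rcases sq_eq_sq_iff_eq_or_eq_neg.1 h3 with h | h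
  · exact h
  · rw [h, neg_im] at h1
    linarith

lemma csqrt_ofReal {x : ℝ} (hx : 0 ≤ x) : csqrt x = (Real.sqrt x : ℂ) := by
  rw [csqrt, Real.sqrt_eq_rpow, ofReal_cpow hx]
  norm_num

/-- The boundary values of the square root on the real line from above. -/
lemma tendsto_csqrt_above (x : ℝ) :
    Tendsto (fun y : ℝ => csqrt (x + y * I)) (𝓝[>] 0)
      (𝓝 ((Real.sqrt (max x 0) : ℂ) + (Real.sqrt (max (-x) 0) : ℂ) * I)) := by
  rcases lt_trichotomy x 0 with h | h | h
  · rw [max_eq_right h.le, max_eq_left (by linarith)]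
    have h1 : Tendsto (fun y : ℝ => I * csqrt (-(x + y * I))) (𝓝[>] 0)
        (𝓝 (I * csqrt (-(x + (0 : ℝ) * I)))) := by
      have hc : ContinuousAt (fun y : ℝ => I * csqrt (-(x + y * I))) 0 := by
        refine continuousAt_const.mul (ContinuousAt.comp (g := csqrt)
          (f := fun y : ℝ => (-(x + y * I) : ℂ)) ?_ (by fun_prop))
        exact (differentiableAt_csqrt (Or.inl (by simpa using h))).continuousAt
      exact hc.tendsto.mono_left nhdsWithin_le_nhds
    have h2 : I * csqrt (-(x + (0 : ℝ) * I)) = (Real.sqrt 0 : ℂ) + (Real.sqrt (-x) : ℂ) * I := by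
      rw [ofReal_zero, zero_mul, add_zero, ← ofReal_neg, csqrt_ofReal (by linarith)]
      simp [mul_comm]
    rw [h2] at h1
    refine h1.congr' ?_
    filter_upwards [self_mem_nhdsWithin] with y hy
    exact (csqrt_eq_of_im_pos (by simpa using hy)).symm
  · subst h
    have h1 := continuousAt_csqrt_zero
    have hc : ContinuousAt (fun y : ℝ => csqrt (((0 : ℝ) : ℂ) + y * I)) 0 :=
      ContinuousAt.comp (g := csqrt) (f := fun y : ℝ => (((0 : ℝ) : ℂ) + y * I)) (by simpa using h1)
        (by fun_prop)
    have := hc.tendsto.mono_left (nhdsWithin_le_nhds (s := Ioi 0))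
    simpa [csqrt_zero] using this
  · rw [max_eq_left h.le, max_eq_right (by linarith)]
    have hc : ContinuousAt (fun y : ℝ => csqrt (x + y * I)) 0 := by
      refine ContinuousAt.comp (g := csqrt) (f := fun y : ℝ => (x + y * I : ℂ)) ?_ (by fun_prop)
      exact (differentiableAt_csqrt (Or.inl (by simpa using h))).continuousAt
    have := hc.tendsto.mono_left (nhdsWithin_le_nhds (s := Ioi 0))
    simpa [csqrt_ofReal h.le] using this

/-- An even holomorphic function of `ζ` is a holomorphic function of `ζ ^ 2`. -/
lemma exists_eq_comp_sq {e : ℂ → ℂ} {r : ℝ} (hr : 0 < r) (he : DifferentiableOn ℂ e (ball 0 r))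
    (heven : ∀ ζ ∈ ball (0 : ℂ) r, e (-ζ) = e ζ) :
    ∃ a : ℂ → ℂ, DifferentiableOn ℂ a (ball 0 (r ^ 2)) ∧ ∀ ζ ∈ ball (0 : ℂ) r, a (ζ ^ 2) = e ζ := by
  have hev : ∀ ζ ∈ ball (0 : ℂ) r, ∀ ξ, ξ ^ 2 = ζ ^ 2 → e ξ = e ζ := by
    intro ζ hζ ξ h
    rcases sq_eq_sq_iff_eq_or_eq_neg.1 h with rfl | rfl
    · rfl
    · exact heven ζ hζ
  have hmem : ∀ {w}, w ∈ ball (0 : ℂ) (r ^ 2) → csqrt w ∈ ball (0 : ℂ) r :=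
    fun hw => csqrt_mem_ball hr.le hw
  refine ⟨fun w => e (csqrt w), ?_, fun ζ hζ => hev ζ hζ _ (csqrt_sq _)⟩
  have hnhds : ball (0 : ℂ) (r ^ 2) ∈ 𝓝 (0 : ℂ) := ball_mem_nhds 0 (by positivity)
  -- At the branch point only continuity is needed: the singularity is removable.
  refine (differentiableOn_compl_singleton_and_continuousAt_iff hnhds).1 ⟨?_, ?_⟩
  · rintro w ⟨hw, hw0⟩
    refine DifferentiableAt.differentiableWithinAt ?_
    by_cases hs : w ∈ slitPlane
    · exact (he.differentiableAt (isOpen_ball.mem_nhds (hmem hw))).comp w (differentiableAt_csqrt hs)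
    · have hs' : -w ∈ slitPlane := by
        rw [mem_slitPlane_iff, not_or, not_lt, not_not] at hs
        refine Or.inl ?_
        rcases hs.1.lt_or_eq with h | h
        · simpa using h
        · exact (hw0 (Complex.ext h hs.2)).elim
      -- On the cut the other formula for a root, i√(−w), is holomorphic. Evenness of e makes the
      -- choice of root irrelevant.
      have hw' : I * csqrt (-w) ∈ ball (0 : ℂ) r := by
        have := hmem (w := -w) (by simpa using hw)
        simpa using this
      have hd : DifferentiableAt ℂ (fun v => e (I * csqrt (-v))) w :=
        (he.differentiableAt (isOpen_ball.mem_nhds hw')).comp (f := fun v => I * csqrt (-v)) w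
          (((differentiableAt_csqrt hs').comp (f := fun v : ℂ => -v) w (by fun_prop)).const_mul I)
      refine hd.congr_of_eventuallyEq ?_
      filter_upwards [isOpen_ball.mem_nhds hw] with v hv
      refine (hev _ (hmem hv) _ ?_).symm
      rw [mul_pow, csqrt_sq, csqrt_sq, I_sq]; ring
  · refine ContinuousAt.comp (g := e) ?_ continuousAt_csqrt_zero
    rw [csqrt_zero]
    exact (he.differentiableAt (ball_mem_nhds 0 hr)).continuousAt

end SquareRoot

/-! ### Uniformization of the initial edge -/

/-- In the coordinate `s = √(z - E)` a Stieltjes transform with square root behaviour at `E`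
continues analytically across the edge. -/
theorem HasSqrtEdge.exists_uniformization {ρ : ProbabilityMeasure ℝ} {E : ℝ}
    (hedge : HasSqrtEdge ρ E) :
    ∃ r > 0, ∃ k : ℂ → ℂ, RealHol k r ∧ (∃ c : ℝ, 0 < c ∧ deriv k 0 = c) ∧
      ∀ s ∈ ball (0 : ℂ) r, 0 < s.re → 0 < s.im → stieltjes ρ (E + s ^ 2) = k s := by
  obtain ⟨hE, U, A, B, S, hU, hEU, hA, hB, hB0, hB1, hS, hmS⟩ := hedge
  set β := deriv B E with hβ
  have hnU : U ∈ 𝓝 (E : ℂ) := hU.mem_nhds hEU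
  have hD : DifferentiableOn ℂ (dslope B E) U :=
    (differentiableOn_dslope hnU).2 hB.differentiableOn
  have hDE : dslope B E E = β := dslope_same B E
  have hcont : ContinuousAt (fun z => dslope B E z / β) E :=
    ((hD.differentiableAt hnU).continuousAt).div_const β
  have hslit : ∀ᶠ z in 𝓝 (E : ℂ), dslope B E z / β ∈ slitPlane :=
    hcont.eventually (isOpen_slitPlane.mem_nhds (by
      simp only [hDE, div_self hB1]; exact one_mem_slitPlane))
  obtain ⟨δ, hδ, hball⟩ := Metric.mem_nhds_iff.1 (inter_mem hnU hslit)
  -- A holomorphic root of B(z)/(z − E). Dividing by β moves the value at E to 1, away from the cut.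
  let b : ℂ → ℂ := fun z => csqrt β * csqrt (dslope B E z / β)
  have hb : DifferentiableOn ℂ b (ball (E : ℂ) δ) := fun z hz => by
    have h1 : DifferentiableAt ℂ (fun z => dslope B E z / β) z :=
      (hD.differentiableAt (hU.mem_nhds (hball hz).1)).div_const β
    exact ((DifferentiableAt.comp (g := csqrt) z
      (differentiableAt_csqrt (hball hz).2) h1).const_mul _).differentiableWithinAt
  have hb2 : ∀ z, (z - E) * b z ^ 2 = B z := fun z => by
    have h1 : b z ^ 2 = dslope B E z := by
      simp only [b]
      rw [mul_pow, csqrt_sq, csqrt_sq]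
      field_simp
    rw [h1, ← smul_eq_mul, sub_smul_dslope, hB0, sub_zero]
  set r := Real.sqrt δ with hr
  have hr0 : 0 < r := Real.sqrt_pos.2 hδ
  have hr2 : r ^ 2 = δ := Real.sq_sqrt hδ.le
  have hmaps : ∀ s ∈ ball (0 : ℂ) r, (E : ℂ) + s ^ 2 ∈ ball (E : ℂ) δ := fun s hs => by
    rw [mem_ball_zero_iff] at hs
    rw [mem_ball, dist_eq_norm, add_sub_cancel_left, norm_pow, ← hr2]
    gcongr
  set Q : Set ℂ := ball 0 r ∩ ({s | 0 < s.re} ∩ {s | 0 < s.im}) with hQ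
  have hQim : ∀ s ∈ Q, 0 < ((E : ℂ) + s ^ 2).im := fun s hs => by
    have : ((E : ℂ) + s ^ 2).im = 2 * s.re * s.im := by simp [sq]; ring
    rw [this]
    exact mul_pos (mul_pos two_pos hs.2.1) hs.2.2
  have hQc : Convex ℝ Q := (convex_ball 0 r).inter
    ((convex_halfSpace_re_gt 0).inter (convex_halfSpace_im_gt 0))
  have hpoly : Differentiable ℂ fun s : ℂ => (E : ℂ) + s ^ 2 := by fun_prop
  have hbs : DifferentiableOn ℂ (fun s => b ((E : ℂ) + s ^ 2)) (ball 0 r) :=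
    hb.comp hpoly.differentiableOn hmaps
  have hAs : DifferentiableOn ℂ (fun s => A ((E : ℂ) + s ^ 2)) (ball 0 r) :=
    hA.differentiableOn.comp hpoly.differentiableOn fun s hs => (hball (hmaps s hs)).1
  have hSs : ContinuousOn (fun s => S ((E : ℂ) + s ^ 2)) Q :=
    hS.continuousOn.comp hpoly.continuous.continuousOn
      fun s hs => ⟨(hball (hmaps s hs.1)).1, hQim s hs⟩
  have hS2 : ∀ s ∈ Q, S ((E : ℂ) + s ^ 2) ^ 2 = (s * b ((E : ℂ) + s ^ 2)) ^ 2 := fun s hs => by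
    rw [(hmS _ (hball (hmaps s hs.1)).1 (hQim s hs)).1, ← hb2]
    ring
  have hbne : ∀ s ∈ ball (0 : ℂ) r, b ((E : ℂ) + s ^ 2) ≠ 0 := fun s hs => by
    refine mul_ne_zero (fun h => hB1 ?_) (fun h => ?_)
    · have := csqrt_sq β
      rw [h] at this
      simpa using this.symm
    · have := csqrt_re_pos (hball (hmaps s hs)).2
      rw [h] at this
      simp at this
  -- On the quadrant Re s, Im s > 0, which s ↦ E + s² maps into the upper half plane, two
  -- nonvanishing continuous roots of the same function differ by a constant sign.
  obtain ⟨σ, hσ0, hσ⟩ : ∃ σ : ℂ, σ ≠ 0 ∧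
      ∀ s ∈ Q, S ((E : ℂ) + s ^ 2) = σ * (s * b ((E : ℂ) + s ^ 2)) := by
    rcases hQc.isPreconnected.eq_or_eq_neg_of_sq_eq hSs
      ((continuousOn_id.mul (hbs.continuousOn.mono inter_subset_left))) (fun s hs => hS2 s hs)
      (fun {s} hs => mul_ne_zero (fun h => by
        have h3 := hs.2.1
        rw [show s = 0 from h] at h3
        simp at h3) (hbne s hs.1)) with h | h
    · exact ⟨1, one_ne_zero, fun s hs => by rw [one_mul]; exact h hs⟩
    · exact ⟨-1, by simp, fun s hs => by rw [neg_one_mul]; exact h hs⟩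
  let k : ℂ → ℂ := fun s => A ((E : ℂ) + s ^ 2) + σ * (s * b ((E : ℂ) + s ^ 2))
  have hkd : DifferentiableOn ℂ k (ball 0 r) :=
    hAs.add ((differentiableOn_id.mul hbs).const_mul σ)
  have hkm : ∀ s ∈ Q, stieltjes ρ (E + s ^ 2) = k s := fun s hs => by
    rw [(hmS _ (hball (hmaps s hs.1)).1 (hQim s hs)).2, hσ s hs]
  have hpt : ∀ (x y : ℝ), 0 < x → 0 < y → x + y < r → (x : ℂ) + y * I ∈ Q := by
    intro x y hx hy hxy
    refine ⟨mem_ball_zero_iff.2 (lt_of_le_of_lt (norm_le_abs_re_add_abs_im _) ?_), ?_, ?_⟩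
    · simpa [abs_of_pos hx, abs_of_pos hy] using hxy
    · simpa using hx
    · simpa using hy
  -- There is no mass to the right of E, so m is analytic and real there, and k agrees with it by
  -- continuity from the quadrant. The identity theorem then gives the symmetry of k on the whole
  -- disc.
  have hkreal : ∀ x : ℝ, 0 < x → x < r → (k x).im = 0 := by
    intro x hx hxr
    have hx2 : 0 < x ^ 2 := by positivity
    have hdist : ∀ᵐ u : ℝ ∂(ρ : Measure ℝ), x ^ 2 ≤ ‖(u : ℂ) - (E + x ^ 2 : ℝ)‖ := by
      filter_upwards [measure_eq_zero_iff_ae_notMem.1 hE] with u hu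
      rw [← ofReal_sub, norm_real, Real.norm_eq_abs, abs_sub_comm]
      rw [mem_Ioi, not_lt] at hu
      exact le_trans (by linarith) (le_abs_self _)
    have h1 : ContinuousAt (fun y : ℝ => stieltjes ρ (E + ((x : ℂ) + y * I) ^ 2)) 0 := by
      refine ContinuousAt.comp (g := stieltjes ρ)
        (f := fun y : ℝ => ((E : ℂ) + ((x : ℂ) + y * I) ^ 2)) ?_ (by fun_prop)
      have := (hasDerivAt_stieltjes hx2 hdist).continuousAt
      convert this using 1
      push_cast
      ring
    have h2 : ContinuousAt (fun y : ℝ => k ((x : ℂ) + y * I)) 0 := by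
      refine ContinuousAt.comp (g := k) (f := fun y : ℝ => ((x : ℂ) + y * I)) ?_ (by fun_prop)
      refine (hkd.differentiableAt (isOpen_ball.mem_nhds ?_)).continuousAt
      simpa [abs_of_pos hx] using hxr
    have h3 : k ((x : ℂ) + (0 : ℝ) * I) = stieltjes ρ (E + ((x : ℂ) + (0 : ℝ) * I) ^ 2) := by
      refine tendsto_nhds_unique (h2.tendsto.mono_left (nhdsWithin_le_nhds (s := Ioi 0)))
        ((h1.tendsto.mono_left (nhdsWithin_le_nhds (s := Ioi 0))).congr' ?_)
      filter_upwards [Ioo_mem_nhdsGT (by linarith : 0 < r - x)] with y hy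
      exact hkm _ (hpt x y hx hy.1 (by linarith [hy.2]))
    rw [ofReal_zero, zero_mul, add_zero] at h3
    rw [h3, ← conj_eq_iff_im, ← stieltjes_conj]
    simp
  have hkR : RealHol k r := by
    refine ⟨hkd, ?_⟩
    have hkc : DifferentiableOn ℂ (conj ∘ k ∘ conj) (ball 0 r) := fun s hs =>
      (differentiableAt_conj_conj_iff.2 (hkd.differentiableAt
        (isOpen_ball.mem_nhds (conj_mem_ball_zero hs)))).differentiableWithinAt
    have heq : EqOn (conj ∘ k ∘ conj) k (ball 0 r) := by
      refine (hkc.analyticOnNhd isOpen_ball).eqOn_of_preconnected_of_frequently_eq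
        (hkd.analyticOnNhd isOpen_ball) (convex_ball 0 r).isPreconnected (z₀ := ((r / 2 : ℝ) : ℂ))
        (ofReal_mem_ball_zero (by rw [abs_of_pos (half_pos hr0)]; linarith)) ?_
      have h3 : Tendsto (fun x : ℝ => (x : ℂ)) (𝓝[>] (r / 2)) (𝓝[≠] ((r / 2 : ℝ) : ℂ)) := by
        refine tendsto_nhdsWithin_iff.2
          ⟨(Complex.continuous_ofReal.tendsto _).mono_left nhdsWithin_le_nhds, ?_⟩
        filter_upwards [self_mem_nhdsWithin] with x hx
        rw [mem_compl_singleton_iff, Ne, ofReal_inj]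
        exact (ne_of_gt hx)
      refine h3.frequently (Eventually.frequently ?_)
      filter_upwards [Ioo_mem_nhdsGT (by linarith : r / 2 < r)] with x hx
      simp only [Function.comp_apply, conj_ofReal]
      exact conj_eq_iff_im.2 (hkreal x (by linarith [hx.1]) hx.2)
    intro s hs
    have := heq (conj_mem_ball_zero hs)
    simp only [Function.comp_apply, conj_conj] at this
    exact this.symm
  have h0 : (0 : ℂ) ∈ ball (0 : ℂ) r := mem_ball_self hr0
  have hkder : HasDerivAt k (σ * b E) 0 := by
    have e1 : HasDerivAt (fun s : ℂ => (E : ℂ) + s ^ 2) 0 0 := by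
      have := ((hasDerivAt_id (0 : ℂ)).pow 2).const_add (E : ℂ)
      simpa using this
    have e2 : HasDerivAt (fun s : ℂ => A ((E : ℂ) + s ^ 2)) 0 0 := by
      have hA' : HasDerivAt A (deriv A E) ((E : ℂ) + 0 ^ 2) := by
        have := (hA E hEU).differentiableAt.hasDerivAt
        simpa using this
      simpa [Function.comp_def] using hA'.comp (0 : ℂ) e1
    have e3 := (hasDerivAt_id (0 : ℂ)).fun_mul
      (hbs.differentiableAt (isOpen_ball.mem_nhds h0)).hasDerivAt
    have e4 := e2.fun_add (e3.const_mul σ)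
    refine e4.congr_deriv ?_
    simp
  refine ⟨r, hr0, k, hkR, ⟨(σ * b E).re, ?_, ?_⟩, fun s hs h1 h2 => hkm s ⟨hs, h1, h2⟩⟩
  · have hne : σ * b E ≠ 0 := mul_ne_zero hσ0 (by simpa using hbne 0 h0)
    have him : (σ * b E).im = 0 := by
      have := hkR.deriv.im_ofReal (x := 0) (by simpa using hr0)
      rwa [ofReal_zero, hkder.deriv] at this
    have hre : (σ * b E).re ≠ 0 := fun h => hne (Complex.ext h him)
    refine lt_of_le_of_ne ?_ hre.symm
    -- The sign of k'(0): along s = iy the imaginary part of k starts at 0 and is a limit of values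
    -- of Im m ≥ 0, so its slope Re k'(0) is nonnegative. It is nonzero because E is a simple root
    -- of B.
    have hI : HasDerivAt (fun y : ℝ => (k (y * I)).im) (σ * b E).re 0 := by
      have e1 : HasDerivAt (fun y : ℂ => y * I) I ((0 : ℝ) : ℂ) := by
        simpa using (hasDerivAt_id ((0 : ℝ) : ℂ)).mul_const I
      have e2 : HasDerivAt k (σ * b E) (((0 : ℝ) : ℂ) * I) := by simpa using hkder
      have e3 := (e2.comp ((0 : ℝ) : ℂ) e1).comp_ofReal
      have e4 := (Complex.imCLM.hasFDerivAt.comp_hasDerivAt (0 : ℝ) e3)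
      simpa [Function.comp_def] using e4
    have hnn : ∀ y ∈ Ioo 0 r, 0 ≤ (k (y * I)).im := by
      intro y hy
      have h2 : ContinuousAt (fun x : ℝ => (k ((x : ℂ) + y * I)).im) 0 := by
        refine Complex.continuous_im.continuousAt.comp (ContinuousAt.comp (g := k)
          (f := fun x : ℝ => ((x : ℂ) + y * I)) ?_ (by fun_prop))
        refine (hkd.differentiableAt (isOpen_ball.mem_nhds ?_)).continuousAt
        simpa [abs_of_pos hy.1] using hy.2
      have h3 := ge_of_tendsto (b := 0) (h2.tendsto.mono_left (nhdsWithin_le_nhds (s := Ioi 0))) (by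
        filter_upwards [Ioo_mem_nhdsGT (by linarith [hy.2] : 0 < r - y)] with x hx
        have hq := hpt x y hx.1 hy.1 (by linarith [hx.2])
        rw [← hkm _ hq]
        exact stieltjes_im_nonneg (hQim _ hq))
      simpa using h3
    have hslope := (hasDerivAt_iff_tendsto_slope.1 hI).mono_left
      (nhdsWithin_mono 0 (fun y (hy : y ∈ Ioi 0) => ne_of_gt hy))
    refine ge_of_tendsto hslope ?_
    filter_upwards [Ioo_mem_nhdsGT hr0] with y hy
    have hk0 : (k 0).im = 0 := by
      have := hkR.im_ofReal (x := 0) (by simpa using hr0)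
      rwa [ofReal_zero] at this
    rw [slope_def_field]
    simp only [ofReal_zero, zero_mul, hk0, sub_zero]
    exact div_nonneg (hnn y hy) hy.1.le
  · rw [hkder.deriv]
    refine Complex.ext (by simp) ?_
    have := hkR.deriv.im_ofReal (x := 0) (by simpa using hr0)
    rw [ofReal_zero, hkder.deriv] at this
    simpa using this

lemma eq_of_sq_eq_of_re_pos {a b : ℂ} (h : a ^ 2 = b ^ 2) (ha : 0 < a.re) (hb : 0 < b.re) :
    a = b := by
  rcases sq_eq_sq_iff_eq_or_eq_neg.1 h with h | h
  · exact h
  · rw [h, neg_re] at ha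
    linarith

lemma csqrt_conj {w : ℂ} (hw : w ∈ slitPlane) : csqrt (conj w) = conj (csqrt w) := by
  refine eq_of_sq_eq_of_re_pos ?_ (csqrt_re_pos ?_) ?_
  · rw [csqrt_sq, ← map_pow, csqrt_sq]
  · rw [mem_slitPlane_iff] at hw ⊢
    simpa using hw
  · simpa using csqrt_re_pos hw

lemma mem_slitPlane_of_norm_sub_one {w : ℂ} (hw : ‖w - 1‖ ≤ 1 / 2) : w ∈ slitPlane := by
  refine Or.inl ?_
  have := (abs_le.1 ((abs_re_le_norm (w - 1)).trans hw)).1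
  simp only [sub_re, one_re] at this
  linarith

lemma norm_csqrt_sub_one_le {w : ℂ} (hw : ‖w - 1‖ ≤ 1 / 2) : ‖csqrt w - 1‖ ≤ ‖w - 1‖ := by
  have h1 : w - 1 = (csqrt w - 1) * (csqrt w + 1) := by
    conv_lhs => rw [← csqrt_sq w]
    ring
  have h2 : 1 ≤ ‖csqrt w + 1‖ := by
    have := (le_abs_self _).trans (abs_re_le_norm (csqrt w + 1))
    have := csqrt_re_pos (mem_slitPlane_of_norm_sub_one hw)
    simp only [add_re, one_re] at *
    linarith
  rw [h1, norm_mul]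
  exact le_mul_of_one_le_right (norm_nonneg _) h2

/-! ### Normal form of a perturbed fold -/

section Fold

variable {Z : ℂ → ℂ} {r E₀ ε : ℝ}

lemma hasDerivAt_sub_sq (hZ : RealHol Z r) {s : ℂ} (hs : s ∈ ball (0 : ℂ) r) :
    HasDerivAt (fun s => Z s - (E₀ + s ^ 2)) (deriv Z s - 2 * s) s := by
  have h1 := ((hasDerivAt_id s).fun_pow 2).const_add (E₀ : ℂ)
  have := (hZ.differentiableAt hs).hasDerivAt.fun_sub h1
  simpa using this

lemma norm_deriv_sub_le_of_fold (hr : 0 < r) (hZ : RealHol Z r)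
    (hb : ∀ s ∈ ball (0 : ℂ) r, ‖Z s - (E₀ + s ^ 2)‖ ≤ ε) {s : ℂ}
    (hs : s ∈ ball (0 : ℂ) (r / 2)) : ‖deriv Z s - 2 * s‖ ≤ 2 * ε / r := by
  have hsr : s ∈ ball (0 : ℂ) r := ball_subset_ball (by linarith) hs
  have h := norm_deriv_le_of_ball
    (fun s hs => (hasDerivAt_sub_sq (E₀ := E₀) hZ hs).differentiableAt.differentiableWithinAt) hb
    (by linarith : r / 2 < r) hs
  rw [(hasDerivAt_sub_sq hZ hsr).deriv] at h
  refine h.trans (le_of_eq ?_)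
  field_simp
  norm_num

lemma norm_deriv_deriv_sub_le_of_fold (hr : 0 < r) (hZ : RealHol Z r)
    (hb : ∀ s ∈ ball (0 : ℂ) r, ‖Z s - (E₀ + s ^ 2)‖ ≤ ε) {s : ℂ}
    (hs : s ∈ ball (0 : ℂ) (r / 4)) : ‖deriv (deriv Z) s - 2‖ ≤ 8 * ε / r ^ 2 := by
  have hd : ∀ s ∈ ball (0 : ℂ) (r / 2),
      HasDerivAt (fun s => deriv Z s - 2 * s) (deriv (deriv Z) s - 2) s := fun s hs => by
    have := (hZ.deriv.differentiableAt (ball_subset_ball (by linarith) hs)).hasDerivAt.fun_sub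
      ((hasDerivAt_id s).const_mul 2)
    simpa using this
  have h := norm_deriv_le_of_ball (fun s hs => (hd s hs).differentiableAt.differentiableWithinAt)
    (fun s hs => norm_deriv_sub_le_of_fold hr hZ hb hs) (by linarith : r / 4 < r / 2) hs
  rw [(hd s (ball_subset_ball (by linarith) hs)).deriv] at h
  refine h.trans (le_of_eq ?_)
  field_simp
  ring

lemma realHol_half_deriv (hr : 0 < r) (hZ : RealHol Z r) :
    RealHol (fun s => deriv Z s / 2) (r / 2) := by
  have := (hZ.deriv.mono (by linarith : r / 2 ≤ r)).mul (RealHol.ofReal (1 / 2))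
  refine ⟨this.diff.congr fun s _ => by push_cast; ring, fun s hs => ?_⟩
  have := this.symm s hs
  push_cast at this
  simp only [mul_one_div] at this
  exact this

lemma norm_half_deriv_sub_le (hr : 0 < r) (hZ : RealHol Z r) (hε : ε ≤ r ^ 2 / 160)
    (hb : ∀ s ∈ ball (0 : ℂ) r, ‖Z s - (E₀ + s ^ 2)‖ ≤ ε) {s : ℂ}
    (hs : s ∈ ball (0 : ℂ) (r / 2)) : ‖deriv Z s / 2 - s‖ ≤ r / 160 := by
  have h := norm_deriv_sub_le_of_fold hr hZ hb hs
  have h2 : deriv Z s / 2 - s = (deriv Z s - 2 * s) / 2 := by ring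
  rw [h2, norm_div, Complex.norm_ofNat]
  have h3 : 2 * ε / r ≤ 2 * (r / 160) := by
    rw [div_le_iff₀ hr]
    nlinarith
  linarith

/-- Normal form of a small perturbation of the fold `s ↦ E₀ + s ^ 2`. -/
theorem exists_fold (hr : 0 < r) (hZ : RealHol Z r) (hε : ε ≤ r ^ 2 / 160)
    (hb : ∀ s ∈ ball (0 : ℂ) r, ‖Z s - (E₀ + s ^ 2)‖ ≤ ε) :
    ∃ (σ : ℝ) (ψ : ℂ → ℂ), |σ| ≤ r / 32 ∧ deriv Z σ = 0 ∧ RealHol ψ (r / 32) ∧ ψ 0 = σ ∧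
      HasDerivAt ψ (csqrt (deriv (deriv Z) σ / 2))⁻¹ 0 ∧
      ∀ ζ ∈ ball (0 : ℂ) (r / 32), ψ ζ ∈ closedBall (0 : ℂ) (r / 16) ∧ Z (ψ ζ) = Z σ + ζ ^ 2 ∧
        (0 < ζ.im → 0 < (ψ ζ).im) := by
  have hr2 : 0 < r / 2 := half_pos hr
  -- With ε ≤ r²/160, Cauchy's estimate puts Z'/2 within r/160 of the identity on the half disc. Its
  -- inverse at 0 is the critical point, which is real by symmetry.
  obtain ⟨χ, hχ, hχ'⟩ := exists_inverse_of_near_id hr2 (realHol_half_deriv hr hZ)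
    (fun s hs => (norm_half_deriv_sub_le hr hZ hε hb hs).trans (by linarith))
  have hz0 : (0 : ℂ) ∈ ball (0 : ℂ) (r / 2 / 8) := mem_ball_self (by positivity)
  set σ := (χ 0).re with hσdef
  have hσ : χ 0 = (σ : ℂ) := by
    refine Complex.ext (by simp [hσdef]) ?_
    have := hχ.im_ofReal (x := 0) (by simpa using hr)
    simpa using this
  obtain ⟨hσm, hσ0, -⟩ := hχ' 0 hz0
  rw [hσ] at hσm hσ0
  have hσ2 : (σ : ℂ) ∈ ball (0 : ℂ) (r / 2) := closedBall_subset_ball (by linarith) hσm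
  have hZσ : deriv Z σ = 0 := by simpa using hσ0
  have hσr : ‖(σ : ℂ)‖ ≤ r / 160 := by
    have := norm_half_deriv_sub_le hr hZ hε hb hσ2
    rwa [hσ0, zero_sub, norm_neg] at this
  set B := ball (0 : ℂ) (r / 4) with hB
  have hBr : B ⊆ ball 0 r := ball_subset_ball (by linarith)
  have hσB : (σ : ℂ) ∈ B := mem_ball_zero_iff.2 (by linarith)
  have hBn : B ∈ 𝓝 (σ : ℂ) := isOpen_ball.mem_nhds hσB
  -- Since Z'(σ) = 0, the second divided difference gives Z(s) = Z(σ) + (s − σ)² p(s) with p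
  -- holomorphic.
  let p : ℂ → ℂ := dslope (dslope Z σ) σ
  have hp : DifferentiableOn ℂ p B :=
    (differentiableOn_dslope hBn).2 ((differentiableOn_dslope hBn).2 (hZ.diff.mono hBr))
  have hpd : ∀ s ∈ B, DifferentiableAt ℂ p s := fun s hs =>
    hp.differentiableAt (isOpen_ball.mem_nhds hs)
  have hpZ : ∀ s, Z s = Z σ + (s - σ) ^ 2 * p s := fun s => by
    have h1 : (s - σ) * p s = dslope Z σ s - dslope Z σ σ :=
      sub_smul_dslope (dslope Z σ) (σ : ℂ) s
    have h2 : (s - σ) * dslope Z σ s = Z s - Z σ := sub_smul_dslope Z (σ : ℂ) s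
    rw [dslope_same, hZσ, sub_zero] at h1
    rw [sq, mul_assoc, h1, h2]
    ring
  have hpσ : p σ = deriv (deriv Z) σ / 2 := by
    have h1 : deriv Z =ᶠ[𝓝 (σ : ℂ)] fun s => (s - σ) * (2 * p s + (s - σ) * deriv p s) := by
      filter_upwards [hBn] with s hs
      have h2 : HasDerivAt (fun s => Z σ + (s - σ) ^ 2 * p s) _ s :=
        ((((hasDerivAt_id s).sub_const (σ : ℂ)).fun_pow 2).fun_mul
          (hpd s hs).hasDerivAt).const_add (Z σ)
      rw [show Z = fun s => Z σ + (s - σ) ^ 2 * p s from funext hpZ, h2.deriv]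
      simp
      ring
    rw [h1.deriv_eq]
    have h3 : DifferentiableAt ℂ (fun s => 2 * p s + (s - σ) * deriv p s) σ :=
      ((hpd σ hσB).const_mul 2).fun_add ((differentiableAt_id.sub_const (σ : ℂ)).fun_mul
        ((hp.deriv isOpen_ball).differentiableAt hBn))
    have h4 := (((hasDerivAt_id (σ : ℂ)).sub_const (σ : ℂ)).fun_mul h3.hasDerivAt).deriv
    simp only [id] at h4
    rw [h4]
    simp
  set K := 8 * ε / r ^ 2 with hK
  have hK1 : K ≤ 1 / 20 := by
    rw [hK, div_le_iff₀ (by positivity)]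
    linarith
  have hpn : ∀ s ∈ B, ‖p s - 1‖ ≤ K := by
    intro s hs
    by_cases hsσ : s = σ
    · rw [hsσ, hpσ]
      have h1 := norm_deriv_deriv_sub_le_of_fold hr hZ hb hσB
      rw [show deriv (deriv Z) (σ : ℂ) / 2 - 1 = (deriv (deriv Z) (σ : ℂ) - 2) / 2 by ring, norm_div,
        Complex.norm_ofNat]
      have := norm_nonneg (deriv (deriv Z) (σ : ℂ) - 2)
      linarith
    -- Restricting to the disc of radius |s − σ| about σ bounds the derivative of Z − E₀ − w² + 2σw
    -- by K|s − σ|, since this derivative vanishes at σ. Its increment from σ to s is (p(s) − 1)(s −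
    -- σ)².
    · set S := B ∩ closedBall (σ : ℂ) ‖s - σ‖ with hS
      have hSc : Convex ℝ S := (convex_ball _ _).inter (convex_closedBall _ _)
      have hderiv : ∀ w ∈ S, HasDerivWithinAt (fun w => Z w - (E₀ + w ^ 2) - (-2 * σ) * w)
          ((deriv Z w - 2 * w) - (-2 * σ)) S w := fun w hw => by
        have := ((hasDerivAt_sub_sq (E₀ := E₀) hZ (hBr hw.1)).fun_sub
          ((hasDerivAt_id w).const_mul (-2 * σ : ℂ))).hasDerivWithinAt (s := S)
        simpa using this
      have hdn : ∀ w ∈ S, ‖(deriv Z w - 2 * w) - (-2 * σ)‖ ≤ K * ‖s - σ‖ := fun w hw => by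
        have hd : ∀ w ∈ B,
            HasDerivWithinAt (fun s => deriv Z s - 2 * s) (deriv (deriv Z) w - 2) B w :=
          fun w hw => by
            have := ((hZ.deriv.differentiableAt (hBr hw)).hasDerivAt.fun_sub
              ((hasDerivAt_id w).const_mul 2)).hasDerivWithinAt (s := B)
            simpa using this
        have h1 := (convex_ball (0 : ℂ) (r / 4)).norm_image_sub_le_of_norm_hasDerivWithin_le hd
          (fun w hw => norm_deriv_deriv_sub_le_of_fold hr hZ hb hw) hσB hw.1
        rw [hZσ] at h1
        have h2 : ‖w - σ‖ ≤ ‖s - σ‖ := by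
          have := hw.2
          rwa [mem_closedBall, dist_eq_norm] at this
        have hK0 : 0 ≤ K :=
          (norm_nonneg _).trans (norm_deriv_deriv_sub_le_of_fold hr hZ hb hσB)
        calc _ = ‖deriv Z w - 2 * w - (0 - 2 * σ)‖ := by congr 1; ring
          _ ≤ K * ‖w - σ‖ := h1
          _ ≤ K * ‖s - σ‖ := by gcongr
      have h1 := hSc.norm_image_sub_le_of_norm_hasDerivWithin_le hderiv hdn
        (⟨hσB, mem_closedBall_self (norm_nonneg _)⟩ : (σ : ℂ) ∈ S)
        (⟨hs, by rw [mem_closedBall, dist_eq_norm]⟩ : s ∈ S)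
      have h2 : Z s - (E₀ + s ^ 2) - (-2 * σ) * s - (Z σ - (E₀ + (σ : ℂ) ^ 2) - (-2 * σ) * σ)
          = (p s - 1) * (s - σ) ^ 2 := by
        rw [hpZ s]; ring
      rw [h2, norm_mul, norm_pow, mul_assoc, ← sq] at h1
      have h3 : 0 < ‖s - σ‖ ^ 2 := by
        have : 0 < ‖s - σ‖ := norm_pos_iff.2 (sub_ne_zero.2 hsσ)
        positivity
      exact le_of_mul_le_mul_right h1 h3
  have hpn2 : ∀ s ∈ B, ‖p s - 1‖ ≤ 1 / 2 := fun s hs => (hpn s hs).trans (by linarith)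
  have hpsymm : ∀ s ∈ B, p (conj s) = conj (p s) := by
    intro s hs
    by_cases hsσ : s = σ
    · have h1 := (hZ.deriv.deriv).symm σ (hBr hσB)
      rw [conj_ofReal] at h1
      rw [hsσ, conj_ofReal, hpσ, map_div₀, ← h1, map_ofNat]
    · have h1 := hZ.symm s (hBr hs)
      have h2 := hZ.symm σ (hBr hσB)
      rw [conj_ofReal] at h2
      rw [hpZ (conj s), hpZ s, map_add, ← h2, map_mul, map_pow, map_sub, conj_ofReal] at h1
      have hne : (conj s - (σ : ℂ)) ^ 2 ≠ 0 := by
        refine pow_ne_zero 2 fun h => hsσ ?_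
        have := congrArg conj (sub_eq_zero.1 h)
        simpa using this
      exact mul_left_cancel₀ hne (add_left_cancel h1)
  -- The Morse coordinate: φ² = Z − Z(σ). As p is within 1/20 of 1, φ is close enough to the
  -- identity to be inverted.
  let φ : ℂ → ℂ := fun s => (s - σ) * csqrt (p s)
  have hqd : ∀ s ∈ B, DifferentiableAt ℂ (fun s => csqrt (p s)) s := fun s hs =>
    DifferentiableAt.comp (g := csqrt) s
      (differentiableAt_csqrt (mem_slitPlane_of_norm_sub_one (hpn2 s hs))) (hpd s hs)
  have hφ : RealHol φ (r / 4) := by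
    refine ⟨fun s hs => ((differentiableAt_id.sub_const (σ : ℂ)).fun_mul
      (hqd s hs)).differentiableWithinAt, fun s hs => ?_⟩
    simp only [φ]
    rw [hpsymm s hs, csqrt_conj (mem_slitPlane_of_norm_sub_one (hpn2 s hs))]
    simp
  have hφid : ∀ s ∈ ball (0 : ℂ) (r / 4), ‖φ s - s‖ ≤ r / 4 / 8 := by
    intro s hs
    have h1 : φ s - s = (s - σ) * (csqrt (p s) - 1) - σ := by simp only [φ]; ring
    have h2 : ‖csqrt (p s) - 1‖ ≤ 1 / 20 :=
      ((norm_csqrt_sub_one_le (hpn2 s hs)).trans (hpn s hs)).trans hK1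
    have h3 : ‖s - σ‖ ≤ r / 4 + r / 160 :=
      (norm_sub_le _ _).trans (add_le_add (mem_ball_zero_iff.1 hs).le hσr)
    rw [h1]
    calc _ ≤ ‖s - σ‖ * ‖csqrt (p s) - 1‖ + ‖(σ : ℂ)‖ := by
          rw [← norm_mul]; exact norm_sub_le _ _
      _ ≤ (r / 4 + r / 160) * (1 / 20) + r / 160 := by gcongr
      _ ≤ r / 4 / 8 := by linarith
  obtain ⟨ψ, hψ, hψ'⟩ := exists_inverse_of_near_id (by positivity) hφ hφid
  have h32 : r / 4 / 8 = r / 32 := by ring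
  have h16 : r / 4 / 4 = r / 16 := by ring
  rw [h32] at hψ hψ'
  rw [h16] at hψ'
  have hz0' : (0 : ℂ) ∈ ball (0 : ℂ) (r / 32) := mem_ball_self (by positivity)
  have hψ0 : ψ 0 = σ := by
    have h1 := norm_sub_le_of_near_id hφ.diff hφid (s := σ) (w := ψ 0)
      (mem_ball_zero_iff.2 (by linarith)) (closedBall_subset_ball (by linarith) (hψ' 0 hz0').1)
    have h2 : φ σ = 0 := by simp [φ]
    rw [(hψ' 0 hz0').2.1, h2, sub_zero, norm_zero, mul_zero] at h1
    exact sub_eq_zero.1 (norm_le_zero_iff.1 h1)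
  refine ⟨σ, ψ, ?_, hZσ, hψ, hψ0, ?_, fun ζ hζ => ⟨(hψ' ζ hζ).1, ?_, (hψ' ζ hζ).2.2.1⟩⟩
  · rw [norm_real, Real.norm_eq_abs] at hσr
    linarith
  · have h1 := (hψ' 0 hz0').2.2.2
    have h2 := (((hasDerivAt_id (σ : ℂ)).sub_const (σ : ℂ)).fun_mul (hqd σ hσB).hasDerivAt).deriv
    simp only [id, sub_self, one_mul, zero_mul, add_zero] at h2
    rw [hψ0, h2, hpσ] at h1
    exact h1
  · have h1 : φ (ψ ζ) ^ 2 = ζ ^ 2 := by rw [(hψ' ζ hζ).2.1]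
    rw [hpZ (ψ ζ), ← h1]
    simp only [φ]
    rw [mul_pow, csqrt_sq]

end Fold

/-! ### What an edge chart implies for the measure -/

/-- Near the edge `E` the function `m + V' / 2` is a real holomorphic function `G` of the local
coordinate `√(z - E)`, with `G' 0 = c`. -/
structure IsEdgeChart (V : ℂ → ℂ) (μ : ProbabilityMeasure ℝ) (E q N c : ℝ) (G : ℂ → ℂ) : Prop where
  pos : 0 < q
  hol : RealHol G q
  bound : ∀ ζ ∈ ball (0 : ℂ) q, ‖G ζ‖ ≤ N
  deriv_eq : deriv G 0 = c
  eq : ∀ z : ℂ, 0 < z.im → z ∈ ball (E : ℂ) (q ^ 2) →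
    stieltjes μ z + deriv V z / 2 = G (csqrt (z - E))

/-- The density near the edge. -/
noncomputable def edgeDensity (G : ℂ → ℂ) (E q x : ℝ) : ℝ :=
  (G ((Real.sqrt (min (max (E - x) 0) (q ^ 2 / 2)) : ℂ) * I)).im / Real.pi

namespace IsEdgeChart

variable {V : ℂ → ℂ} {μ : ProbabilityMeasure ℝ} {E q N c : ℝ} {G : ℂ → ℂ}

lemma zero_mem (h : IsEdgeChart V μ E q N c G) : (0 : ℂ) ∈ ball (0 : ℂ) q := mem_ball_self h.pos

lemma im_zero (h : IsEdgeChart V μ E q N c G) : (G 0).im = 0 := by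
  simpa using h.hol.im_ofReal (x := 0) (by simpa using h.pos)

/-- The even and odd parts of the chart give the decomposition `A + √B`. -/
theorem hasSqrtEdge (h : IsEdgeChart V μ E q N c G) (hV : IsPotential V) (hc : c ≠ 0)
    (hμ : (μ : Measure ℝ) (Ioi E) = 0) : HasSqrtEdge μ E := by
  have hneg : ∀ {ζ}, ζ ∈ ball (0 : ℂ) q → -ζ ∈ ball (0 : ℂ) q := fun h => by simpa using h
  have hGn : DifferentiableOn ℂ (fun ζ => G (-ζ)) (ball 0 q) :=
    h.hol.diff.comp differentiable_neg.differentiableOn fun ζ hζ => hneg hζ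
  let o : ℂ → ℂ := fun ζ => (G ζ - G (-ζ)) / 2
  have ho : DifferentiableOn ℂ o (ball 0 q) := (h.hol.diff.fun_sub hGn).div_const 2
  have hnhds : ball (0 : ℂ) q ∈ 𝓝 (0 : ℂ) := ball_mem_nhds 0 h.pos
  have ho0 : o 0 = 0 := by simp [o]
  have hod : ∀ ζ, ζ * dslope o 0 ζ = o ζ := fun ζ => by
    have := sub_smul_dslope o 0 ζ
    rwa [sub_zero, smul_eq_mul, ho0, sub_zero] at this
  have hoder : deriv o 0 = c := by
    have h1 : HasDerivAt G (c : ℂ) 0 := by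
      rw [← h.deriv_eq]; exact (h.hol.differentiableAt h.zero_mem).hasDerivAt
    have h2 : HasDerivAt (fun ζ => G (-ζ)) (-(c : ℂ)) 0 := by
      have h3 : HasDerivAt G (c : ℂ) (-0) := by simpa using h1
      simpa [Function.comp_def] using h3.comp (0 : ℂ) (hasDerivAt_neg (0 : ℂ))
    rw [((h1.fun_sub h2).div_const 2).deriv]
    ring
  obtain ⟨a, ha, hae⟩ := exists_eq_comp_sq h.pos ((h.hol.diff.fun_add hGn).div_const 2)
    (fun ζ _ => by simp only [neg_neg]; ring)
  obtain ⟨b, hb, hbe⟩ := exists_eq_comp_sq h.pos ((differentiableOn_dslope hnhds).2 ho)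
    (fun ζ _ => by
      rcases eq_or_ne ζ 0 with rfl | h0
      · simp
      · refine mul_left_cancel₀ h0 ?_
        have h1 := hod (-ζ)
        rw [hod ζ]
        have h2 : o (-ζ) = -o ζ := by simp only [o, neg_neg]; ring
        rw [h2] at h1
        linear_combination -h1)
  have hmaps : MapsTo (fun z : ℂ => z - E) (ball (E : ℂ) (q ^ 2)) (ball 0 (q ^ 2)) := fun z hz => by
    rw [mem_ball_zero_iff]; rwa [mem_ball, dist_eq_norm] at hz
  have hsub : Differentiable ℂ fun z : ℂ => z - E := by fun_prop
  have haE := ha.comp hsub.differentiableOn hmaps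
  have hbE := hb.comp hsub.differentiableOn hmaps
  have hEU : (E : ℂ) ∈ ball (E : ℂ) (q ^ 2) := mem_ball_self (by have := h.pos; positivity)
  have hb0 : b 0 = c := by
    have := hbe 0 h.zero_mem
    rwa [zero_pow two_ne_zero, dslope_same, hoder] at this
  -- Splitting into even and odd parts, G(ζ) = a(ζ²) + ζ b(ζ²). Hence B = (z − E) b(z − E)², and
  -- B'(E) = b(0)² = c² is nonzero.
  refine ⟨hμ, ball (E : ℂ) (q ^ 2), fun z => a (z - E) - deriv V z / 2,
    fun z => (z - E) * b (z - E) ^ 2, fun z => csqrt (z - E) * b (z - E), isOpen_ball, hEU,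
    ?_, ?_, by simp, ?_, ?_, fun z hz him => ⟨?_, ?_⟩⟩
  · exact (haE.fun_sub
      (hV.differentiable_deriv.differentiableOn.div_const 2)).analyticOnNhd isOpen_ball
  · exact (hsub.differentiableOn.fun_mul (hbE.fun_pow 2)).analyticOnNhd isOpen_ball
  · have h1 := (hsub (E : ℂ)).hasDerivAt.fun_mul
      ((hbE.fun_pow 2).differentiableAt (isOpen_ball.mem_nhds hEU)).hasDerivAt
    have h2 : deriv (fun z : ℂ => z - E) (E : ℂ) = 1 := by simp
    have h3 := h1.deriv
    simp only [Function.comp_apply, sub_self, h2, hb0, one_mul, zero_mul, add_zero] at h3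
    rw [h3]
    exact pow_ne_zero 2 (by exact_mod_cast hc)
  · have hopen : IsOpen (ball (E : ℂ) (q ^ 2) ∩ {z : ℂ | 0 < z.im}) :=
      isOpen_ball.inter (isOpen_lt continuous_const Complex.continuous_im)
    refine DifferentiableOn.analyticOnNhd (DifferentiableOn.fun_mul (fun z hz => ?_)
      (hbE.mono inter_subset_left)) hopen
    refine (DifferentiableAt.comp (g := csqrt) z (differentiableAt_csqrt (Or.inr ?_))
      (hsub z)).differentiableWithinAt
    have := hz.2
    simp only [mem_ofPred_eq] at this
    simpa using this.ne'
  · simp only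
    rw [mul_pow, csqrt_sq]
  · have hζ := csqrt_mem_ball h.pos.le (hmaps hz)
    have h1 := h.eq z him hz
    have h2 := hae _ hζ
    have h3 := hbe _ hζ
    have h4 := hod (csqrt (z - E))
    rw [csqrt_sq] at h2 h3
    rw [← h3] at h4
    simp only [o] at h4
    simp only
    rw [h2, h4, eq_sub_of_add_eq h1]
    ring

lemma tendsto_G (h : IsEdgeChart V μ E q N c G) {x : ℝ} (hx : |x - E| < q ^ 2) :
    Tendsto (fun y : ℝ => G (csqrt ((x + y * I : ℂ) - E))) (𝓝[>] 0)
      (𝓝 (G ((Real.sqrt (max (x - E) 0) : ℂ) + (Real.sqrt (max (E - x) 0) : ℂ) * I))) := by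
  have h1 := tendsto_csqrt_above (x - E)
  rw [neg_sub] at h1
  have h2 : ((Real.sqrt (max (x - E) 0) : ℂ) + (Real.sqrt (max (E - x) 0) : ℂ) * I)
      ∈ ball (0 : ℂ) q := by
    have h3 : (Real.sqrt |x - E|) < q := by
      rw [← Real.sqrt_sq h.pos.le]
      exact Real.sqrt_lt_sqrt (abs_nonneg _) hx
    rw [mem_ball_zero_iff]
    rcases le_total x E with hxE | hxE
    · rw [max_eq_right (by linarith), max_eq_left (by linarith), Real.sqrt_zero]
      rw [abs_of_nonpos (by linarith), neg_sub] at h3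
      simpa [abs_of_nonneg (Real.sqrt_nonneg _)] using h3
    · rw [max_eq_left (by linarith), max_eq_right (by linarith), Real.sqrt_zero]
      rw [abs_of_nonneg (by linarith)] at h3
      simpa [abs_of_nonneg (Real.sqrt_nonneg _)] using h3
  refine ((h.hol.differentiableAt h2).continuousAt.tendsto.comp h1).congr fun y => ?_
  simp only [Function.comp_apply]
  congr 2
  push_cast
  ring

lemma mem_ball_of_lt {x y : ℝ} (hxy : |x - E| + |y| < q ^ 2) :
    (x + y * I : ℂ) ∈ ball (E : ℂ) (q ^ 2) := by
  rw [mem_ball, dist_eq_norm]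
  refine lt_of_le_of_lt (norm_le_abs_re_add_abs_im _) ?_
  simpa using hxy

lemma tendsto_deriv (hV : IsPotential V) (x : ℝ) :
    Tendsto (fun y : ℝ => deriv V (x + y * I) / 2) (𝓝[>] 0) (𝓝 (deriv V x / 2)) := by
  have hc : Continuous fun y : ℝ => deriv V (x + y * I) / 2 :=
    (hV.differentiable_deriv.continuous.comp (by fun_prop)).div_const 2
  have := (hc.tendsto 0).mono_left (nhdsWithin_le_nhds (s := Ioi 0))
  simpa using this

lemma tendsto_stieltjes (h : IsEdgeChart V μ E q N c G) (hV : IsPotential V) {x : ℝ}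
    (hx : |x - E| < q ^ 2) :
    Tendsto (fun y : ℝ => stieltjes μ (x + y * I)) (𝓝[>] 0)
      (𝓝 (G ((Real.sqrt (max (x - E) 0) : ℂ) + (Real.sqrt (max (E - x) 0) : ℂ) * I)
        - deriv V x / 2)) := by
  refine ((h.tendsto_G hx).sub (tendsto_deriv hV x)).congr' ?_
  filter_upwards [Ioo_mem_nhdsGT (by linarith : 0 < q ^ 2 - |x - E|)] with y hy
  have := h.eq (x + y * I) (by simpa using hy.1)
    (mem_ball_of_lt (by rw [abs_of_pos hy.1]; linarith [hy.2]))
  exact (eq_sub_of_add_eq this).symm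

lemma im_G_eq (h : IsEdgeChart V μ E q N c G) {x : ℝ} (hx : |x - E| ≤ q ^ 2 / 2) :
    (G ((Real.sqrt (max (x - E) 0) : ℂ) + (Real.sqrt (max (E - x) 0) : ℂ) * I)).im
      = edgeDensity G E q x * Real.pi := by
  rw [edgeDensity, div_mul_cancel₀ _ Real.pi_ne_zero]
  have hm : max (E - x) 0 ≤ q ^ 2 / 2 :=
    max_le (by linarith [neg_abs_le (x - E)]) (by positivity)
  rw [min_eq_left hm]
  rcases le_total x E with hxE | hxE
  · rw [max_eq_right (a := x - E) (by linarith)]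
    simp
  · rw [max_eq_right (a := E - x) (by linarith), max_eq_left (a := x - E) (by linarith)]
    simp only [Real.sqrt_zero, ofReal_zero, zero_mul, add_zero, h.im_zero]
    refine h.hol.im_ofReal (ofReal_mem_ball_zero ?_)
    rw [abs_of_nonneg (Real.sqrt_nonneg _), ← Real.sqrt_sq h.pos.le]
    refine Real.sqrt_lt_sqrt (by linarith) ?_
    have := h.pos
    nlinarith [le_abs_self (x - E), pow_pos this 2]

lemma tendsto_stieltjes_im (h : IsEdgeChart V μ E q N c G) (hV : IsPotential V) {x : ℝ}
    (hx : |x - E| ≤ q ^ 2 / 2) :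
    Tendsto (fun y : ℝ => (stieltjes μ (x + y * I)).im) (𝓝[>] 0)
      (𝓝 (edgeDensity G E q x * Real.pi)) := by
  have hq := pow_pos h.pos 2
  have h1 := (Complex.continuous_im.tendsto _).comp (h.tendsto_stieltjes hV (x := x) (by linarith))
  have h2 : (deriv V x / 2).im = 0 := by simp [hV.deriv_im_ofReal x]
  rw [sub_im, h2, sub_zero, h.im_G_eq hx] at h1
  exact h1

/-- The truncation at q²/2 keeps the argument of G inside its disc, so the formula makes sense and
is continuous on the whole line. -/
lemma continuous_edgeDensity (h : IsEdgeChart V μ E q N c G) : Continuous (edgeDensity G E q) := by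
  refine (Complex.continuous_im.comp ?_).div_const _
  refine h.hol.diff.continuousOn.comp_continuous (by fun_prop) fun x => ?_
  rw [mem_ball_zero_iff, norm_mul, norm_I, mul_one, norm_real, Real.norm_eq_abs,
    abs_of_nonneg (Real.sqrt_nonneg _)]
  have := pow_pos h.pos 2
  have hlt : min (max (E - x) 0) (q ^ 2 / 2) < q ^ 2 := (min_le_right _ _).trans_lt (by linarith)
  exact (Real.sqrt_lt_sqrt (by positivity) hlt).trans_eq (Real.sqrt_sq h.pos.le)

/-- Each value is attained at some E − m with 0 ≤ m ≤ q²/2, where it is a boundary value of Im m ≥ 0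
up to the factor π. -/
lemma edgeDensity_nonneg (h : IsEdgeChart V μ E q N c G) (hV : IsPotential V) (x : ℝ) :
    0 ≤ edgeDensity G E q x := by
  have hq := pow_pos h.pos 2
  set m := min (max (E - x) 0) (q ^ 2 / 2) with hm
  have hm0 : 0 ≤ m := by positivity
  have hmq : m ≤ q ^ 2 / 2 := min_le_right _ _
  have he : edgeDensity G E q x = edgeDensity G E q (E - m) := by
    simp only [edgeDensity, sub_sub_cancel, max_eq_left hm0, min_eq_left hmq, ← hm]
  have h1 := h.tendsto_stieltjes_im hV (x := E - m) (by
    rw [sub_sub_cancel_left, abs_neg, abs_of_nonneg hm0]; exact hmq)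
  rw [← he] at h1
  have h2 := ge_of_tendsto h1 (b := 0) (by
    filter_upwards [self_mem_nhdsWithin] with y hy
    exact stieltjes_im_nonneg (by simpa using hy))
  exact nonneg_of_mul_nonneg_left h2 Real.pi_pos

/-- Stieltjes inversion applies because G is bounded and has boundary values on the axis. The
interval contains E itself, so an atom at the edge is excluded as well. -/
theorem restrict_eq (h : IsEdgeChart V μ E q N c G) (hV : IsPotential V) :
    (μ : Measure ℝ).restrict (Ioo (E - q ^ 2 / 2) (E + q ^ 2 / 2)) =
      (volume.restrict (Ioo (E - q ^ 2 / 2) (E + q ^ 2 / 2))).withDensity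
        (fun x => ENNReal.ofReal (edgeDensity G E q x)) := by
  have hq := pow_pos h.pos 2
  obtain ⟨D, hD⟩ := (isCompact_closedBall (E : ℂ) (q ^ 2)).exists_bound_of_continuousOn
    hV.differentiable_deriv.continuous.continuousOn
  have habs : ∀ x ∈ Ioo (E - q ^ 2 / 2) (E + q ^ 2 / 2), |x - E| < q ^ 2 / 2 := fun x hx =>
    abs_lt.2 ⟨by linarith [hx.1], by linarith [hx.2]⟩
  refine restrict_eq_withDensity (y₀ := q ^ 2 / 2) (M := N + D / 2) (by positivity)
    h.continuous_edgeDensity.measurable (h.edgeDensity_nonneg hV)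
    (fun x hx => h.tendsto_stieltjes_im hV (habs x hx).le) (fun x hx y hy => ?_)
  have hb : (x + y * I : ℂ) ∈ ball (E : ℂ) (q ^ 2) :=
    mem_ball_of_lt (by rw [abs_of_pos hy.1]; linarith [hy.2, habs x hx])
  have h1 := h.eq (x + y * I) (by simpa using hy.1) hb
  rw [eq_sub_of_add_eq h1]
  refine (abs_im_le_norm _).trans ((norm_sub_le _ _).trans (add_le_add (h.bound _ ?_) ?_))
  · refine csqrt_mem_ball h.pos.le (mem_ball_zero_iff.2 ?_)
    rwa [mem_ball, dist_eq_norm] at hb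
  · rw [norm_div, Complex.norm_ofNat]
    have := hD _ (ball_subset_closedBall hb)
    linarith

/-- To the right of E the coordinate √(x − E) is real and G is real there, so the density vanishes.
-/
lemma measure_Ioo_eq_zero (h : IsEdgeChart V μ E q N c G) (hV : IsPotential V) :
    (μ : Measure ℝ) (Ioo E (E + q ^ 2 / 2)) = 0 := by
  have hq := pow_pos h.pos 2
  have h1 := congrArg (fun ν : Measure ℝ => ν (Ioo E (E + q ^ 2 / 2))) (h.restrict_eq hV)
  rw [Measure.restrict_apply measurableSet_Ioo, withDensity_apply _ measurableSet_Ioo,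
    inter_eq_left.2 (Ioo_subset_Ioo_left (by linarith))] at h1
  rw [h1]
  refine lintegral_eq_zero_of_ae_eq_zero ?_
  filter_upwards [ae_restrict_mem measurableSet_Ioo] with x hx
  have : max (E - x) 0 = 0 := max_eq_right (by linarith [hx.1])
  have h2 : min (0 : ℝ) (q ^ 2 / 2) = 0 := min_eq_left (by positivity)
  simp [edgeDensity, this, h2, h.im_zero]

/-- The density vanishes like a square root at the edge. -/
lemma abs_edgeDensity_sub_le (h : IsEdgeChart V μ E q N c G) {x : ℝ} (hx : |x - E| < q ^ 2 / 16) :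
    |edgeDensity G E q x - c / Real.pi * Real.sqrt (max (E - x) 0)|
      ≤ 8 * N / q ^ 2 / Real.pi * Real.sqrt (max (E - x) 0) ^ 2 := by
  have hq := pow_pos h.pos 2
  have hq0 := h.pos
  have hm : max (E - x) 0 ≤ q ^ 2 / 16 :=
    max_le (by linarith [neg_abs_le (x - E)]) (by positivity)
  set y := Real.sqrt (max (E - x) 0) with hy
  have hy0 : 0 ≤ y := Real.sqrt_nonneg _
  have hyq : y < q / 4 := by
    have : q / 4 = Real.sqrt (q ^ 2 / 16) := by
      rw [show q ^ 2 / 16 = (q / 4) ^ 2 by ring, Real.sqrt_sq (by positivity)]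
    rw [this]
    refine Real.sqrt_lt_sqrt (by positivity) (max_lt (by linarith [neg_abs_le (x - E)]) (by positivity))
  have h1 : ∀ ζ ∈ ball (0 : ℂ) (q / 2), ‖deriv G ζ‖ ≤ 2 * N / q := fun ζ hζ => by
    refine (norm_deriv_le_of_ball h.hol.diff h.bound (by linarith : q / 2 < q) hζ).trans
      (le_of_eq ?_)
    field_simp; norm_num
  have h2 : ∀ ζ ∈ ball (0 : ℂ) (q / 4), ‖deriv (deriv G) ζ‖ ≤ 8 * N / q ^ 2 := fun ζ hζ => by
    refine (norm_deriv_le_of_ball (h.hol.deriv.mono (by linarith : q / 2 ≤ q)).diff h1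
      (by linarith : q / 4 < q / 2) hζ).trans (le_of_eq ?_)
    field_simp; ring
  set ζ : ℂ := (y : ℂ) * I with hζdef
  have hζn : ‖ζ‖ = y := by
    rw [hζdef, norm_mul, norm_I, mul_one, norm_real, Real.norm_eq_abs, abs_of_nonneg hy0]
  have hζ : ζ ∈ ball (0 : ℂ) (q / 4) := mem_ball_zero_iff.2 (by rwa [hζn])
  have h04 : (0 : ℂ) ∈ ball (0 : ℂ) (q / 4) := mem_ball_self (by positivity)
  have hsub : ball (0 : ℂ) (q / 4) ⊆ ball 0 q := ball_subset_ball (by linarith)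
  set S := ball (0 : ℂ) (q / 4) ∩ closedBall 0 y with hS
  have hSc : Convex ℝ S := (convex_ball _ _).inter (convex_closedBall _ _)
  have hd : ∀ w ∈ S, HasDerivWithinAt (fun w => G w - c * w) (deriv G w - c) S w := fun w hw => by
    have := ((h.hol.differentiableAt (hsub hw.1)).hasDerivAt.fun_sub
      ((hasDerivAt_id w).const_mul (c : ℂ))).hasDerivWithinAt (s := S)
    simpa using this
  have hN0 : 0 ≤ 8 * N / q ^ 2 := (norm_nonneg _).trans (h2 0 h04)
  have hb : ∀ w ∈ S, ‖deriv G w - c‖ ≤ 8 * N / q ^ 2 * y := fun w hw => by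
    have h3 := norm_image_sub_le_of_ball (h.hol.deriv.diff.mono hsub) h2 h04 hw.1
    rw [h.deriv_eq, sub_zero] at h3
    exact h3.trans (mul_le_mul_of_nonneg_left (mem_closedBall_zero_iff.1 hw.2) hN0)
  have h4 := hSc.norm_image_sub_le_of_norm_hasDerivWithin_le hd hb
    (⟨h04, mem_closedBall_self hy0⟩ : (0 : ℂ) ∈ S)
    (⟨hζ, mem_closedBall_zero_iff.2 hζn.le⟩ : ζ ∈ S)
  rw [mul_zero, sub_zero, sub_zero, hζn] at h4
  have h5 : (G ζ - c * ζ - G 0).im = (G ζ).im - c * y := by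
    simp [hζdef, h.im_zero]
  have h6 := (abs_im_le_norm _).trans h4
  rw [h5] at h6
  have h7 : edgeDensity G E q x = (G ζ).im / Real.pi := by
    rw [edgeDensity, min_eq_left (by linarith)]
  rw [h7, show (G ζ).im / Real.pi - c / Real.pi * y = ((G ζ).im - c * y) / Real.pi by ring, abs_div,
    abs_of_pos Real.pi_pos, div_le_iff₀ Real.pi_pos]
  refine h6.trans (le_of_eq ?_)
  field_simp

/-- The Stieltjes transform converges absolutely at the edge. -/
theorem integrable_and_eq (h : IsEdgeChart V μ E q N c G) (hV : IsPotential V)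
    (hμ : (μ : Measure ℝ) (Ioi E) = 0) :
    Integrable (fun x : ℝ => 1 / ((x : ℂ) - (E : ℂ))) (μ : Measure ℝ) ∧
      stieltjes μ E + deriv V E / 2 = G 0 := by
  have hq := pow_pos h.pos 2
  have hae : ∀ᵐ x ∂(μ : Measure ℝ), x ≤ E := by
    filter_upwards [measure_eq_zero_iff_ae_notMem.1 hμ] with x hx
    exact not_lt.1 hx
  let y : ℕ → ℝ := fun n => 1 / ((n : ℝ) + 1)
  have hy0 : ∀ n, 0 < y n := fun n => by positivity
  have hy : Tendsto y atTop (𝓝[>] 0) :=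
    tendsto_nhdsWithin_iff.2 ⟨tendsto_one_div_add_atTop_nhds_zero_nat, Eventually.of_forall hy0⟩
  -- These are −Re 1/(x − E − iy_n), nonnegative on the support. Their integrals converge because
  -- m(E + iy) has a limit, so Fatou gives integrability of 1/(E − x). Dominated convergence then
  -- identifies the integral.
  let g : ℕ → ℝ → ℝ := fun n x => (E - x) / ((x - E) ^ 2 + y n ^ 2)
  have hgm : ∀ n, Measurable (g n) := fun n => by fun_prop
  have hg0 : ∀ n, ∀ᵐ x ∂(μ : Measure ℝ), 0 ≤ g n x := fun n => hae.mono fun x hx => by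
    have := sub_nonneg.2 hx
    positivity
  have hgint : ∀ n, ∫ x, g n x ∂(μ : Measure ℝ) = -(stieltjes μ (E + y n * I)).re := fun n => by
    rw [stieltjes_re (by simpa using hy0 n), ← integral_neg]
    refine integral_congr_ae (Eventually.of_forall fun x => ?_)
    simp only [g, add_re, ofReal_re, mul_re, I_re, mul_zero, ofReal_im, I_im, mul_one, sub_self,
      add_zero, add_im, mul_im, zero_add]
    rw [← neg_div, neg_sub]
  have hgi : ∀ n, Integrable (g n) (μ : Measure ℝ) := fun n => by
    refine Integrable.of_bound (hgm n).aestronglyMeasurable (1 / y n) (Eventually.of_forall fun x => ?_)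
    have h1 := norm_one_div_sub_le (x := x) (z := (E + y n * I : ℂ)) (hy0 n) (by
      have := im_le_norm_ofReal_sub x (E + y n * I)
      simpa [abs_of_pos (hy0 n)] using this)
    have h2 := (abs_re_le_norm _).trans h1
    rw [one_div_sub_re] at h2
    simp only [add_re, ofReal_re, mul_re, I_re, mul_zero, ofReal_im, I_im, mul_one, sub_self,
      add_zero, add_im, mul_im, zero_add] at h2
    rw [Real.norm_eq_abs]
    have h3 : g n x = -((x - E) / ((x - E) ^ 2 + y n ^ 2)) := by
      simp only [g]; rw [← neg_div, neg_sub]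
    rwa [h3, abs_neg]
  have hglim : ∀ x, Tendsto (fun n => g n x) atTop (𝓝 (E - x)⁻¹) := fun x => by
    -- At x = E both sides are 0 by the convention 0⁻¹ = 0.
    rcases eq_or_ne x E with rfl | hne
    · simp [g]
    · have h1 : Tendsto (fun n => (E - x) / ((x - E) ^ 2 + y n ^ 2)) atTop
          (𝓝 ((E - x) / ((x - E) ^ 2 + 0 ^ 2))) := by
        refine tendsto_const_nhds.div (tendsto_const_nhds.add
          ((hy.mono_right nhdsWithin_le_nhds).pow 2)) ?_
        have := sub_ne_zero.2 hne
        positivity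
      have h2 : (E - x) / ((x - E) ^ 2 + 0 ^ 2) = (E - x)⁻¹ := by
        have h3 := sub_ne_zero.2 hne.symm
        rw [show (x - E) ^ 2 + 0 ^ 2 = (E - x) * (E - x) by ring, div_mul_cancel_left₀ h3]
      rwa [h2] at h1
  have hlim : Tendsto (fun n => stieltjes μ (E + y n * I)) atTop (𝓝 (G 0 - deriv V E / 2)) := by
    have := (h.tendsto_stieltjes hV (x := E) (by simpa using hq)).comp hy
    simpa [Function.comp_def] using this
  have hlimre : Tendsto (fun n => ∫ x, g n x ∂(μ : Measure ℝ)) atTop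
      (𝓝 (-(G 0 - deriv V E / 2).re)) := by
    simp only [hgint]
    exact ((Complex.continuous_re.tendsto _).comp hlim).neg
  have hint : Integrable (fun x : ℝ => (E - x)⁻¹) (μ : Measure ℝ) := by
    refine ⟨(by fun_prop : Measurable fun x : ℝ => (E - x)⁻¹).aestronglyMeasurable, ?_⟩
    have hnn : ∀ᵐ x ∂(μ : Measure ℝ), 0 ≤ (E - x)⁻¹ := hae.mono fun x hx =>
      inv_nonneg.2 (sub_nonneg.2 hx)
    rw [hasFiniteIntegral_iff_ofReal hnn]
    have h1 : ∀ x, ENNReal.ofReal (E - x)⁻¹ = liminf (fun n => ENNReal.ofReal (g n x)) atTop :=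
      fun x => ((ENNReal.continuous_ofReal.tendsto _).comp (hglim x)).liminf_eq.symm
    simp only [h1]
    refine (lintegral_liminf_le fun n => ENNReal.measurable_ofReal.comp (hgm n)).trans_lt ?_
    have h2 : ∀ n, ∫⁻ x, ENNReal.ofReal (g n x) ∂(μ : Measure ℝ)
        = ENNReal.ofReal (∫ x, g n x ∂(μ : Measure ℝ)) := fun n =>
      (ofReal_integral_eq_lintegral_ofReal (hgi n) (hg0 n)).symm
    simp only [Function.comp_apply, h2]
    have h3 := ((ENNReal.continuous_ofReal.tendsto _).comp hlimre).liminf_eq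
    simp only [Function.comp_def] at h3
    rw [h3]
    exact ENNReal.ofReal_lt_top
  have hcongr : ∀ x : ℝ, 1 / ((x : ℂ) - (E : ℂ)) = ((-(E - x)⁻¹ : ℝ) : ℂ) := fun x => by
    rw [← inv_neg, neg_sub]
    push_cast
    rw [one_div]
  have hst : stieltjes μ E = ((-∫ x, (E - x)⁻¹ ∂(μ : Measure ℝ) : ℝ) : ℂ) := by
    rw [stieltjes, ← integral_neg]
    exact (integral_congr_ae (Eventually.of_forall hcongr)).trans integral_ofReal
  refine ⟨(hint.neg.ofReal (𝕜 := ℂ)).congr (Eventually.of_forall fun x => (hcongr x).symm), ?_⟩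
  have hdom : Tendsto (fun n => ∫ x, g n x ∂(μ : Measure ℝ)) atTop
      (𝓝 (∫ x, (E - x)⁻¹ ∂(μ : Measure ℝ))) := by
    refine tendsto_integral_of_dominated_convergence (fun x => ‖(E - x)⁻¹‖)
      (fun n => (hgm n).aestronglyMeasurable) hint.norm (fun n => Eventually.of_forall fun x => ?_)
      (Eventually.of_forall hglim)
    simp only [g]
    rcases eq_or_ne x E with rfl | hne
    · simp
    · have h3 : 0 < |E - x| := abs_pos.2 (sub_ne_zero.2 hne.symm)
      rw [norm_div, norm_inv, Real.norm_eq_abs, Real.norm_eq_abs,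
        abs_of_nonneg (by positivity : 0 ≤ (x - E) ^ 2 + y n ^ 2), div_le_iff₀ (by
          have := hy0 n; positivity), inv_mul_eq_div, le_div_iff₀ h3, ← sq, sq_abs]
      nlinarith [sq_nonneg (y n)]
  have heq := tendsto_nhds_unique hdom hlimre
  rw [hst, heq, neg_neg]
  have hV0 := hV.deriv_im_ofReal E
  refine Complex.ext ?_ ?_
  · simp
  · simp [hV0, h.im_zero]

end IsEdgeChart

/-! ### Families of folds: motion of the critical point and of the slope -/

lemma norm_taylor_one_le {f : ℂ → ℂ} {r K : ℝ} (hf : DifferentiableOn ℂ f (ball 0 r))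
    (hK : ∀ s ∈ ball (0 : ℂ) r, ‖deriv (deriv f) s‖ ≤ K) {s w : ℂ} (hs : s ∈ ball (0 : ℂ) r)
    (hw : w ∈ ball (0 : ℂ) r) : ‖f w - f s - deriv f s * (w - s)‖ ≤ K * ‖w - s‖ ^ 2 := by
  have hK0 : 0 ≤ K := (norm_nonneg _).trans (hK s hs)
  set S := ball (0 : ℂ) r ∩ closedBall s ‖w - s‖
  have hSc : Convex ℝ S := (convex_ball _ _).inter (convex_closedBall _ _)
  have hd : ∀ v ∈ S,
      HasDerivWithinAt (fun v => f v - deriv f s * v) (deriv f v - deriv f s) S v := fun v hv => by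
    have := ((hf.differentiableAt (isOpen_ball.mem_nhds hv.1)).hasDerivAt.fun_sub
      ((hasDerivAt_id v).const_mul (deriv f s))).hasDerivWithinAt (s := S)
    simpa using this
  have hb : ∀ v ∈ S, ‖deriv f v - deriv f s‖ ≤ K * ‖w - s‖ := fun v hv => by
    have h1 := norm_image_sub_le_of_ball (hf.deriv isOpen_ball) hK hs hv.1
    have h2 : ‖v - s‖ ≤ ‖w - s‖ := by
      have := hv.2
      rwa [mem_closedBall, dist_eq_norm] at this
    exact h1.trans (by gcongr)
  have h := hSc.norm_image_sub_le_of_norm_hasDerivWithin_le hd hb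
    (⟨hs, mem_closedBall_self (norm_nonneg _)⟩ : s ∈ S)
    (⟨hw, by rw [mem_closedBall, dist_eq_norm]⟩ : w ∈ S)
  calc _ = ‖f w - deriv f s * w - (f s - deriv f s * s)‖ := by congr 1; ring
    _ ≤ K * ‖w - s‖ * ‖w - s‖ := h
    _ = K * ‖w - s‖ ^ 2 := by ring

lemma norm_deriv_sub_deriv_le {f g : ℂ → ℂ} {r r' δ : ℝ} (hf : DifferentiableOn ℂ f (ball 0 r))
    (hg : DifferentiableOn ℂ g (ball 0 r)) (h : ∀ s ∈ ball (0 : ℂ) r, ‖f s - g s‖ ≤ δ)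
    (hr : r' < r) {s : ℂ} (hs : s ∈ ball (0 : ℂ) r') : ‖deriv f s - deriv g s‖ ≤ δ / (r - r') := by
  have hn := isOpen_ball.mem_nhds (ball_subset_ball hr.le hs)
  have h1 := norm_deriv_le_of_ball (hf.fun_sub hg) h hr hs
  rwa [((hf.differentiableAt hn).hasDerivAt.fun_sub (hg.differentiableAt hn).hasDerivAt).deriv]
    at h1

/-- The derivatives of two nearby holomorphic functions at two nearby points. -/
lemma norm_deriv_sub_deriv_le_add {f g : ℂ → ℂ} {r B δ : ℝ} (hr : 0 < r)
    (hf : DifferentiableOn ℂ f (ball 0 r)) (hg : DifferentiableOn ℂ g (ball 0 r))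
    (hB : ∀ s ∈ ball (0 : ℂ) r, ‖f s‖ ≤ B) (h : ∀ s ∈ ball (0 : ℂ) r, ‖f s - g s‖ ≤ δ) {x y : ℂ}
    (hx : x ∈ ball (0 : ℂ) (r / 4)) (hy : y ∈ ball (0 : ℂ) (r / 4)) :
    ‖deriv f x - deriv g y‖ ≤ 8 * B / r ^ 2 * ‖x - y‖ + 2 * δ / r := by
  have h2 : ball (0 : ℂ) (r / 2) ⊆ ball 0 r := ball_subset_ball (by linarith)
  have h1 : ∀ s ∈ ball (0 : ℂ) (r / 4), ‖deriv (deriv f) s‖ ≤ B / (r - r / 2) / (r / 2 - r / 4) :=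
    fun s hs => norm_deriv_le_of_ball ((hf.deriv isOpen_ball).mono h2)
      (fun s hs => norm_deriv_le_of_ball hf hB (by linarith) hs) (by linarith) hs
  have h3 := norm_image_sub_le_of_ball ((hf.deriv isOpen_ball).mono
    (ball_subset_ball (by linarith))) h1 hy hx
  have h4 := norm_deriv_sub_deriv_le hf hg h (by linarith : r / 2 < r)
    (ball_subset_ball (by linarith) hy)
  have e1 : B / (r - r / 2) / (r / 2 - r / 4) = 8 * B / r ^ 2 := by field_simp; ring
  have e2 : δ / (r - r / 2) = 2 * δ / r := by field_simp; ring
  rw [e1] at h3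
  rw [e2] at h4
  linarith [norm_sub_le_norm_sub_add_norm_sub (deriv f x) (deriv f y) (deriv g y)]

/-- Factor p − p' as a difference of squares. Both roots have real part at least 1/2, so their sum
has norm at least 1. -/
lemma norm_csqrt_sub_csqrt_le {p p' : ℂ} (hp : ‖p - 1‖ ≤ 1 / 2) (hp' : ‖p' - 1‖ ≤ 1 / 2) :
    ‖csqrt p - csqrt p'‖ ≤ ‖p - p'‖ := by
  have hre : ∀ p, ‖p - 1‖ ≤ 1 / 2 → 1 / 2 ≤ (csqrt p).re := fun p hp => by
    have h1 := (abs_le.1 ((abs_re_le_norm _).trans ((norm_csqrt_sub_one_le hp).trans hp))).1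
    simp only [sub_re, one_re] at h1
    linarith
  have h1 : p - p' = (csqrt p - csqrt p') * (csqrt p + csqrt p') := by
    conv_lhs => rw [← csqrt_sq p, ← csqrt_sq p']
    ring
  have h2 : 1 ≤ ‖csqrt p + csqrt p'‖ := by
    refine le_trans ?_ ((le_abs_self _).trans (abs_re_le_norm _))
    rw [add_re]
    linarith [hre p hp, hre p' hp']
  rw [h1, norm_mul]
  exact le_mul_of_one_le_right (norm_nonneg _) h2

/-- A family of perturbations of the fold `s ↦ E₀ + s ^ 2` together with functions `U t` of slope
about `c`, as produced by the characteristics. -/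
structure IsFoldFamily (T r E₀ c N M : ℝ) (Z U : ℝ → ℂ → ℂ) : Prop where
  r_pos : 0 < r
  c_pos : 0 < c
  holZ : ∀ t ∈ Icc 0 T, RealHol (Z t) r
  holU : ∀ t ∈ Icc 0 T, RealHol (U t) r
  near : ∀ t ∈ Icc 0 T, ∀ s ∈ ball (0 : ℂ) r, ‖Z t s - (E₀ + s ^ 2)‖ ≤ r ^ 2 / 160
  slope : ∀ t ∈ Icc 0 T, ∀ s ∈ ball (0 : ℂ) (r / 2), ‖deriv (U t) s - c‖ ≤ c / 2
  derivZ : ∀ t ∈ Icc 0 T, ∀ s ∈ ball (0 : ℂ) r,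
    HasDerivWithinAt (fun τ => Z τ s) (-U t s) (Icc 0 T) t
  boundU : ∀ t ∈ Icc 0 T, ∀ s ∈ ball (0 : ℂ) r, ‖U t s‖ ≤ N
  lipZ : ∀ s ∈ ball (0 : ℂ) r, ∀ t ∈ Icc 0 T, ∀ τ ∈ Icc 0 T, ‖Z t s - Z τ s‖ ≤ N * |t - τ|
  lipU : ∀ s ∈ ball (0 : ℂ) r, ∀ t ∈ Icc 0 T, ∀ τ ∈ Icc 0 T, ‖U t s - U τ s‖ ≤ M * |t - τ|

namespace IsFoldFamily

variable {T r E₀ c N M : ℝ} {Z U : ℝ → ℂ → ℂ} {σ : ℝ → ℝ}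

lemma norm_deriv_deriv_sub_two_le (h : IsFoldFamily T r E₀ c N M Z U) {t : ℝ} (ht : t ∈ Icc 0 T)
    {s : ℂ} (hs : s ∈ ball (0 : ℂ) (r / 4)) : ‖deriv (deriv (Z t)) s - 2‖ ≤ 1 / 20 := by
  have hr := h.r_pos
  refine (norm_deriv_deriv_sub_le_of_fold h.r_pos (h.holZ t ht) (h.near t ht) hs).trans
    (le_of_eq ?_)
  field_simp
  norm_num

lemma ofReal_mem (h : IsFoldFamily T r E₀ c N M Z U) {x : ℝ} (hx : |x| ≤ r / 32) :
    (x : ℂ) ∈ ball (0 : ℂ) (r / 8) := ofReal_mem_ball_zero (by have := h.r_pos; linarith)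

/-- The map Z_t'/2 is near the identity and separates points up to a factor 2. So σ_t moves no
faster than the value of Z_t' at σ_τ, which Cauchy's estimate controls through the Lipschitz bound
on Z. -/
lemma abs_critical_sub_le (h : IsFoldFamily T r E₀ c N M Z U)
    (hσ : ∀ t ∈ Icc 0 T, |σ t| ≤ r / 32 ∧ deriv (Z t) (σ t) = 0) {t τ : ℝ} (ht : t ∈ Icc 0 T)
    (hτ : τ ∈ Icc 0 T) : |σ t - σ τ| ≤ 2 * N / r * |t - τ| := by
  have hr := h.r_pos
  have h8 : r / 8 ≤ r / 2 / 2 := by linarith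
  have m1 := h.ofReal_mem (hσ t ht).1
  have m2 := h.ofReal_mem (hσ τ hτ).1
  have h1 := norm_sub_le_of_near_id (realHol_half_deriv hr (h.holZ t ht)).diff
    (fun s hs => (norm_half_deriv_sub_le hr (h.holZ t ht) le_rfl (h.near t ht) hs).trans
      (by linarith)) (ball_subset_ball h8 m2) (ball_subset_ball h8 m1)
  have h2 := norm_deriv_sub_deriv_le (h.holZ t ht).diff (h.holZ τ hτ).diff
    (fun s hs => h.lipZ s hs t ht τ hτ) (by linarith : r / 2 < r)
    (ball_subset_ball (by linarith) m2)
  rw [(hσ τ hτ).2, sub_zero] at h2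
  rw [(hσ t ht).2, zero_div, zero_sub, norm_neg, norm_div, Complex.norm_ofNat,
    ← ofReal_sub, norm_real, Real.norm_eq_abs] at h1
  calc |σ t - σ τ| ≤ ‖deriv (Z t) (σ τ)‖ := by linarith
    _ ≤ N * |t - τ| / (r - r / 2) := h2
    _ = 2 * N / r * |t - τ| := by field_simp; ring

/-- The envelope argument: as Z_τ'(σ_τ) = 0, replacing σ_t by σ_τ changes Z_τ by O(|σ_τ − σ_t|²) =
O(|τ − t|²). No differentiability of σ is needed. -/
lemma hasDerivWithinAt_critical (h : IsFoldFamily T r E₀ c N M Z U)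
    (hσ : ∀ t ∈ Icc 0 T, |σ t| ≤ r / 32 ∧ deriv (Z t) (σ t) = 0) {t : ℝ} (ht : t ∈ Icc 0 T) :
    HasDerivWithinAt (fun τ => Z τ (σ τ)) (-U t (σ t)) (Icc 0 T) t := by
  have hr := h.r_pos
  have h84 : ball (0 : ℂ) (r / 8) ⊆ ball 0 (r / 4) := ball_subset_ball (by linarith)
  have h4 : ball (0 : ℂ) (r / 4) ⊆ ball 0 r := ball_subset_ball (by linarith)
  have mt := h.ofReal_mem (hσ t ht).1
  have h1 : HasDerivWithinAt (fun τ => Z τ (σ τ) - Z τ (σ t)) 0 (Icc 0 T) t := by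
    have hO : (fun τ => Z τ (σ τ) - Z τ (σ t)) =O[𝓝[Icc 0 T] t] fun τ => ‖τ - t‖ ^ 2 := by
      refine Asymptotics.IsBigO.of_bound (3 * (2 * N / r) ^ 2) ?_
      filter_upwards [eventually_mem_nhdsWithin] with τ hτ
      have mτ := h.ofReal_mem (hσ τ hτ).1
      have hK : ∀ s ∈ ball (0 : ℂ) (r / 4), ‖deriv (deriv (Z τ)) s‖ ≤ 3 := fun s hs => by
        have h2 := h.norm_deriv_deriv_sub_two_le hτ hs
        have h3 := norm_le_norm_add_norm_sub' (deriv (deriv (Z τ)) s) 2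
        rw [Complex.norm_ofNat] at h3
        linarith
      have h2 := norm_taylor_one_le ((h.holZ τ hτ).diff.mono h4) hK (h84 mτ) (h84 mt)
      rw [(hσ τ hτ).2, zero_mul, sub_zero, ← ofReal_sub, norm_real] at h2
      rw [norm_sub_rev, norm_pow, norm_norm]
      refine h2.trans ?_
      rw [mul_assoc, ← mul_pow]
      have h5 := h.abs_critical_sub_le hσ ht hτ
      rw [abs_sub_comm t τ] at h5
      gcongr
      exact h5
    have := (hO.hasFDerivWithinAt ht one_lt_two).hasDerivWithinAt
    simpa using this
  have h2 := h1.fun_add (h.derivZ t ht (σ t) (h4 (h84 mt)))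
  simpa using h2

lemma norm_half_deriv_deriv_sub_one_le (h : IsFoldFamily T r E₀ c N M Z U) {t : ℝ}
    (ht : t ∈ Icc 0 T) {s : ℂ} (hs : s ∈ ball (0 : ℂ) (r / 4)) :
    ‖deriv (deriv (Z t)) s / 2 - 1‖ ≤ 1 / 2 := by
  have h1 := h.norm_deriv_deriv_sub_two_le ht hs
  rw [show deriv (deriv (Z t)) s / 2 - 1 = (deriv (deriv (Z t)) s - 2) / 2 by ring,
    norm_div, Complex.norm_ofNat]
  linarith

/-- The slope at the edge in the local coordinate is Lipschitz in time. -/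
lemma exists_lipschitz_slope {r c N M : ℝ} (hr : 0 < r) (hc : 0 < c) (hN : 0 ≤ N) (hM : 0 ≤ M) :
    ∃ L, 0 ≤ L ∧ ∀ T E₀ Z U, IsFoldFamily T r E₀ c N M Z U → ∀ σ : ℝ → ℝ,
      (∀ t ∈ Icc 0 T, |σ t| ≤ r / 32 ∧ deriv (Z t) (σ t) = 0) → ∀ t ∈ Icc 0 T, ∀ τ ∈ Icc 0 T,
      ‖deriv (U t) (σ t) * (csqrt (deriv (deriv (Z t)) (σ t) / 2))⁻¹
        - deriv (U τ) (σ τ) * (csqrt (deriv (deriv (Z τ)) (σ τ) / 2))⁻¹‖ ≤ L * |t - τ| := by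
  -- Lipschitz constants of U_t'(σ_t) and of Z_t''(σ_t)/2. In each, the first summand comes from the
  -- motion of σ_t and the second from the change of the function.
  set L₁ := 8 * N / r ^ 2 * (2 * N / r) + 2 * M / r with hL₁
  set L₂ := 8 * (2 * r) / (r / 2) ^ 2 * (2 * N / r) + 2 * (2 * N / r) / (r / 2) with hL₂
  refine ⟨2 * L₁ + 4 * (2 * c) * L₂, by positivity, fun T E₀ Z U h σ hσ t ht τ hτ => ?_⟩
  have mt := h.ofReal_mem (hσ t ht).1
  have mτ := h.ofReal_mem (hσ τ hτ).1
  have h84 : ball (0 : ℂ) (r / 8) ⊆ ball 0 (r / 4) := ball_subset_ball (by linarith)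
  have h82 : ball (0 : ℂ) (r / 8) ⊆ ball 0 (r / 2 / 4) := ball_subset_ball (by linarith)
  have hσσ : ‖(σ t : ℂ) - σ τ‖ ≤ 2 * N / r * |t - τ| := by
    rw [← ofReal_sub, norm_real]
    exact h.abs_critical_sub_le hσ ht hτ
  set u := deriv (U t) (σ t)
  set u' := deriv (U τ) (σ τ) with hu'
  set p := deriv (deriv (Z t)) (σ t) / 2 with hp
  set p' := deriv (deriv (Z τ)) (σ τ) / 2 with hp'
  have huu : ‖u - u'‖ ≤ L₁ * |t - τ| := by
    refine (norm_deriv_sub_deriv_le_add hr (h.holU t ht).diff (h.holU τ hτ).diff (h.boundU t ht)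
      (fun s hs => h.lipU s hs t ht τ hτ) (h84 mt) (h84 mτ)).trans ?_
    calc _ ≤ 8 * N / r ^ 2 * (2 * N / r * |t - τ|) + 2 * (M * |t - τ|) / r := by gcongr
      _ = L₁ * |t - τ| := by rw [hL₁]; ring
  have hpp : ‖p - p'‖ ≤ L₂ * |t - τ| := by
    have h2 : ball (0 : ℂ) (r / 2) ⊆ ball 0 r := ball_subset_ball (by linarith)
    have hb : ∀ s ∈ ball (0 : ℂ) (r / 2), ‖deriv (Z t) s‖ ≤ 2 * r := fun s hs => by
      have h3 := norm_half_deriv_sub_le hr (h.holZ t ht) le_rfl (h.near t ht) hs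
      have h4 := norm_le_norm_add_norm_sub' (deriv (Z t) s / 2) s
      rw [norm_div, Complex.norm_ofNat] at h4
      linarith [mem_ball_zero_iff.1 hs]
    have h5 := norm_deriv_sub_deriv_le_add (half_pos hr) ((h.holZ t ht).deriv.diff.mono h2)
      ((h.holZ τ hτ).deriv.diff.mono h2) hb
      (fun s hs => norm_deriv_sub_deriv_le (h.holZ t ht).diff (h.holZ τ hτ).diff
        (fun s hs => h.lipZ s hs t ht τ hτ) (by linarith : r / 2 < r) hs) (h82 mt) (h82 mτ)
    have h6 : N * |t - τ| / (r - r / 2) = 2 * N / r * |t - τ| := by field_simp; ring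
    rw [h6] at h5
    have h7 : p - p' = (deriv (deriv (Z t)) (σ t) - deriv (deriv (Z τ)) (σ τ)) / 2 := by
      rw [hp, hp']; ring
    rw [h7, norm_div, Complex.norm_ofNat]
    refine (half_le_self (norm_nonneg _)).trans (h5.trans ?_)
    calc _ ≤ 8 * (2 * r) / (r / 2) ^ 2 * (2 * N / r * |t - τ|)
          + 2 * (2 * N / r * |t - τ|) / (r / 2) := by gcongr
      _ = L₂ * |t - τ| := by rw [hL₂]; ring
  have hp1 : ‖p - 1‖ ≤ 1 / 2 := h.norm_half_deriv_deriv_sub_one_le ht (h84 mt)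
  have hp1' : ‖p' - 1‖ ≤ 1 / 2 := h.norm_half_deriv_deriv_sub_one_le hτ (h84 mτ)
  have hκ : ∀ p : ℂ, ‖p - 1‖ ≤ 1 / 2 → csqrt p ≠ 0 ∧ ‖(csqrt p)⁻¹‖ ≤ 2 := fun p hp => by
    have h3 := (norm_csqrt_sub_one_le hp).trans hp
    have h4 := norm_le_norm_add_norm_sub (csqrt p) 1
    rw [norm_one] at h4
    have h5 : 1 / 2 ≤ ‖csqrt p‖ := by linarith
    refine ⟨norm_pos_iff.1 (by linarith), ?_⟩
    rw [norm_inv]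
    exact inv_le_of_inv_le₀ two_pos (by linarith)
  have hub : ‖u'‖ ≤ 2 * c := by
    have h1 := h.slope τ hτ _ (ball_subset_ball (by linarith) mτ)
    have h2 := norm_le_norm_add_norm_sub' u' c
    rw [norm_real, Real.norm_eq_abs, abs_of_pos hc] at h2
    rw [← hu'] at h1
    linarith
  obtain ⟨k1, k2⟩ := hκ p hp1
  obtain ⟨k1', k2'⟩ := hκ p' hp1'
  have h8 : u * (csqrt p)⁻¹ - u' * (csqrt p')⁻¹
      = (u - u') * (csqrt p)⁻¹ - u' * (csqrt p - csqrt p') * ((csqrt p)⁻¹ * (csqrt p')⁻¹) := by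
    field_simp
    ring
  rw [h8]
  calc _ ≤ ‖u - u'‖ * ‖(csqrt p)⁻¹‖
        + ‖u'‖ * ‖csqrt p - csqrt p'‖ * (‖(csqrt p)⁻¹‖ * ‖(csqrt p')⁻¹‖) := by
        rw [← norm_mul, ← norm_mul, ← norm_mul, ← norm_mul]; exact norm_sub_le _ _
    _ ≤ (L₁ * |t - τ|) * 2 + (2 * c) * (L₂ * |t - τ|) * (2 * 2) := by
        have := (norm_csqrt_sub_csqrt_le hp1 hp1').trans hpp
        gcongr
    _ = (2 * L₁ + 4 * (2 * c) * L₂) * |t - τ| := by ring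

/-- The slope at the edge in the local coordinate is bounded below. -/
lemma slope_ge (h : IsFoldFamily T r E₀ c N M Z U) {t x g : ℝ} (ht : t ∈ Icc 0 T)
    (hx : |x| ≤ r / 32)
    (hg : deriv (U t) x * (csqrt (deriv (deriv (Z t)) x / 2))⁻¹ = g) : c / 3 ≤ g := by
  have hr := h.r_pos
  have hc := h.c_pos
  have m := h.ofReal_mem hx
  have hp := h.norm_half_deriv_deriv_sub_one_le ht (ball_subset_ball (by linarith) m)
  set κ := csqrt (deriv (deriv (Z t)) x / 2)
  have hκ := (abs_le.1 ((abs_re_le_norm _).trans ((norm_csqrt_sub_one_le hp).trans hp)))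
  simp only [sub_re, one_re] at hκ
  have hκ0 : κ ≠ 0 := fun h0 => by
    have := csqrt_re_pos (mem_slitPlane_of_norm_sub_one hp)
    simp only [κ] at h0
    rw [h0] at this
    simp at this
  have h1 : deriv (U t) x = g * κ := by rw [← hg]; field_simp
  have h2 := (abs_le.1 ((abs_re_le_norm _).trans
    (h.slope t ht x (ball_subset_ball (by linarith) m)))).1
  rw [h1, sub_re, re_ofReal_mul, ofReal_re] at h2
  -- The factor 1/3 arises from Re κ ≤ 3/2.
  have h3 : c / 2 ≤ g * κ.re := by linarith
  have hg0 : 0 < g := by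
    by_contra hneg
    nlinarith
  nlinarith

end IsFoldFamily

/-! ### From characteristics to edge charts -/

section EdgeChart

variable {V : ℂ → ℂ} {T r R E₀ c N M : ℝ} {ρ : ℝ → ProbabilityMeasure ℝ} {k : ℂ → ℂ}
  {Z U : ℝ → ℂ → ℂ}

/-- The characteristics that start in the upper half `s`-disc move downwards. -/
lemma IsFlow.im_antitone {F : ℝ → ℂ → ℂ} {h : ℂ → ℂ} (hZ : IsFlow F T r R N h k Z U)
    (hf : IsFoldFamily T r E₀ c N M Z U) {s : ℂ} (hs : s ∈ ball (0 : ℂ) (r / 2)) (hs0 : 0 < s.im) :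
    AntitoneOn (fun τ => (Z τ s).im) (Icc 0 T) := by
  have hr := hf.r_pos
  have hsr : s ∈ ball (0 : ℂ) r := ball_subset_ball (by linarith) hs
  have hd : ∀ τ ∈ Icc 0 T, HasDerivWithinAt (fun τ => (Z τ s).im) (-U τ s).im (Icc 0 T) τ :=
    fun τ hτ => Complex.imCLM.hasFDerivAt.comp_hasDerivWithinAt τ (hZ.derivZ τ hτ s hsr)
  refine antitoneOn_of_hasDerivWithinAt_nonpos (f' := fun τ => (-U τ s).im) (convex_Icc 0 T)
    (fun τ hτ => (hd τ hτ).continuousWithinAt)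
    (fun τ hτ => (hd τ (interior_subset hτ)).mono interior_subset) fun τ hτ => ?_
  have h1 := (abs_le.1 (((hf.holU τ (interior_subset hτ)).mono (by linarith : r / 2 ≤ r)).abs_im_sub_le
    (hf.slope τ (interior_subset hτ)) hs)).1
  rw [abs_of_pos hs0] at h1
  have := mul_pos hf.c_pos hs0
  rw [neg_im]
  linarith

/-- The chart is G = U_t ∘ ψ, with ψ the inverse Morse coordinate of Z_t. Each z above the axis near
the edge is Z_t(s) for s = ψ(√(z − E_t)), and transport along that characteristic identifies m_t +
V'/2 at z. -/
theorem IsSolution.exists_edgeChart (hV : IsPotential V) (hρ : IsSolution V T ρ)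
    (hZ : IsFlow (fun t => forcing V (ρ t)) T r R N (fun s => E₀ + s ^ 2) k Z U)
    (hf : IsFoldFamily T r E₀ c N M Z U)
    (h0 : ∀ s ∈ ball (0 : ℂ) r, 0 < s.re → 0 < s.im →
      stieltjes (ρ 0) (E₀ + s ^ 2) + deriv V (E₀ + s ^ 2) / 2 = k s) {t : ℝ} (ht : t ∈ Icc 0 T) :
    ∃ (x g : ℝ) (G : ℂ → ℂ), (|x| ≤ r / 32 ∧ deriv (Z t) x = 0) ∧ (Z t x).im = 0 ∧
      deriv (U t) x * (csqrt (deriv (deriv (Z t)) x / 2))⁻¹ = g ∧ G 0 = U t x ∧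
      IsEdgeChart V (ρ t) (Z t x).re (r / 32) N g G := by
  have hr := hf.r_pos
  obtain ⟨x, ψ, hx, hx0, hψ, hψ0, hψd, hψ'⟩ :=
    exists_fold hr (hf.holZ t ht) le_rfl (hf.near t ht)
  have hball : closedBall (0 : ℂ) (r / 16) ⊆ ball 0 (r / 2) := closedBall_subset_ball (by linarith)
  have hballr : ball (0 : ℂ) (r / 2) ⊆ ball 0 r := ball_subset_ball (by linarith)
  have hxr : (x : ℂ) ∈ ball (0 : ℂ) r := ball_subset_ball (by linarith) (hf.ofReal_mem hx)
  have hZx : (Z t x).im = 0 := (hf.holZ t ht).im_ofReal hxr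
  have hZre : Z t x = ((Z t x).re : ℂ) := Complex.ext (by simp) (by simp [hZx])
  have hG : RealHol (fun ζ => U t (ψ ζ)) (r / 32) :=
    (hf.holU t ht).comp hψ fun ζ hζ => hballr (hball (hψ' ζ hζ).1)
  have hq0 : (0 : ℂ) ∈ ball (0 : ℂ) (r / 32) := mem_ball_self (by positivity)
  have hGd : deriv (fun ζ => U t (ψ ζ)) 0
      = deriv (U t) x * (csqrt (deriv (deriv (Z t)) x / 2))⁻¹ := by
    have h1 : HasDerivAt (U t) (deriv (U t) x) (ψ 0) := by
      rw [hψ0]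
      exact ((hf.holU t ht).differentiableAt hxr).hasDerivAt
    exact (h1.comp (0 : ℂ) hψd).deriv
  have hGre : deriv (fun ζ => U t (ψ ζ)) 0 = ((deriv (fun ζ => U t (ψ ζ)) 0).re : ℂ) := by
    refine Complex.ext (by simp) ?_
    have := hG.deriv.im_ofReal (x := 0) (by simpa using hr)
    simpa using this
  refine ⟨x, (deriv (fun ζ => U t (ψ ζ)) 0).re, fun ζ => U t (ψ ζ), ⟨hx, hx0⟩, hZx, ?_, ?_,
    ⟨by positivity, hG, fun ζ hζ => hf.boundU t ht _ (hballr (hball (hψ' ζ hζ).1)), hGre, ?_⟩⟩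
  · rw [← hGre, hGd]
  · simp only [hψ0]
  · intro z hz hzb
    have hmem : z - ((Z t x).re : ℂ) ∈ ball (0 : ℂ) ((r / 32) ^ 2) := by
      rwa [mem_ball_zero_iff, ← dist_eq_norm]
    have hζ := csqrt_mem_ball (by positivity) hmem
    have hζim : 0 < (csqrt (z - ((Z t x).re : ℂ))).im := csqrt_im_pos (by simpa using hz)
    obtain ⟨hs, hZs, hsim⟩ := hψ' _ hζ
    set s := ψ (csqrt (z - ((Z t x).re : ℂ)))
    rw [csqrt_sq, hZre, ofReal_re, add_sub_cancel] at hZs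
    have hs2 := hball hs
    have hanti := hZ.im_antitone hf hs2 (hsim hζim)
    have hle : ∀ τ ∈ Icc 0 t, z.im ≤ (Z τ s).im := fun τ hτ => by
      have := hanti ⟨hτ.1, hτ.2.trans ht.2⟩ ht hτ.2
      simp only [hZs] at this
      exact this
    -- At time 0 the characteristic is at height 2 Re s Im s ≥ Im z > 0, so s lies in the quadrant
    -- where k represents the initial transform.
    have hre : 0 < s.re := by
      have h1 := hle 0 ⟨le_rfl, ht.1⟩
      rw [(hZ.init s (hballr hs2)).1] at h1
      have h2 : ((E₀ : ℂ) + s ^ 2).im = 2 * s.re * s.im := by simp [sq]; ring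
      rw [h2] at h1
      by_contra hneg
      nlinarith [hsim hζim]
    have := hZ.stieltjes_eq hV hρ ht (hballr hs2) hz hle (h0 s (hballr hs2) hre (hsim hζim))
    rwa [hZs] at this

end EdgeChart

/-- The characteristics that start near a square root edge form a family of folds, for a time
that depends only on the initial data and the range of the solution. -/
theorem exists_foldFamily {V : ℂ → ℂ} (hV : IsPotential V) (b E₀ : ℝ) {r₁ c : ℝ} {k₀ : ℂ → ℂ}
    (hr₁ : 0 < r₁) (hk₀ : RealHol k₀ r₁) (hc : 0 < c) (hkc : deriv k₀ 0 = c) :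
    ∃ r > 0, r ≤ r₁ ∧ ∃ N M, 0 ≤ N ∧ 0 ≤ M ∧ ∃ δ > 0, ∀ (T : ℝ) (ρ : ℝ → ProbabilityMeasure ℝ),
      0 ≤ T → T ≤ δ → IsSolution V T ρ → (∀ t ∈ Icc 0 T, CarriedBy (ρ t) b) →
      ∃ Z U, (∃ R, IsFlow (fun t => forcing V (ρ t)) T r R N (fun s => E₀ + s ^ 2)
          (fun s => k₀ s + deriv V (E₀ + s ^ 2) / 2) Z U) ∧
        IsFoldFamily T r E₀ c N M Z U := by
  let h : ℂ → ℂ := fun s => E₀ + s ^ 2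
  let k : ℂ → ℂ := fun s => k₀ s + deriv V (h s) / 2
  have hhd : Differentiable ℂ h := by fun_prop
  have hVd : Differentiable ℂ fun s => deriv V (h s) / 2 :=
    (hV.differentiable_deriv.comp hhd).div_const 2
  have hh : ∀ r, RealHol h r := fun r => ⟨hhd.differentiableOn, fun s _ => by simp [h]⟩
  have hk : RealHol k r₁ := by
    refine ⟨hk₀.diff.add hVd.differentiableOn, fun s hs => ?_⟩
    have h1 : h (conj s) = conj (h s) := by simp [h]
    simp only [k, h1, hk₀.symm s hs, hV.deriv_apply_conj, map_add, map_div₀, map_ofNat]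
  have h0 : (0 : ℂ) ∈ ball (0 : ℂ) r₁ := mem_ball_self hr₁
  have hkd : deriv k 0 = c := by
    have e1 : HasDerivAt h 0 0 := by
      have := ((hasDerivAt_id (0 : ℂ)).fun_pow 2).const_add (E₀ : ℂ)
      exact this.congr_deriv (by simp)
    have e2 := ((hV.hasDerivAt_deriv (h 0)).comp (0 : ℂ) e1).div_const 2
    have e3 := (hk₀.differentiableAt h0).hasDerivAt.fun_add e2
    have e4 := e3.deriv
    simp only [mul_zero, zero_div, add_zero, hkc] at e4
    exact e4
  obtain ⟨r₂, hr₂, hkr₂⟩ : ∃ r₂ > 0, ∀ s ∈ ball (0 : ℂ) r₂, ‖deriv k s - c‖ ≤ c / 4 := by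
    have hcont := (hk.deriv.differentiableAt h0).continuousAt
    obtain ⟨r₂, hr₂, h2⟩ := Metric.continuousAt_iff.1 hcont (c / 4) (by positivity)
    refine ⟨r₂, hr₂, fun s hs => ?_⟩
    have := h2 (mem_ball.1 hs)
    rw [dist_eq_norm, hkd] at this
    exact this.le
  -- Halving makes k continuous up to the boundary of the closed disc while U' starts within c/4 of
  -- c.
  set r := min r₁ r₂ / 2 with hr
  have hr0 : 0 < r := by positivity
  have hrr₁ : r < r₁ := by have := min_le_left r₁ r₂; linarith
  have hrr₂ : r ≤ r₂ := by have := min_le_right r₁ r₂; linarith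
  have hkc : ContinuousOn k (closedBall 0 r) :=
    hk.diff.continuousOn.mono (closedBall_subset_ball hrr₁)
  obtain ⟨D, hD⟩ := (isCompact_closedBall (0 : ℂ) r).exists_bound_of_continuousOn hkc
  set N := |D| + 1 with hN
  obtain ⟨M, hM0, hM⟩ := exists_isForcing hV b (|E₀| + r ^ 2 + 1)
  -- The three time bounds serve existence of the flow, closeness N·T ≤ r²/160 to the fold, and M·T
  -- ≤ cr/8. By Cauchy on the half disc the last one changes U' by at most c/4, for a total
  -- deviation of c/2.
  refine ⟨r, hr0, hrr₁.le, N, M, by positivity, hM0,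
    min (1 / (N + M)) (min (r ^ 2 / 160 / N) (c * r / 8 / (M + 1))), by positivity,
    fun T ρ hT hTδ hρ hb => ?_⟩
  have hN0 : 0 < N := by positivity
  have hT1 : T * (N + M) ≤ 1 := by
    rw [← le_div_iff₀ (by positivity)]; exact hTδ.trans (min_le_left _ _)
  have hTN : T * N ≤ 1 := le_trans (by gcongr; linarith) hT1
  have hTM : T * M ≤ 1 := le_trans (by gcongr; linarith) hT1
  have hT2 : N * T ≤ r ^ 2 / 160 := by
    rw [mul_comm, ← le_div_iff₀ hN0]
    exact hTδ.trans ((min_le_right _ _).trans (min_le_left _ _))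
  have hT3 : M * T ≤ c * r / 8 := by
    have h1 : T * (M + 1) ≤ c * r / 8 := by
      rw [← le_div_iff₀ (by positivity)]
      exact hTδ.trans ((min_le_right _ _).trans (min_le_right _ _))
    linarith
  have hF := hM T ρ hρ.continuousOn hb
  obtain ⟨Z, U, hZ⟩ := exists_flow hT hr0 hF (hh r) hhd.continuous.continuousOn
    (hk.mono hrr₁.le) hkc (fun s hs => by
      have h1 := norm_add_le (E₀ : ℂ) (s ^ 2)
      rw [norm_real, Real.norm_eq_abs, norm_pow] at h1
      have h2 : ‖s‖ ^ 2 ≤ r ^ 2 := by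
        have := mem_closedBall_zero_iff.1 hs
        gcongr
      simp only [h]
      linarith) (fun s hs => by
      have := (hD s hs).trans (le_abs_self D)
      linarith) hTN hTM
  have hZ0 : (0 : ℝ) ∈ Icc 0 T := ⟨le_rfl, hT⟩
  refine ⟨Z, U, ⟨_, hZ⟩, hr0, hc, hZ.holZ, hZ.holU, fun t ht s hs => ?_, fun t ht s hs => ?_,
    hZ.derivZ, hZ.boundU, fun s hs t ht τ hτ => hZ.norm_Z_sub_le hs ht hτ,
    fun s hs t ht τ hτ => hZ.norm_U_sub_le hF hs ht hτ⟩
  · have h1 := hZ.norm_Z_sub_le hs ht hZ0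
    rw [(hZ.init s hs).1, sub_zero, abs_of_nonneg ht.1] at h1
    exact h1.trans (le_trans (by gcongr; exact ht.2) hT2)
  · have hsr : s ∈ ball (0 : ℂ) r := ball_subset_ball (by linarith) hs
    have h1 := norm_deriv_sub_deriv_le (hZ.holU t ht).diff (hk.mono hrr₁.le).diff
      (δ := c * r / 8) (fun s hs => by
        have h1 := hZ.norm_U_sub_le hF hs ht hZ0
        rw [(hZ.init s hs).2, sub_zero, abs_of_nonneg ht.1] at h1
        exact h1.trans (le_trans (by gcongr; exact ht.2) hT3)) (by linarith : r / 2 < r) hs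
    have h2 : c * r / 8 / (r - r / 2) = c / 4 := by field_simp; norm_num
    rw [h2] at h1
    have h3 := hkr₂ s (ball_subset_ball hrr₂ hsr)
    linarith [norm_sub_le_norm_sub_add_norm_sub (deriv (U t) s) (deriv k s) c]

/-- Mass to the right of the edge: none near the edge by the chart, none away from it by finite
speed of propagation. -/
lemma measure_Ioi_eq_zero {μ : ProbabilityMeasure ℝ} {b E q w : ℝ} (hμ : CarriedBy μ b)
    (hw : 0 < w) (hq : 0 < q) (hnear : (μ : Measure ℝ) (Ioo E (E + q)) = 0)
    (hfar : ∀ x : ℝ, |x| ≤ b → E + q / 2 ≤ x → (μ : Measure ℝ) (Ioo (x - w) (x + w)) = 0) :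
    (μ : Measure ℝ) (Ioi E) = 0 := by
  have h1 : (μ : Measure ℝ) (Ici (E + q / 2) ∩ Icc (-b) b) = 0 := by
    refine measure_null_of_locally_null _ fun x hx => ?_
    exact ⟨Ioo (x - w) (x + w),
      mem_nhdsWithin_of_mem_nhds (Ioo_mem_nhds (by linarith) (by linarith)),
      hfar x (abs_le.2 hx.2) hx.1⟩
  refine measure_mono_null (t := Ioo E (E + q) ∪ ((Ici (E + q / 2) ∩ Icc (-b) b) ∪ (Icc (-b) b)ᶜ))
    ?_ (measure_union_null hnear (measure_union_null h1 hμ))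
  intro x hx
  by_cases hxq : x < E + q
  · exact Or.inl ⟨hx, hxq⟩
  · refine Or.inr ?_
    by_cases hxb : x ∈ Icc (-b) b
    · exact Or.inl ⟨by rw [mem_Ici]; linarith, hxb⟩
    · exact Or.inr hxb

lemma IsFoldFamily.abs_edge_sub_le {T r E₀ c N M : ℝ} {Z U : ℝ → ℂ → ℂ} {σ : ℝ → ℝ}
    (h : IsFoldFamily T r E₀ c N M Z U)
    (hσ : ∀ t ∈ Icc 0 T, |σ t| ≤ r / 32 ∧ deriv (Z t) (σ t) = 0) {t s : ℝ} (ht : t ∈ Icc 0 T)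
    (hs : s ∈ Icc 0 T) : |(Z t (σ t)).re - (Z s (σ s)).re| ≤ N * |t - s| := by
  have hr := h.r_pos
  rw [← sub_re]
  exact (abs_re_le_norm _).trans ((convex_Icc 0 T).norm_image_sub_le_of_norm_hasDerivWithin_le
    (fun τ hτ => h.hasDerivWithinAt_critical hσ hτ) (fun τ hτ => by
      rw [norm_neg]
      exact h.boundU τ hτ _ (ball_subset_ball (by linarith) (h.ofReal_mem (hσ τ hτ).1))) hs ht)

/-- Square root asymptotics of the density, with an explicit neighbourhood of the edge. -/
lemma IsEdgeChart.abs_edgeDensity_sub_le_mul {V : ℂ → ℂ} {μ : ProbabilityMeasure ℝ}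
    {E q N c c₀ η : ℝ} {G : ℂ → ℂ} (h : IsEdgeChart V μ E q N c G) (hN : 0 ≤ N) (hc₀ : 0 < c₀)
    (hc : c₀ ≤ c) (hη : 0 < η) {x : ℝ}
    (hx : |x - E| ≤ min (q ^ 2 / 32) ((η * c₀ / (8 * N / q ^ 2 + 1)) ^ 2)) :
    |edgeDensity G E q x - c / Real.pi * Real.sqrt (max (E - x) 0)|
      ≤ η * (c / Real.pi * Real.sqrt (max (E - x) 0)) := by
  have hq := pow_pos h.pos 2
  have hA : 0 ≤ 8 * N / q ^ 2 := by positivity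
  refine (h.abs_edgeDensity_sub_le (by linarith [hx.trans (min_le_left _ _)])).trans ?_
  set A := 8 * N / q ^ 2
  set y := Real.sqrt (max (E - x) 0) with hy
  have hy0 : 0 ≤ y := Real.sqrt_nonneg _
  have h1 : y ≤ η * c₀ / (A + 1) := by
    rw [hy]
    refine Real.sqrt_le_iff.2 ⟨by positivity, max_le ?_ (by positivity)⟩
    linarith [hx.trans (min_le_right _ _), neg_abs_le (x - E)]
  have h2 : A * y ≤ η * c := by
    rw [le_div_iff₀ (by positivity)] at h1
    nlinarith
  have hpi := Real.pi_pos
  calc A / Real.pi * y ^ 2 = A * y * (y / Real.pi) := by ring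
    _ ≤ η * c * (y / Real.pi) := by gcongr
    _ = η * (c / Real.pi * y) := by ring

end McKeanVlasov

/-! ### Assembly of the main theorem -/

open McKeanVlasov in
theorem mainTheorem7 (V : ℂ → ℂ) (hV : McKeanVlasov.IsPotential V)
    (ρ₀ : ProbabilityMeasure ℝ) (hcompact : ∃ a : ℝ, McKeanVlasov.CarriedBy ρ₀ a)
    (E₀ : ℝ) (hedge : McKeanVlasov.HasSqrtEdge ρ₀ E₀) :
    ∃ T₀ > (0 : ℝ), ∃ ε > (0 : ℝ), ∃ L : ℝ,
      ∀ T : ℝ, 0 < T → T ≤ T₀ →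
      ∀ ρ : ℝ → ProbabilityMeasure ℝ, McKeanVlasov.IsSolution V T ρ → ρ 0 = ρ₀ →
      ∃ (E C : ℝ → ℝ) (f : ℝ → ℝ → ℝ),
        E 0 = E₀ ∧
        -- square root behaviour is preserved
        (∀ t ∈ Icc 0 T, McKeanVlasov.HasSqrtEdge (ρ t) (E t)) ∧
        -- the equation of the edge; the Stieltjes transform converges absolutely at the edge
        (∀ t ∈ Icc 0 T,
          Integrable (fun x : ℝ => 1 / ((x : ℂ) - (E t : ℂ))) (ρ t : Measure ℝ) ∧
          HasDerivWithinAt (fun s : ℝ => (E s : ℂ))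
            (-McKeanVlasov.stieltjes (ρ t) (E t) - deriv V (E t) / 2) (Icc 0 T) t) ∧
        (∀ s ∈ Icc 0 T, ∀ t ∈ Icc 0 T, |E t - E s| ≤ L * |t - s|) ∧
        -- `f t` is a density of `ρ t` on `[E t - ε, E t + ε]`
        (∀ t ∈ Icc 0 T, 0 < C t ∧ Measurable (f t) ∧ (∀ x, 0 ≤ f t x) ∧
          (ρ t : Measure ℝ).restrict (Icc (E t - ε) (E t + ε)) =
            (volume.restrict (Icc (E t - ε) (E t + ε))).withDensity
              (fun x => ENNReal.ofReal (f t x))) ∧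
        -- `f t x = (1 + o(1)) C_t √(E_t - x)₊` as `x → E_t`, uniformly in `t`
        (∀ η > (0 : ℝ), ∃ δ > (0 : ℝ), ∀ t ∈ Icc 0 T, ∀ x : ℝ, |x - E t| ≤ δ →
          |f t x - C t * Real.sqrt (max (E t - x) 0)|
            ≤ η * (C t * Real.sqrt (max (E t - x) 0))) ∧
        (∀ s ∈ Icc 0 T, ∀ t ∈ Icc 0 T, |C t - C s| ≤ L * |t - s|) := by
  obtain ⟨a, ha⟩ := hcompact
  obtain ⟨r₁, hr₁, k₀, hk₀, ⟨c, hc, hkc⟩, hmk⟩ := hedge.exists_uniformization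
  obtain ⟨T₁, hT₁, hsupp⟩ := exists_time_carriedBy hV a
  obtain ⟨r, hr, hrr₁, N, M, hN, hM, T₂, hT₂, hfold⟩ :=
    exists_foldFamily hV (a + 1) E₀ hr₁ hk₀ hc hkc
  obtain ⟨L, hL, hLip⟩ := IsFoldFamily.exists_lipschitz_slope hr hc hN hM
  set q := r / 32 with hq
  have hq0 : 0 < q := by positivity
  have hqq : 0 < q ^ 2 := by positivity
  obtain ⟨T₃, hT₃, hfar⟩ := exists_time_measure_Ioo_eq_zero hV (a + 1) (a + 1)
    (r := q ^ 2 / 32) (by positivity)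
  -- The last bound on T keeps E_t within q²/8 of E₀. The width ε = q²/4 puts the closed interval
  -- inside the open one of half-width q²/2 on which the chart gives a density. In L, the summand N
  -- serves E and the other serves C.
  refine ⟨min (min T₁ T₂) (min T₃ (q ^ 2 / 8 / (N + 1))), by positivity, q ^ 2 / 4, by positivity,
    N + L, fun T hT0 hT ρ hρ hρ0 => ?_⟩
  have hTT₁ : T ≤ T₁ := hT.trans ((min_le_left _ _).trans (min_le_left _ _))
  have hTT₂ : T ≤ T₂ := hT.trans ((min_le_left _ _).trans (min_le_right _ _))
  have hTT₃ : T ≤ T₃ := hT.trans ((min_le_right _ _).trans (min_le_left _ _))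
  have hTN : N * T ≤ q ^ 2 / 8 := by
    have h1 : T ≤ q ^ 2 / 8 / (N + 1) := hT.trans ((min_le_right _ _).trans (min_le_right _ _))
    rw [le_div_iff₀ (by positivity)] at h1
    linarith
  have hb := hsupp T ρ hTT₁ hρ (by rw [hρ0]; exact ha)
  obtain ⟨Z, U, ⟨R, hZ⟩, hf⟩ := hfold T ρ hT0.le hTT₂ hρ hb
  have hchart : ∀ t : ℝ, ∃ (x g : ℝ) (G : ℂ → ℂ), t ∈ Icc 0 T →
      (|x| ≤ r / 32 ∧ deriv (Z t) x = 0) ∧ (Z t x).im = 0 ∧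
      deriv (U t) x * (csqrt (deriv (deriv (Z t)) x / 2))⁻¹ = g ∧
      G 0 = U t x ∧ IsEdgeChart V (ρ t) (Z t x).re q N g G := by
    intro t
    by_cases ht : t ∈ Icc 0 T
    · obtain ⟨x, g, G, h⟩ := hρ.exists_edgeChart hV hZ hf (fun s hs h1 h2 => by
        rw [hρ0, hmk s (Metric.ball_subset_ball hrr₁ hs) h1 h2]) ht
      exact ⟨x, g, G, fun _ => h⟩
    · exact ⟨0, 0, 0, fun h => (ht h).elim⟩
  choose σ g G hσg using hchart
  have hσ : ∀ t ∈ Icc 0 T, |σ t| ≤ r / 32 ∧ deriv (Z t) (σ t) = 0 := fun t ht => (hσg t ht).1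
  have hG : ∀ t ∈ Icc 0 T, IsEdgeChart V (ρ t) (Z t (σ t)).re q N (g t) (G t) :=
    fun t ht => (hσg t ht).2.2.2.2
  have hg : ∀ t ∈ Icc 0 T, c / 3 ≤ g t := fun t ht =>
    hf.slope_ge ht (hσ t ht).1 (hσg t ht).2.2.1
  have hZre : ∀ t ∈ Icc 0 T, Z t (σ t) = (((Z t (σ t)).re : ℝ) : ℂ) := fun t ht =>
    Complex.ext (by simp) (by simp [(hσg t ht).2.1])
  have h0T : (0 : ℝ) ∈ Icc 0 T := ⟨le_rfl, hT0.le⟩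
  have hE0 : (Z 0 (σ 0)).re = E₀ := by
    have hm : ∀ {x : ℝ}, |x| ≤ r / 32 → (x : ℂ) ∈ Metric.ball (0 : ℂ) r := fun hx =>
      Metric.ball_subset_ball (by linarith) (hf.ofReal_mem hx)
    -- At time 0 the map is exactly the fold, whose derivative 2s vanishes only at 0.
    have hσ0 : σ 0 = 0 := by
      have h1 : Z 0 =ᶠ[𝓝 (σ 0 : ℂ)] fun s => (E₀ : ℂ) + s ^ 2 := by
        filter_upwards [Metric.isOpen_ball.mem_nhds (hm (hσ 0 h0T).1)] with s hs
        exact (hZ.init s hs).1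
      have h2 := (((hasDerivAt_id (σ 0 : ℂ)).fun_pow 2).const_add (E₀ : ℂ)).deriv
      have h3 := h1.deriv_eq
      simp only [id] at h2
      rw [(hσ 0 h0T).2, h2] at h3
      simpa using h3.symm
    rw [hσ0, (hZ.init _ (hm (by simpa using by positivity))).1]
    simp
  have hElip : ∀ s ∈ Icc 0 T, ∀ t ∈ Icc 0 T, |(Z t (σ t)).re - (Z s (σ s)).re| ≤ N * |t - s| :=
    fun s hs t ht => hf.abs_edge_sub_le hσ ht hs
  have hright : ∀ t ∈ Icc 0 T, (ρ t : Measure ℝ) (Ioi (Z t (σ t)).re) = 0 := by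
    intro t ht
    have hEt := hElip 0 h0T t ht
    rw [hE0, sub_zero, abs_of_nonneg ht.1] at hEt
    have hEt' : |(Z t (σ t)).re - E₀| ≤ q ^ 2 / 8 :=
      hEt.trans (le_trans (by gcongr; exact ht.2) hTN)
    -- Far points satisfy x ≥ E_t + q²/4 ≥ E₀ + q²/8. The interval of radius 2·(q²/32) = q²/16 about
    -- x therefore lies to the right of E₀, where the initial measure has no mass.
    refine measure_Ioi_eq_zero (hb t ht) (w := q ^ 2 / 32 / 16) (by positivity) (half_pos hqq)
      ((hG t ht).measure_Ioo_eq_zero hV) fun x hxb hx => ?_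
    refine hfar T ρ hTT₃ hρ hb x hxb ?_ t ht
    rw [hρ0]
    refine measure_mono_null (fun u hu => ?_) hedge.1
    rw [mem_Ioi]
    linarith [hu.1, (abs_le.1 hEt').1]
  refine ⟨fun t => (Z t (σ t)).re, fun t => g t / Real.pi,
    fun t => edgeDensity (G t) (Z t (σ t)).re q, hE0, fun t ht => ?_, fun t ht => ?_,
    fun s hs t ht => ?_, fun t ht => ⟨?_, ?_, ?_, ?_⟩, fun η hη => ?_, fun s hs t ht => ?_⟩
  · exact (hG t ht).hasSqrtEdge hV (by linarith [hg t ht] : (0 : ℝ) < g t).ne' (hright t ht)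
  · obtain ⟨h1, h2⟩ := (hG t ht).integrable_and_eq hV (hright t ht)
    refine ⟨h1, ?_⟩
    have h3 := hf.hasDerivWithinAt_critical hσ ht
    rw [← (hσg t ht).2.2.2.1, ← h2, neg_add'] at h3
    exact h3.congr_of_mem (fun s hs => (hZre s hs).symm) ht
  · refine (hElip s hs t ht).trans ?_
    gcongr
    linarith
  · have := hg t ht
    have : 0 < g t := by linarith
    positivity
  · exact (hG t ht).continuous_edgeDensity.measurable
  · exact (hG t ht).edgeDensity_nonneg hV
  · have h1 := congrArg (fun ν : Measure ℝ => ν.restrict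
      (Icc ((Z t (σ t)).re - q ^ 2 / 4) ((Z t (σ t)).re + q ^ 2 / 4))) ((hG t ht).restrict_eq hV)
    have h2 : Icc ((Z t (σ t)).re - q ^ 2 / 4) ((Z t (σ t)).re + q ^ 2 / 4) ⊆
        Ioo ((Z t (σ t)).re - q ^ 2 / 2) ((Z t (σ t)).re + q ^ 2 / 2) := fun x hx =>
      ⟨by linarith [hx.1], by linarith [hx.2]⟩
    simp only [restrict_withDensity measurableSet_Icc] at h1
    rwa [Measure.restrict_restrict_of_subset h2, Measure.restrict_restrict_of_subset h2] at h1
  -- This δ uses only the lower bound c/3 on the slopes and the common N and q, so it does not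
  -- depend on t.
  · exact ⟨min (q ^ 2 / 32) ((η * (c / 3) / (8 * N / q ^ 2 + 1)) ^ 2), by positivity,
      fun t ht x hx => (hG t ht).abs_edgeDensity_sub_le_mul hN (by positivity) (hg t ht) hη hx⟩
  · have h1 := hLip T E₀ Z U hf σ hσ t ht s hs
    rw [(hσg t ht).2.2.1, (hσg s hs).2.2.1, ← Complex.ofReal_sub, Complex.norm_real,
      Real.norm_eq_abs] at h1
    rw [← sub_div, abs_div, abs_of_pos Real.pi_pos]
    refine (div_le_self (abs_nonneg _) (by linarith [Real.pi_gt_three])).trans (h1.trans ?_)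
    gcongr
    linarith
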